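/- Let $N\ge 1$ and let $(a_i)_{i\in\mathbb Z}$, $(b_i)_{i\in\mathbb Z}$ be $N$-periodic real sequences with all $a_i>0$. Consider the continued fraction $$\varphi(z)=\cfrac{a_0^2}{z-b_1-\cfrac{a_1^2}{z-b_2-\cfrac{a_2^2}{z-b_3-\cdots}}}.$$ For $i,k$ let $D_{i,k}(z)$ be the determinant of $J-zI$, where $J$ is the $k\times k$ symmetric tridiagonal matrix with diagonal $b_i,\dots,b_{i+k-1}$ and off-diagonal entries $a_i,\dots,a_{i+k-2}$ (with $D_{i,0}=1$ and $D_{i,-1}=0$). Put $\alpha=\prod_{i=1}^N a_i$, $\Delta_{N,N}=D_{1,N-1}$ and $P(z)=(-1)^N\left(D_{1,N}(z)-a_0^2D_{2,N-2}(z)\right)=z^N+\cdots$. Let $A(h)$ be the $N\times N$ symmetric tridiagonal matrix with diagonal $b_1,\dots,b_N$ and off-diagonal entries $a_1,\dots,a_{N-1}$, with $a_Nh^{-1}$ added to its $(1,N)$ entry and $a_Nh$ to its $(N,1)$ entry, and let $\mathcal C=\{(z,h)\in\mathbb C\times\mathbb C^*:\det(A(h)-zI)=0\}$, that is, $\alpha(h+h^{-1})=P(z)$.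 Then the polynomial $P^2-4\alpha^2$ has $2N$ real zeros $\xi_1\le\xi_2\le\dots\le\xi_{2N}$, counted with multiplicity, and $\Delta_{N,N}$ has $N-1$ simple real zeros $\sigma_1<\dots<\sigma_{N-1}$. Let $\sqrt{P^2(z)-4\alpha^2}=\prod_{i=1}^{2N}\sqrt{z-\xi_i}$ with principal square roots ($\sqrt{-t}=i\sqrt t$ for $t>0$). Off the stable bands $[\xi_{2l-1},\xi_{2l}]$, $1\le l\le N$, this is the holomorphic branch asymptotic to $z^N$ at infinity, and on the bands it is the boundary value of that branch from the upper half-plane. Let $h(\sigma_j^-)=\dfrac{P(\sigma_j)-\sqrt{P^2(\sigma_j)-4\alpha^2}}{2\alpha}$, which is the value of $h$ at the point of $\mathcal C$ over $\sigma_j$ with $|h|\le 1$, and let $$r_j=\frac{\alpha\, h(\sigma_j^-)+(-1)^N a_0^2\,D_{2,N-2}(\sigma_j)}{\prod_{l\ne j}(\sigma_j-\sigma_l)},\qquad w(x)=\frac{(-1)^{N+1}}{2\pi i}\,\frac{\sqrt{P^2(x)-4\alpha^2}}{\Delta_{N,N}(x)}.$$ The convergents of the continued fraction converge near $z=\infty$,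 and their limit has an analytic prolongation $\varphi$ to the domain $\Omega$ obtained from $\mathbb C$ by removing the stable bands and the points $\sigma_1,\dots,\sigma_{N-1}$. The number $r_j$ is the residue of $\varphi$ at $\sigma_j$, in the sense that $(z-\sigma_j)\varphi(z)\to r_j$ as $z\to\sigma_j$ in $\Omega$. For all $z\in\Omega$ the following integrals converge and $$\varphi(z)=\sum_{j=1}^{N-1}\frac{r_j}{z-\sigma_j}+\sum_{l=1}^{N}\frac{(-1)^{N+1}}{2\pi i}\int_{\xi_{2l-1}}^{\xi_{2l}}\frac{\sqrt{P^2(x)-4\alpha^2}}{(z-x)\,\Delta_{N,N}(x)}\,dx .$$ Moreover all $r_j\ge 0$, $w\ge 0$ on the stable bands (with the convention $w(x)=0$ where $\Delta_{N,N}(x)=0$), and $\varphi$ is the Cauchy--Stieltjes transform $\varphi(z)=\int_{\mathbb R}\frac{d\sigma(x)}{z-x}$, $z\in\Omega$, of the positive measure $$d\sigma=\sum_{j=1}^{N-1} r_j\,\delta_{\sigma_j}+w(x)\,\mathbf 1_{\bigcup_{l}[\xi_{2l-1},\xi_{2l}]}(x)\,dx,$$ a discrete measure plus an absolutely continuous one.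 -/

import Mathlib

open Filter Topology MeasureTheory

/-- The continued fraction
`a₀² / (z - b₁ - a₁² / (z - b₂ - a₂² / (z - b₃ - ⋯)))`,
as a generalized continued fraction with head term `0`; its `k`-th convergent is `A_k(z) / B_k(z)`. -/
noncomputable def gammaFraction (a b : ℤ → ℝ) (z : ℂ) : GenContFract ℂ where
  h := 0
  s := Stream'.Seq.ofStream fun n : ℕ =>
    { a := if n = 0 then (a 0 : ℂ) ^ 2 else -(a n : ℂ) ^ 2
      b := z - (b (n + 1) : ℂ) }

/-- `φ` is the function defined by the continued fraction: on the open set `Ω` it is holomorphic, and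
near `z = ∞` it is the limit of the convergents (so that `φ` on `Ω` is the analytic prolongation of the
value of the continued fraction near infinity). -/
def IsStieltjesFunction (a b : ℤ → ℝ) (Ω : Set ℂ) (φ : ℂ → ℂ) : Prop :=
  DifferentiableOn ℂ φ Ω ∧
    ∀ᶠ z in Bornology.cobounded ℂ,
      Tendsto (fun k : ℕ => (gammaFraction a b z).convs k) atTop (𝓝 (φ z))

/-- The `k × k` tridiagonal block with diagonal `b i, …, b (i + k - 1)` and off-diagonal entries
`a i, …, a (i + k - 2)`. -/
noncomputable def jacobiBlock (a b : ℤ → ℝ) (i : ℤ) (k : ℕ) : Matrix (Fin k) (Fin k) ℂ :=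
  Matrix.of fun p q =>
    if p = q then (b (i + (p : ℕ)) : ℂ)
    else if (p : ℕ) + 1 = q then (a (i + (p : ℕ)) : ℂ)
    else if (q : ℕ) + 1 = p then (a (i + (q : ℕ)) : ℂ)
    else 0

/-- `det (J - z I)` for the tridiagonal block `J` of size `k` that starts at index `i`
(equal to `1` for `k = 0`). -/
noncomputable def jacobiDet (a b : ℤ → ℝ) (i : ℤ) (k : ℕ) (z : ℂ) : ℂ :=
  (jacobiBlock a b i k - z • (1 : Matrix (Fin k) (Fin k) ℂ)).det

/-- The finite matrix `A(h)`: the tridiagonal block with diagonal `b₁, …, b_N` and off-diagonal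
`a₁, …, a_{N-1}`, to which `a_N h⁻¹` is added in the upper right corner and `a_N h` in the lower left
corner. -/
noncomputable def periodicMatrix (N : ℕ) (a b : ℤ → ℝ) (h : ℂ) : Matrix (Fin N) (Fin N) ℂ :=
  jacobiBlock a b 1 N + Matrix.of fun p q : Fin N =>
    (if (p : ℕ) = 0 ∧ (q : ℕ) + 1 = N then (a N : ℂ) * h⁻¹ else 0) +
      (if (p : ℕ) + 1 = N ∧ (q : ℕ) = 0 then (a N : ℂ) * h else 0)

/-- The (affine) spectral curve `{(z, h) ∈ ℂ × ℂ* : det (A(h) - z I) = 0}`. -/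
def spectralCurve (N : ℕ) (a b : ℤ → ℝ) : Set (ℂ × ℂ) :=
  {p | p.2 ≠ 0 ∧
    (periodicMatrix N a b p.2 - p.1 • (1 : Matrix (Fin N) (Fin N) ℂ)).det = 0}

/-- `α = a₁ ⋯ a_N`. -/
def alphaProd (N : ℕ) (a : ℤ → ℝ) : ℝ := ∏ i ∈ Finset.Icc 1 N, a i

/-- The monic polynomial function `P(z) = z ^ N + ⋯` with
`det (A(h) - z I) = (-1)^(N+1) (α (h + h⁻¹) - P(z))`. The second determinant, of size `N - 2`, is absent
for `N = 1`. -/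
noncomputable def discrP (N : ℕ) (a b : ℤ → ℝ) (z : ℂ) : ℂ :=
  (-1) ^ N * (jacobiDet a b 1 N z -
    (a 0 : ℂ) ^ 2 * (if N = 1 then 0 else jacobiDet a b 2 (N - 2) z))

/-- The minor `Δ_{N,N}(z)` of `A(h) - z I`: the last row and the last column are removed. It does not
depend on `h`. -/
noncomputable def deltaNN (N : ℕ) (a b : ℤ → ℝ) (z : ℂ) : ℂ := jacobiDet a b 1 (N - 1) z

/-- `ξ 1 ≤ ⋯ ≤ ξ (2 N)` are the zeros of `P² - 4 α²`, all real, listed with multiplicity. -/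
def IsBranchPoints (N : ℕ) (a b : ℤ → ℝ) (ξ : ℕ → ℝ) : Prop :=
  MonotoneOn ξ (Set.Icc 1 (2 * N)) ∧
    ∀ z : ℂ, discrP N a b z ^ 2 - 4 * (alphaProd N a : ℂ) ^ 2 =
      ∏ i ∈ Finset.Icc 1 (2 * N), (z - (ξ i : ℂ))

/-- `σ 1 < ⋯ < σ (N - 1)` are the zeros of `Δ_{N,N}`, all real and simple. -/
def IsAuxiliarySpectrum (N : ℕ) (a b : ℤ → ℝ) (σ : ℕ → ℝ) : Prop :=
  StrictMonoOn σ (Set.Icc 1 (N - 1)) ∧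
    ∀ z : ℂ, deltaNN N a b z = (-1) ^ (N - 1) * ∏ j ∈ Finset.Icc 1 (N - 1), (z - (σ j : ℂ))

/-- The stable bands `[ξ_{2l-1}, ξ_{2l}]`, `1 ≤ l ≤ N`, taken together. -/
def stableBands (N : ℕ) (ξ : ℕ → ℝ) : Set ℝ :=
  ⋃ l ∈ Finset.Icc 1 N, Set.Icc (ξ (2 * l - 1)) (ξ (2 * l))

/-- The complex plane without the stable bands and without the points `σ_j`. -/
def bandDomain (N : ℕ) (ξ σ : ℕ → ℝ) : Set ℂ :=
  ((fun x : ℝ => (x : ℂ)) '' (stableBands N ξ ∪ σ '' Set.Icc 1 (N - 1)))ᶜ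

/-- The branch of `√(P²(z) - 4 α²)` that is holomorphic off the stable bands and asymptotic to `z ^ N`
at infinity. With the principal square roots used here, its value at a point of a stable band is the
boundary value from the upper half-plane. -/
noncomputable def sqrtDiscr (N : ℕ) (ξ : ℕ → ℝ) (z : ℂ) : ℂ :=
  ∏ i ∈ Finset.Icc 1 (2 * N), (z - (ξ i : ℂ)) ^ (1 / 2 : ℂ)

/-- The function `h` on the sheet `-` (the one on which `h` vanishes at infinity):
`h = (P(z) - √(P²(z) - 4 α²)) / (2 α)`. -/
noncomputable def hMinus (N : ℕ) (a b : ℤ → ℝ) (ξ : ℕ → ℝ) (z : ℂ) : ℂ :=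
  (discrP N a b z - sqrtDiscr N ξ z) / (2 * (alphaProd N a : ℂ))

/-- The number
`(α h(σ_j⁻) + (-1)^N a₀² Λ) / ∏_{l ≠ j} (σ_j - σ_l)`, where `Λ` is `det (J - σ_j I)` for the block `J` with
diagonal `b₂, …, b_{N-1}`. -/
noncomputable def resCoeff (N : ℕ) (a b : ℤ → ℝ) (ξ σ : ℕ → ℝ) (j : ℕ) : ℂ :=
  ((alphaProd N a : ℂ) * hMinus N a b ξ (σ j) +
      (-1) ^ N * (a 0 : ℂ) ^ 2 * jacobiDet a b 2 (N - 2) (σ j)) /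
    ∏ l ∈ (Finset.Icc 1 (N - 1)).erase j, ((σ j : ℂ) - (σ l : ℂ))

/-- The density `(-1)^(N+1) / (2 π i) · √(P²(x) - 4 α²) / Δ_{N,N}(x)`. -/
noncomputable def bandDensity (N : ℕ) (a b : ℤ → ℝ) (ξ : ℕ → ℝ) (x : ℝ) : ℂ :=
  (-1) ^ (N + 1) / (2 * (Real.pi : ℂ) * Complex.I) * (sqrtDiscr N ξ x / deltaNN N a b x)

/-- The measure `dσ`: the discrete measure with mass `Res(φ, σ_j⁻)` at `σ_j`, plus the absolutely
continuous measure on the stable bands with density `bandDensity`. -/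
noncomputable def spectralMeasure (N : ℕ) (a b : ℤ → ℝ) (ξ σ : ℕ → ℝ) : Measure ℝ :=
  (∑ j ∈ Finset.Icc 1 (N - 1),
      ENNReal.ofReal (resCoeff N a b ξ σ j).re • Measure.dirac (σ j)) +
    (volume.restrict (stableBands N ξ)).withDensity
      fun x => ENNReal.ofReal (bandDensity N a b ξ x).re

/-!
The convergents of the continued fraction are `A_k / B_k`, where `A_k` and `B_k` solve the same
three-term recurrence (`convNum`, `convDen`), and over one period they are transformed by a matrix of
determinant `α²` and trace `P = B_N - A_{N-1}`. The value of the fraction is the fixed point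
`φ = (α h + A_{N-1}) / B_{N-1}` of the corresponding Möbius map that belongs to the eigenvalue `α h`
with `|h| < 1` (`stieltjesFunction`).

*Interlacing.* The zeros `σ_j` of `B_{N-1}` are real and simple, and at `σ_j` one has
`P = B_N + α² / B_N`, so that `|P| ≥ 2 α` with alternating signs. Hence `P` runs through `[-2 α, 2 α]`
once between consecutive `σ_j`; this gives the `N` bands (`exists_bandData`), and off the bands
`|h| ≠ 1`, so `|h| < 1` by connectedness (`BandData.norm_hMinus_lt_one`).

*The measure.* On each band `t = P x` is a change of variables
onto `(-2 α, 2 α)`, which turns the density into `√(4 α² - t²) / (2 π P' B_{N-1})`. For fixed `t`, the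
sum over the bands of `1 / (P' B_{N-1} (z - x))` is a sum over all roots of `P = t`, and is known from
the partial fractions of `1 / ((P - t) B_{N-1})` (`BandData.sum_fiber_partialFractions`). What is left
is the Stieltjes transform of the semicircle law, whose value at `P z = α (h + h⁻¹)` is `α h`
(`integral_semicircle`). The poles at the `σ_j` come out with residues
`(α h + A_{N-1}) / B_{N-1}'`, and `BandData.stieltjes_formula` follows. Integrability of the density at
the band edges is a consequence of its positivity and of the same identity at one real point
(`BandData.integrableOn_realDensity`).
-/

/-! ### Convergents and tridiagonal determinants -/

open Polynomial in
/-- The denominator `B_k` of the `k`-th convergent, a monic real polynomial of degree `k`. It is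
`(-1) ^ k` times the determinant `D_{1,k}`. -/
noncomputable def convDen (a b : ℤ → ℝ) : ℕ → ℝ[X]
  | 0 => 1
  | 1 => X - C (b 1)
  | k + 2 => (X - C (b (k + 2))) * convDen a b (k + 1) - C (a (k + 1) ^ 2) * convDen a b k

open Polynomial in
/-- The numerator `A_k` of the `k`-th convergent, a real polynomial of degree `k - 1` if `k ≥ 1`. It is
`(-1) ^ (k - 1) a₀²` times the determinant `D_{2,k-1}`. -/
noncomputable def convNum (a b : ℤ → ℝ) : ℕ → ℝ[X]
  | 0 => 0
  | 1 => C (a 0 ^ 2)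
  | k + 2 => (X - C (b (k + 2))) * convNum a b (k + 1) - C (a (k + 1) ^ 2) * convNum a b k

open Polynomial in
/-- The monic polynomial `P = B_N - A_{N-1}`, as a real polynomial. -/
noncomputable def discrPoly (N : ℕ) (a b : ℤ → ℝ) : ℝ[X] := convDen a b N - convNum a b (N - 1)

theorem Polynomial.degree_C_mul_le_degree {R : Type*} [Semiring R] (c : R) (p : Polynomial R) :
    (Polynomial.C c * p).degree ≤ p.degree := by
  rw [← Polynomial.smul_eq_C_mul]; exact Polynomial.degree_smul_le c p

open Polynomial in
theorem convDen_monic_natDegree (a b : ℤ → ℝ) (k : ℕ) :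
    ((convDen a b k).Monic ∧ (convDen a b k).natDegree = k) ∧
      ((convDen a b (k + 1)).Monic ∧ (convDen a b (k + 1)).natDegree = k + 1) := by
  induction k with
  | zero => exact ⟨⟨monic_one, natDegree_one⟩, monic_X_sub_C _, natDegree_X_sub_C _⟩
  | succ k ih =>
    refine ⟨ih.2, ?_⟩
    obtain ⟨⟨hm0, hd0⟩, hm1, hd1⟩ := ih
    have hM : ((X - C (b (k + 2))) * convDen a b (k + 1)).Monic := (monic_X_sub_C _).mul hm1
    have hD : ((X - C (b (k + 2))) * convDen a b (k + 1)).natDegree = k + 2 := by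
      rw [(monic_X_sub_C _).natDegree_mul hm1, natDegree_X_sub_C, hd1]; ring
    have hlt : (C (a (k + 1) ^ 2) * convDen a b k).degree <
        ((X - C (b (k + 2))) * convDen a b (k + 1)).degree := by
      refine lt_of_le_of_lt (degree_C_mul_le_degree _ _) ?_
      rw [degree_eq_natDegree hM.ne_zero, degree_eq_natDegree hm0.ne_zero, hD, hd0]
      exact_mod_cast by omega
    refine ⟨hM.sub_of_left hlt, ?_⟩
    change ((X - C (b (k + 2))) * convDen a b (k + 1) - C (a (k + 1) ^ 2) * convDen a b k).natDegree = _
    rw [natDegree_sub_eq_left_of_natDegree_lt, hD]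
    rw [hD]
    exact lt_of_le_of_lt (natDegree_C_mul_le _ _) (by omega)

theorem convDen_monic (a b : ℤ → ℝ) (k : ℕ) : (convDen a b k).Monic :=
  (convDen_monic_natDegree a b k).1.1

theorem convDen_natDegree (a b : ℤ → ℝ) (k : ℕ) : (convDen a b k).natDegree = k :=
  (convDen_monic_natDegree a b k).1.2

theorem convDen_degree (a b : ℤ → ℝ) (k : ℕ) : (convDen a b k).degree = k := by
  rw [Polynomial.degree_eq_natDegree (convDen_monic a b k).ne_zero, convDen_natDegree]

open Polynomial in
theorem convNum_degree_lt (a b : ℤ → ℝ) (k : ℕ) : (convNum a b k).degree < k := by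
  have key : ∀ k, (convNum a b k).degree < k ∧ (convNum a b (k + 1)).degree < (k + 1 : ℕ) := by
    intro k
    induction k with
    | zero =>
      refine ⟨by simp [convNum], ?_⟩
      exact lt_of_le_of_lt degree_C_le (by norm_num)
    | succ k ih =>
      refine ⟨ih.2, ?_⟩
      obtain ⟨h0, h1⟩ := ih
      refine lt_of_le_of_lt (degree_sub_le _ _) (max_lt ?_ ?_)
      · refine lt_of_le_of_lt (degree_mul_le _ _) ?_
        rw [degree_X_sub_C]
        rcases eq_or_ne (convNum a b (k + 1)) 0 with h | h
        · rw [h, degree_zero]; simp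
        · rw [degree_eq_natDegree h] at h1 ⊢
          have : (convNum a b (k + 1)).natDegree < k + 1 := by exact_mod_cast h1
          exact_mod_cast by omega
      · refine lt_of_le_of_lt (degree_C_mul_le_degree _ _) (h0.trans ?_)
        exact_mod_cast by omega
  exact (key k).1

theorem discrPoly_monic {N : ℕ} (hN : 1 ≤ N) (a b : ℤ → ℝ) : (discrPoly N a b).Monic := by
  refine (convDen_monic a b N).sub_of_left ((convNum_degree_lt a b (N - 1)).trans ?_)
  rw [convDen_degree]
  exact_mod_cast by omega

theorem discrPoly_natDegree {N : ℕ} (hN : 1 ≤ N) (a b : ℤ → ℝ) :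
    (discrPoly N a b).natDegree = N := by
  have h : (convNum a b (N - 1)).degree < (convDen a b N).degree := by
    refine (convNum_degree_lt a b (N - 1)).trans ?_
    rw [convDen_degree]
    exact_mod_cast by omega
  rw [discrPoly, Polynomial.natDegree_eq_of_degree_eq (Polynomial.degree_sub_eq_left_of_degree_lt h),
    convDen_natDegree]

open Polynomial in
/-- The Casoratian of the two solutions of the three-term recurrence. -/
theorem convNum_mul_convDen_sub (a b : ℤ → ℝ) (k : ℕ) :
    convNum a b (k + 1) * convDen a b k - convNum a b k * convDen a b (k + 1) =
      C (∏ i ∈ Finset.range (k + 1), a i ^ 2) := by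
  induction k with
  | zero => simp [convNum, convDen]
  | succ k ih =>
    rw [Finset.prod_range_succ, C_mul, ← ih, convNum, convDen]
    push_cast
    ring

theorem alphaProd_sq {N : ℕ} (a : ℤ → ℝ) (hN : 1 ≤ N) (hpa : ∀ i, a (i + N) = a i) :
    ∏ i ∈ Finset.range N, a i ^ 2 = alphaProd N a ^ 2 := by
  obtain ⟨m, rfl⟩ : ∃ m, N = m + 1 := ⟨N - 1, by omega⟩
  have h0 : a ((m + 1 : ℕ) : ℤ) = a 0 := by simpa using hpa 0
  rw [alphaProd, Finset.prod_pow, Finset.prod_Icc_succ_top (by omega), h0, Finset.prod_range_succ']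
  congr 2
  rw [Finset.range_eq_Ico, Finset.prod_Ico_add' (fun i : ℕ => a i) 0 m 1]
  rfl

/-- The tridiagonal determinant expanded along its first row. -/
theorem jacobiDet_succ_succ (a b : ℤ → ℝ) (i : ℤ) (k : ℕ) (z : ℂ) :
    jacobiDet a b i (k + 2) z = (b i - z) * jacobiDet a b (i + 1) (k + 1) z -
      (a i : ℂ) ^ 2 * jacobiDet a b (i + 2) k z := by
  have h1 : (jacobiBlock a b i (k + 2) - z • (1 : Matrix (Fin (k + 2)) (Fin (k + 2)) ℂ)).submatrix
      Fin.succ (Fin.succAbove 0) = jacobiBlock a b (i + 1) (k + 1) - z • 1 := by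
    ext p q
    simp [jacobiBlock, Matrix.one_apply, Fin.ext_iff, add_assoc, add_comm (1 : ℤ)]
  have h3 : (jacobiBlock a b i (k + 2) - z • (1 : Matrix (Fin (k + 2)) (Fin (k + 2)) ℂ)).submatrix
      (Fin.succ ∘ Fin.succ) (Fin.succAbove 1 ∘ Fin.succ) = jacobiBlock a b (i + 2) k - z • 1 := by
    ext p q
    simp [jacobiBlock, Matrix.one_apply, Fin.ext_iff, add_assoc, add_comm (2 : ℤ),
      one_add_one_eq_two]
  have h2 : ((jacobiBlock a b i (k + 2) - z • (1 : Matrix (Fin (k + 2)) (Fin (k + 2)) ℂ)).submatrix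
      Fin.succ (Fin.succAbove (Fin.succ 0))).det =
      a i * (jacobiBlock a b (i + 2) k - z • (1 : Matrix (Fin k) (Fin k) ℂ)).det := by
    rw [Matrix.det_succ_column_zero, Fin.sum_univ_succ, Finset.sum_eq_zero]
    · simp [← h3]
      simp [jacobiBlock]
    · intro j _
      simp [jacobiBlock, Fin.ext_iff]
  unfold jacobiDet
  rw [Matrix.det_succ_row_zero, Fin.sum_univ_succ, Fin.sum_univ_succ, Finset.sum_eq_zero, h1, h2]
  · simp [jacobiBlock]
    ring
  · intro j _
    simp [jacobiBlock, Fin.ext_iff]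

theorem jacobiDet_zero (a b : ℤ → ℝ) (i : ℤ) (z : ℂ) : jacobiDet a b i 0 z = 1 := by
  simp [jacobiDet]

theorem jacobiDet_one (a b : ℤ → ℝ) (i : ℤ) (z : ℂ) : jacobiDet a b i 1 z = b i - z := by
  simp [jacobiDet, jacobiBlock]

/-- The expansion along the last row, obtained from the one along the first row by induction. -/
theorem jacobiDet_succ_succ' (a b : ℤ → ℝ) (i : ℤ) (k : ℕ) (z : ℂ) :
    jacobiDet a b i (k + 2) z = (b (i + k + 1) - z) * jacobiDet a b i (k + 1) z -
      (a (i + k) : ℂ) ^ 2 * jacobiDet a b i k z := by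
  induction k using Nat.strong_induction_on generalizing i with
  | _ k ih =>
    match k with
    | 0 =>
      rw [jacobiDet_succ_succ]
      simp only [jacobiDet_zero, jacobiDet_one, Nat.cast_zero, add_zero, zero_add]
      ring
    | 1 =>
      rw [jacobiDet_succ_succ, jacobiDet_succ_succ a b i, jacobiDet_succ_succ a b (i + 1)]
      simp only [jacobiDet_zero, jacobiDet_one, zero_add, Nat.cast_one]
      rw [show i + 1 + 1 = i + 2 by ring]
      ring
    | m + 2 =>
      have h1 := ih (m + 1) (by omega) (i + 1)
      have h2 := ih m (by omega) (i + 2)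
      rw [jacobiDet_succ_succ a b i (m + 2), jacobiDet_succ_succ a b i (m + 1),
        jacobiDet_succ_succ a b i m, h1, h2]
      push_cast
      rw [show i + 1 + ((m : ℤ) + 1) + 1 = i + m + 3 by ring,
        show i + 1 + ((m : ℤ) + 1) = i + m + 2 by ring,
        show i + 2 + (m : ℤ) + 1 = i + m + 3 by ring,
        show i + 2 + (m : ℤ) = i + m + 2 by ring,
        show i + ((m : ℤ) + 2) + 1 = i + m + 3 by ring,
        show i + ((m : ℤ) + 2) = i + m + 2 by ring]
      ring

open Polynomial in
theorem jacobiDet_one_eq (a b : ℤ → ℝ) (k : ℕ) (z : ℂ) :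
    jacobiDet a b 1 k z = (-1) ^ k * aeval z (convDen a b k) := by
  have key : ∀ k : ℕ, jacobiDet a b 1 k z = (-1) ^ k * aeval z (convDen a b k) ∧
      jacobiDet a b 1 (k + 1) z = (-1) ^ (k + 1) * aeval z (convDen a b (k + 1)) := by
    intro k
    induction k with
    | zero => simp [jacobiDet_zero, jacobiDet_one, convDen]
    | succ k ih =>
      refine ⟨ih.2, ?_⟩
      rw [jacobiDet_succ_succ', ih.1, ih.2, convDen]
      simp only [map_sub, map_mul, aeval_X, aeval_C, Complex.coe_algebraMap]
      rw [show (1 : ℤ) + k + 1 = k + 2 by ring, show (1 : ℤ) + k = k + 1 by ring]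
      push_cast
      ring
  exact (key k).1

open Polynomial in
theorem jacobiDet_two_eq (a b : ℤ → ℝ) (k : ℕ) (z : ℂ) :
    (a 0 : ℂ) ^ 2 * jacobiDet a b 2 k z = (-1) ^ k * aeval z (convNum a b (k + 1)) := by
  have key : ∀ k : ℕ, (a 0 : ℂ) ^ 2 * jacobiDet a b 2 k z =
        (-1) ^ k * aeval z (convNum a b (k + 1)) ∧
      (a 0 : ℂ) ^ 2 * jacobiDet a b 2 (k + 1) z =
        (-1) ^ (k + 1) * aeval z (convNum a b (k + 2)) := by
    intro k
    induction k with
    | zero => simp [jacobiDet_zero, jacobiDet_one, convNum]; ring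
    | succ k ih =>
      refine ⟨ih.2, ?_⟩
      rw [jacobiDet_succ_succ', convNum]
      simp only [map_sub, map_mul, aeval_X, aeval_C, Complex.coe_algebraMap]
      push_cast
      rw [show (2 : ℤ) + k + 1 = k + 1 + 2 by ring, show (2 : ℤ) + k = k + 1 + 1 by ring]
      linear_combination (b (k + 1 + 2) - z) * ih.2 - (a (k + 1 + 1) : ℂ) ^ 2 * ih.1
  exact (key k).1

open Polynomial in
theorem discrP_eq {N : ℕ} (hN : 1 ≤ N) (a b : ℤ → ℝ) (z : ℂ) :
    discrP N a b z = aeval z (discrPoly N a b) := by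
  rw [discrP, discrPoly, map_sub, jacobiDet_one_eq]
  have h1 : ((-1 : ℂ) ^ N) * (-1) ^ N = 1 := by rw [← mul_pow]; simp
  split_ifs with h
  · subst h; simp [convNum]
  · obtain ⟨m, rfl⟩ : ∃ m, N = m + 2 := ⟨N - 2, by omega⟩
    rw [jacobiDet_two_eq, show m + 2 - 2 = m by omega, show m + 2 - 1 = m + 1 by omega]
    linear_combination (aeval z (convDen a b (m + 2)) - aeval z (convNum a b (m + 1))) * h1

open Polynomial in
theorem deltaNN_eq (N : ℕ) (a b : ℤ → ℝ) (z : ℂ) :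
    deltaNN N a b z = (-1) ^ (N - 1) * aeval z (convDen a b (N - 1)) :=
  jacobiDet_one_eq a b (N - 1) z

theorem Polynomial.aeval_complex_ofReal (p : Polynomial ℝ) (x : ℝ) :
    Polynomial.aeval (x : ℂ) p = ((p.eval x : ℝ) : ℂ) := by
  simpa using Polynomial.aeval_algebraMap_apply ℂ x p

/-! ### Real zeros and sign alternation -/

theorem prod_Icc_one_eq_prod_range {M : Type*} [CommMonoid M] (f : ℕ → M) (n : ℕ) :
    ∏ j ∈ Finset.Icc 1 n, f j = ∏ m ∈ Finset.range n, f (m + 1) := by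
  rw [Finset.range_eq_Ico, Finset.prod_Ico_add' f 0 n 1]
  rfl

theorem sum_Icc_one_eq_sum_range {M : Type*} [AddCommMonoid M] (f : ℕ → M) (n : ℕ) :
    ∑ j ∈ Finset.Icc 1 n, f j = ∑ m ∈ Finset.range n, f (m + 1) := by
  rw [Finset.range_eq_Ico, Finset.sum_Ico_add' f 0 n 1]
  rfl

/-- The sign of `∏ (x - y j)` is `(-1)` to the number of `y j` beyond `x`. -/
theorem prod_sub_eq_sign_mul_prod_abs (y : ℕ → ℝ) (x : ℝ) (i k : ℕ) (hik : i ≤ k)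
    (h1 : ∀ j ∈ Finset.Icc 1 k, j ≤ i → y j ≤ x) (h2 : ∀ j ∈ Finset.Icc 1 k, i < j → x ≤ y j) :
    ∏ j ∈ Finset.Icc 1 k, (x - y j) = (-1) ^ (k + i) * ∏ j ∈ Finset.Icc 1 k, |x - y j| := by
  induction k, hik using Nat.le_induction with
  | base =>
    rw [← two_mul, pow_mul, neg_one_sq, one_pow, one_mul]
    refine Finset.prod_congr rfl fun j hj => ?_
    rw [abs_of_nonneg (sub_nonneg.2 (h1 j hj (Finset.mem_Icc.1 hj).2))]
  | succ k hik ih =>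
    have hsub : ∀ j ∈ Finset.Icc 1 k, j ∈ Finset.Icc 1 (k + 1) := fun j hj =>
      Finset.mem_Icc.2 ⟨(Finset.mem_Icc.1 hj).1, (Finset.mem_Icc.1 hj).2.trans (Nat.le_succ k)⟩
    rw [Finset.prod_Icc_succ_top (by omega), Finset.prod_Icc_succ_top (by omega),
      ih (fun j hj => h1 j (hsub j hj)) (fun j hj => h2 j (hsub j hj)),
      abs_of_nonpos (sub_nonpos.2 (h2 (k + 1) (Finset.mem_Icc.2 ⟨by omega, le_rfl⟩) (by omega)))]
    ring

open Polynomial in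
/-- A monic polynomial tends to `+∞` at `+∞`, and to `(-1) ^ n ∞` at `-∞`. -/
theorem Polynomial.Monic.exists_large_abscissa {p : ℝ[X]} (hp : p.Monic) {n : ℕ} (hn : 1 ≤ n)
    (hd : p.natDegree = n) (c m : ℝ) :
    ∃ M, m < M ∧ c < p.eval M ∧ c < (-1) ^ n * p.eval (-M) := by
  have h1 : Tendsto (fun x => eval x p) atTop atTop :=
    tendsto_atTop_of_leadingCoeff_nonneg p
      (natDegree_pos_iff_degree_pos.1 (by omega)) (by rw [hp.leadingCoeff]; exact zero_le_one)
  have hl : (C ((-1) ^ n) * p.comp (-X)).leadingCoeff = 1 := by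
    rw [leadingCoeff_mul, leadingCoeff_C, leadingCoeff_comp (by simp), hp.leadingCoeff, hd]
    simp [← mul_pow]
  have hdd : (C ((-1 : ℝ) ^ n) * p.comp (-X)).natDegree = n := by
    rw [natDegree_C_mul (by simp), natDegree_comp, hd]; simp
  have h2 : Tendsto (fun x => eval x (C ((-1) ^ n) * p.comp (-X))) atTop atTop :=
    tendsto_atTop_of_leadingCoeff_nonneg _
      (natDegree_pos_iff_degree_pos.1 (by omega)) (by rw [hl]; exact zero_le_one)
  obtain ⟨M, hM, hM1, hM2⟩ := ((eventually_gt_atTop m).and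
    ((h1.eventually_gt_atTop c).and (h2.eventually_gt_atTop c))).exists
  exact ⟨M, hM, hM1, by simpa using hM2⟩

open Polynomial in
/-- A monic polynomial of degree `N` whose signs alternate along `y 0 < ⋯ < y N` has a simple root in
each of the `N` gaps. -/
theorem Polynomial.Monic.exists_eq_prod_of_alternating {p : ℝ[X]} (hp : p.Monic) {N : ℕ}
    (hd : p.natDegree = N) {y : ℕ → ℝ} (hy : StrictMonoOn y (Set.Iic N))
    (hs : ∀ i ≤ N, 0 < (-1) ^ (N + i) * p.eval (y i)) :
    ∃ x : ℕ → ℝ, (∀ m < N, y m < x m ∧ x m < y (m + 1)) ∧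
      p = ∏ m ∈ Finset.range N, (X - C (x m)) := by
  have hroot : ∀ m, ∃ x, m < N → (y m < x ∧ x < y (m + 1)) ∧ p.eval x = 0 := by
    intro m
    by_cases hm : m < N
    · have hlt : y m < y (m + 1) := hy (Set.mem_Iic.2 hm.le) (Set.mem_Iic.2 hm) (Nat.lt_succ_self m)
      have h1 := hs m hm.le
      have h2 := hs (m + 1) hm
      have hc : ContinuousOn (fun x => (-1) ^ (N + m) * p.eval x) (Set.Icc (y m) (y (m + 1))) := by
        fun_prop
      have hmem : (0 : ℝ) ∈ Set.Ioo ((-1) ^ (N + m) * p.eval (y (m + 1)))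
          ((-1) ^ (N + m) * p.eval (y m)) := by
        refine ⟨?_, h1⟩
        rw [← add_assoc, pow_succ] at h2
        linarith
      obtain ⟨x, hx, hx0⟩ := intermediate_value_Ioo' hlt.le hc hmem
      refine ⟨x, fun _ => ⟨hx, ?_⟩⟩
      simpa using hx0
    · exact ⟨0, fun h => absurd h hm⟩
  choose x hx using hroot
  have hmono : StrictMonoOn x (Set.Iio N) := by
    intro i hi j hj hij
    have h1 := (hx i hi).1.2
    have h2 := (hx j hj).1.1
    have h3 : y (i + 1) ≤ y j := hy.monotoneOn (Set.mem_Iic.2 (Nat.succ_le_of_lt hi))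
      (Set.mem_Iic.2 (le_of_lt hj)) hij
    linarith
  refine ⟨x, fun m hm => (hx m hm).1, ?_⟩
  have hmon : (∏ m ∈ Finset.range N, (X - C (x m))).Monic := monic_prod_of_monic _ _ fun _ _ => monic_X_sub_C _
  have hnd : (∏ m ∈ Finset.range N, (X - C (x m))).natDegree = N := by
    rw [natDegree_prod_of_monic _ _ fun _ _ => monic_X_sub_C _]; simp
  refine Polynomial.eq_of_degree_sub_lt_of_eval_index_eq (v := x) (Finset.range N) ?_ ?_ ?_
  · exact hmono.injOn.mono (by intro i hi; simpa using hi)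
  · refine (degree_sub_lt_left ?_ hp.ne_zero ?_).trans_eq ?_
    · rw [degree_eq_natDegree hp.ne_zero, degree_eq_natDegree hmon.ne_zero, hd, hnd]
    · rw [hp.leadingCoeff, hmon.leadingCoeff]
    · rw [degree_eq_natDegree hp.ne_zero, hd, Finset.card_range]
  · intro i hi
    rw [(hx i (Finset.mem_range.1 hi)).2, eval_prod, Finset.prod_eq_zero hi (by simp)]

open Polynomial in
/-- The zeros of `B_k` are real and simple, and `B_{k-1}` alternates in sign along them. -/
theorem exists_convDen_eq_prod (a b : ℤ → ℝ) (ha : ∀ i, 0 < a i) (k : ℕ) :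
    ∃ y : ℕ → ℝ, StrictMonoOn y (Set.Icc 1 (k + 1)) ∧
      convDen a b (k + 1) = ∏ j ∈ Finset.Icc 1 (k + 1), (X - C (y j)) ∧
      ∀ j ∈ Finset.Icc 1 (k + 1), 0 < (-1) ^ (k + 1 + j) * (convDen a b k).eval (y j) := by
  induction k with
  | zero =>
    refine ⟨fun _ => b 1, ?_, by simp [convDen], ?_⟩
    · intro i hi j hj hij
      obtain ⟨h1, h2⟩ := hi
      obtain ⟨h3, h4⟩ := hj
      omega
    · intro j hj
      have : j = 1 := by simpa using hj
      subst this
      simp [convDen]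
  | succ k ih =>
    obtain ⟨y, hy, hB, hsgn⟩ := ih
    obtain ⟨M, hM, hM1, hM2⟩ := (convDen_monic a b (k + 2)).exists_large_abscissa (by omega)
      (convDen_natDegree a b (k + 2)) 0 (∑ j ∈ Finset.Icc 1 (k + 1), |y j|)
    have hyM : ∀ j ∈ Finset.Icc 1 (k + 1), |y j| < M := fun j hj =>
      lt_of_le_of_lt (Finset.single_le_sum (f := fun j => |y j|) (fun i _ => abs_nonneg _) hj) hM
    -- the zeros of `B_{k+1}` completed by two points beyond all zeros
    set Y : ℕ → ℝ := fun j => if j = 0 then -M else if j = k + 2 then M else y j with hY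
    have hY0 : Y 0 = -M := by simp [hY]
    have hYtop : Y (k + 2) = M := by simp [hY]
    have hYj : ∀ j ∈ Finset.Icc 1 (k + 1), Y j = y j := by
      intro j hj
      obtain ⟨h1, h2⟩ := Finset.mem_Icc.1 hj
      simp only [hY]
      rw [if_neg (by omega), if_neg (by omega)]
    have hM0 : 0 < M := lt_of_le_of_lt (Finset.sum_nonneg fun i _ => abs_nonneg _) hM
    have hYmono : StrictMonoOn Y (Set.Iic (k + 2)) := by
      refine strictMonoOn_of_lt_succ Set.ordConnected_Iic ?_
      intro i _ _ hi
      have hi' : i + 1 ≤ k + 2 := hi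
      change Y i < Y (i + 1)
      rcases Nat.eq_zero_or_pos i with h0 | h0
      · subst h0
        rw [hY0, zero_add, hYj 1 (Finset.mem_Icc.2 ⟨le_rfl, by omega⟩)]
        exact neg_lt_of_abs_lt (hyM 1 (Finset.mem_Icc.2 ⟨le_rfl, by omega⟩))
      · have hi1 : i ∈ Finset.Icc 1 (k + 1) := Finset.mem_Icc.2 ⟨h0, by omega⟩
        rcases Nat.lt_or_ge i (k + 1) with h1 | h1
        · have hi2 : i + 1 ∈ Finset.Icc 1 (k + 1) := Finset.mem_Icc.2 ⟨by omega, by omega⟩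
          rw [hYj i hi1, hYj _ hi2]
          exact hy (Finset.mem_Icc.1 hi1) (Finset.mem_Icc.1 hi2) (Nat.lt_succ_self i)
        · have : i = k + 1 := by omega
          subst this
          rw [hYj _ hi1, hYtop]
          exact lt_of_abs_lt (hyM _ hi1)
    have halt : ∀ i ≤ k + 2, 0 < (-1) ^ (k + 2 + i) * (convDen a b (k + 2)).eval (Y i) := by
      intro i hi
      rcases Nat.eq_zero_or_pos i with h0 | h0
      · subst h0; rw [hY0]; exact hM2
      rcases Nat.lt_or_ge i (k + 2) with h1 | h1
      · have hi1 : i ∈ Finset.Icc 1 (k + 1) := Finset.mem_Icc.2 ⟨h0, by omega⟩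
        have h3 : (convDen a b (k + 1)).eval (y i) = 0 := by
          rw [hB, eval_prod]; exact Finset.prod_eq_zero hi1 (by simp)
        rw [hYj i hi1, convDen]
        simp only [eval_sub, eval_mul, h3, mul_zero, zero_sub, eval_C]
        have h4 := hsgn i hi1
        have h5 := ha (k + 1)
        have h6 : (-1 : ℝ) ^ (k + 2 + i) * -(a (k + 1) ^ 2 * eval (y i) (convDen a b k)) =
          a (k + 1) ^ 2 * ((-1) ^ (k + 1 + i) * (convDen a b k).eval (y i)) := by ring
        rw [h6]; positivity
      · have : i = k + 2 := by omega
        subst this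
        rw [hYtop, ← two_mul, pow_mul]; simpa using hM1
    obtain ⟨x, hx, hBx⟩ := (convDen_monic a b (k + 2)).exists_eq_prod_of_alternating
      (convDen_natDegree a b (k + 2)) hYmono halt
    refine ⟨fun j => x (j - 1), ?_, ?_, ?_⟩
    · rintro i ⟨hi1, hi2⟩ j ⟨hj1, hj2⟩ hij
      have h1 := (hx (i - 1) (by omega)).2
      have h2 := (hx (j - 1) (by omega)).1
      have h3 : Y (i - 1 + 1) ≤ Y (j - 1) := hYmono.monotoneOn (Set.mem_Iic.2 (by omega))
        (Set.mem_Iic.2 (by omega)) (by omega)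
      exact h1.trans_le (h3.trans h2.le)
    · rw [hBx, prod_Icc_one_eq_prod_range]
      simp
    · intro j hj
      obtain ⟨hj1, hj2⟩ := Finset.mem_Icc.1 hj
      have hxj := hx (j - 1) (by omega)
      rw [hB, eval_prod]
      simp only [eval_sub, eval_X, eval_C]
      have hleft : ∀ i ∈ Finset.Icc 1 (k + 1), i ≤ j - 1 → y i < x (j - 1) := by
        intro i hi hij
        rw [← hYj i hi]
        exact lt_of_le_of_lt (hYmono.monotoneOn (Set.mem_Iic.2 (by have := (Finset.mem_Icc.1 hi).2; omega))
          (Set.mem_Iic.2 (by omega)) hij) hxj.1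
      have hright : ∀ i ∈ Finset.Icc 1 (k + 1), j - 1 < i → x (j - 1) < y i := by
        intro i hi hij
        rw [← hYj i hi]
        exact lt_of_lt_of_le hxj.2 (hYmono.monotoneOn (Set.mem_Iic.2 (by omega))
          (Set.mem_Iic.2 (by have := (Finset.mem_Icc.1 hi).2; omega)) (by omega))
      rw [prod_sub_eq_sign_mul_prod_abs y _ (j - 1) (k + 1) (by omega)
        (fun i hi h => (hleft i hi h).le) (fun i hi h => (hright i hi h).le), ← mul_assoc, ← pow_add]
      rw [show k + 1 + 1 + j + (k + 1 + (j - 1)) = 2 * (k + 1 + j) by omega, pow_mul, neg_one_sq,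
        one_pow, one_mul]
      refine Finset.prod_pos fun i hi => abs_pos.2 ?_
      rcases Nat.lt_or_ge (j - 1) i with h | h
      · exact sub_ne_zero.2 (hright i hi h).ne
      · exact sub_ne_zero.2 (hleft i hi h).ne'

/-! ### Levels of an oscillating polynomial and interlacing -/

open Polynomial in
/-- The levels `p = t` for `|t| ≤ c`, when `p` oscillates between the levels `±c` along
`y 0 < ⋯ < y N`. The extreme levels `t = ±c`, where zeros may coalesce, are reached by compactness. -/
theorem Polynomial.Monic.exists_sub_C_eq_prod {p : ℝ[X]} (hp : p.Monic) {N : ℕ} (hN : 1 ≤ N)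
    (hd : p.natDegree = N) {y : ℕ → ℝ} (hy : StrictMonoOn y (Set.Iic N)) {c : ℝ} (hc : 0 < c)
    (hs : ∀ i ≤ N, c ≤ (-1) ^ (N + i) * p.eval (y i)) :
    (∀ t ∈ Set.Ioo (-c) c, ∃ x : ℕ → ℝ, (∀ m < N, y m < x m ∧ x m < y (m + 1)) ∧
      p - C t = ∏ m ∈ Finset.range N, (X - C (x m))) ∧
    ∀ t ∈ Set.Icc (-c) c, ∃ x : ℕ → ℝ, (∀ m < N, y m ≤ x m ∧ x m ≤ y (m + 1)) ∧
      p - C t = ∏ m ∈ Finset.range N, (X - C (x m)) := by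
  have hopen : ∀ t ∈ Set.Ioo (-c) c, ∃ x : ℕ → ℝ, (∀ m < N, y m < x m ∧ x m < y (m + 1)) ∧
      p - C t = ∏ m ∈ Finset.range N, (X - C (x m)) := by
    intro t ht
    have hmon : (p - C t).Monic := by
      refine hp.sub_of_left (lt_of_le_of_lt degree_C_le ?_)
      rw [degree_eq_natDegree hp.ne_zero, hd]
      exact_mod_cast hN
    refine hmon.exists_eq_prod_of_alternating (by rw [natDegree_sub_C, hd]) hy fun i hi => ?_
    have h1 := hs i hi
    rw [eval_sub, eval_C, mul_sub]
    rcases neg_one_pow_eq_or ℝ (N + i) with h | h <;> rw [h] at h1 ⊢ <;> linarith [ht.1, ht.2]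
  refine ⟨hopen, fun t ht => ?_⟩
  set K : Set (Fin N → ℝ) := Set.pi Set.univ fun m => Set.Icc (y m) (y (m + 1)) with hK
  have hKc : IsCompact K := isCompact_univ_pi fun m => isCompact_Icc
  set E : Set (ℝ × (Fin N → ℝ)) := (Set.Icc (-c) c ×ˢ K) ∩
    {q | ∀ z : ℝ, p.eval z - q.1 = ∏ m, (z - q.2 m)} with hE
  have hEc : IsCompact E := by
    refine (isCompact_Icc.prod hKc).inter_right ?_
    simp only [Set.ofPred_forall]
    exact isClosed_iInter fun z => isClosed_eq (by fun_prop) (by fun_prop)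
  have hsub : Set.Ioo (-c) c ⊆ Prod.fst '' E := by
    intro s hsm
    obtain ⟨x, hx, hpx⟩ := hopen s hsm
    refine ⟨(s, fun m => x m), ⟨⟨Set.Ioo_subset_Icc_self hsm, ?_⟩, ?_⟩, rfl⟩
    · intro m _
      exact ⟨(hx m m.2).1.le, (hx m m.2).2.le⟩
    · intro z
      have := congrArg (eval z) hpx
      simp only [eval_sub, eval_C, eval_prod, eval_X] at this
      rw [this, Finset.prod_range]
  have hmem : t ∈ Prod.fst '' E := by
    have hcl : IsClosed (Prod.fst '' E) := (hEc.image continuous_fst).isClosed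
    have := closure_minimal hsub hcl
    rw [closure_Ioo (by linarith)] at this
    exact this ht
  obtain ⟨⟨s, x⟩, ⟨⟨_, hxK⟩, hxp⟩, rfl⟩ := hmem
  refine ⟨fun m => if h : m < N then x ⟨m, h⟩ else 0, fun m hm => ?_, ?_⟩
  · simpa [hm] using hxK ⟨m, hm⟩ (Set.mem_univ _)
  · refine Polynomial.funext fun z => ?_
    simp only [eval_sub, eval_C, eval_prod, eval_X, Finset.prod_range]
    simpa using hxp z

/-- The interlacing of the zeros of `B_{N-1}` with the branch points. The sequence `σ` is completed by
two points `σ 0` and `σ N` beyond all branch points, so that the `m`-th band (from `0`)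
`[ξ (2 m + 1), ξ (2 m + 2)]` lies in `[σ m, σ (m + 1)]`. -/
structure BandData (N : ℕ) (a b : ℤ → ℝ) (ξ σ : ℕ → ℝ) : Prop where
  one_le : 1 ≤ N
  alpha_pos : 0 < alphaProd N a
  strictMono : StrictMonoOn σ (Set.Iic N)
  den_eq : convDen a b (N - 1) =
    ∏ j ∈ Finset.Icc 1 (N - 1), (Polynomial.X - Polynomial.C (σ j))
  two_alpha_le : ∀ i ≤ N, 2 * alphaProd N a ≤ (-1) ^ (N + i) * (discrPoly N a b).eval (σ i)
  den_pos : ∀ j ∈ Finset.Icc 1 (N - 1), 0 < (-1) ^ (N + j) * (convDen a b N).eval (σ j)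
  num_mul_den : ∀ j ∈ Finset.Icc 1 (N - 1),
    (convNum a b (N - 1)).eval (σ j) * (convDen a b N).eval (σ j) = -alphaProd N a ^ 2
  le_left : ∀ m < N, σ m ≤ ξ (2 * m + 1)
  left_le_right : ∀ m, ξ (2 * m + 1) ≤ ξ (2 * m + 2)
  right_le : ∀ m < N, ξ (2 * m + 2) ≤ σ (m + 1)
  disc_eq : discrPoly N a b ^ 2 - Polynomial.C (4 * alphaProd N a ^ 2) =
    ∏ m ∈ Finset.range N, ((Polynomial.X - Polynomial.C (ξ (2 * m + 1))) *
      (Polynomial.X - Polynomial.C (ξ (2 * m + 2))))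

open Polynomial in
theorem exists_bandData (N : ℕ) (hN : 1 ≤ N) (a b : ℤ → ℝ) (ha : ∀ i, 0 < a i)
    (hpa : ∀ i, a (i + N) = a i) : ∃ ξ σ : ℕ → ℝ, BandData N a b ξ σ := by
  have hα : 0 < alphaProd N a := Finset.prod_pos fun i _ => ha i
  set α := alphaProd N a with hαdef
  set P := discrPoly N a b with hP
  -- the zeros of `B_{N-1}`
  obtain ⟨y, hy, hB, hBs⟩ : ∃ y : ℕ → ℝ, StrictMonoOn y (Set.Icc 1 (N - 1)) ∧
      convDen a b (N - 1) = ∏ j ∈ Finset.Icc 1 (N - 1), (X - C (y j)) ∧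
      ∀ j ∈ Finset.Icc 1 (N - 1), 0 < (-1) ^ (N + j) * (convDen a b N).eval (y j) := by
    rcases Nat.eq_or_lt_of_le hN with h | h
    · subst h
      exact ⟨fun _ => 0, fun i hi => absurd hi (by simp), by simp [convDen], by simp⟩
    · obtain ⟨k, rfl⟩ : ∃ k, N = k + 2 := ⟨N - 2, by omega⟩
      obtain ⟨y, hy, hB, hs⟩ := exists_convDen_eq_prod a b ha k
      refine ⟨y, hy, hB, fun j hj => ?_⟩
      have h3 : (convDen a b (k + 1)).eval (y j) = 0 := by
        rw [hB, eval_prod]; exact Finset.prod_eq_zero hj (by simp)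
      rw [convDen]
      simp only [eval_sub, eval_mul, h3, mul_zero, zero_sub, eval_C]
      have h4 := hs j hj
      have h5 := ha (k + 1)
      have h6 : (-1 : ℝ) ^ (k + 2 + j) * -(a (k + 1) ^ 2 * eval (y j) (convDen a b k)) =
        a (k + 1) ^ 2 * ((-1) ^ (k + 1 + j) * (convDen a b k).eval (y j)) := by ring
      rw [h6]; positivity
  have hcas : ∀ j ∈ Finset.Icc 1 (N - 1),
      (convNum a b (N - 1)).eval (y j) * (convDen a b N).eval (y j) = -α ^ 2 := by
    intro j hj
    have h := congrArg (eval (y j)) (convNum_mul_convDen_sub a b (N - 1))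
    rw [Nat.sub_add_cancel hN, alphaProd_sq a hN hpa] at h
    have h3 : (convDen a b (N - 1)).eval (y j) = 0 := by
      rw [hB, eval_prod]; exact Finset.prod_eq_zero hj (by simp)
    simp only [eval_sub, eval_mul, h3, mul_zero, zero_sub, eval_C] at h
    linarith
  obtain ⟨M, hM, hM1, hM2⟩ := (discrPoly_monic hN a b).exists_large_abscissa hN
      (discrPoly_natDegree hN a b) (2 * α) (∑ j ∈ Finset.Icc 1 (N - 1), |y j|)
  have hyM : ∀ j ∈ Finset.Icc 1 (N - 1), |y j| < M := fun j hj =>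
    lt_of_le_of_lt (Finset.single_le_sum (f := fun j => |y j|) (fun i _ => abs_nonneg _) hj) hM
  set σ : ℕ → ℝ := fun j => if j = 0 then -M else if j = N then M else y j with hσ
  have hσ0 : σ 0 = -M := by simp [hσ]
  have hσN : σ N = M := by
    have h0 : N ≠ 0 := by omega
    simp [hσ, h0]
  have hσj : ∀ j ∈ Finset.Icc 1 (N - 1), σ j = y j := by
    intro j hj
    obtain ⟨h1, h2⟩ := Finset.mem_Icc.1 hj
    simp only [hσ]
    rw [if_neg (by omega), if_neg (by omega)]
  have hM0 : 0 < M := lt_of_le_of_lt (Finset.sum_nonneg fun i _ => abs_nonneg _) hM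
  have hmono : StrictMonoOn σ (Set.Iic N) := by
    refine strictMonoOn_of_lt_succ Set.ordConnected_Iic ?_
    intro i _ _ hi
    have hi' : i + 1 ≤ N := hi
    change σ i < σ (i + 1)
    have hlow : σ i < M ∧ (1 ≤ i → σ i = y i) := by
      rcases Nat.eq_zero_or_pos i with h0 | h0
      · subst h0; rw [hσ0]; exact ⟨by linarith, fun h => absurd h (by norm_num)⟩
      · have hi1 : i ∈ Finset.Icc 1 (N - 1) := Finset.mem_Icc.2 ⟨h0, by omega⟩
        rw [hσj i hi1]; exact ⟨lt_of_abs_lt (hyM i hi1), fun _ => rfl⟩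
    rcases Nat.lt_or_ge (i + 1) N with h1 | h1
    · have hi2 : i + 1 ∈ Finset.Icc 1 (N - 1) := Finset.mem_Icc.2 ⟨by omega, by omega⟩
      rw [hσj _ hi2]
      rcases Nat.eq_zero_or_pos i with h0 | h0
      · subst h0; rw [hσ0]; exact neg_lt_of_abs_lt (hyM _ hi2)
      · rw [hlow.2 h0]
        exact hy ⟨h0, by omega⟩ (Finset.mem_Icc.1 hi2) (Nat.lt_succ_self i)
    · rw [show i + 1 = N by omega, hσN]; exact hlow.1
  have halt : ∀ i ≤ N, 2 * α ≤ (-1) ^ (N + i) * P.eval (σ i) := by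
    intro i hi
    rcases Nat.eq_zero_or_pos i with h0 | h0
    · subst h0; rw [hσ0]; exact hM2.le
    rcases Nat.lt_or_ge i N with h1 | h1
    · have hi1 : i ∈ Finset.Icc 1 (N - 1) := Finset.mem_Icc.2 ⟨h0, by omega⟩
      have h2 := hBs i hi1
      have h3 := hcas i hi1
      rw [hσj i hi1, hP, discrPoly, eval_sub]
      -- `P = B_N + α² / B_N` at a zero of `B_{N-1}`
      set u := (convDen a b N).eval (y i)
      set v := (convNum a b (N - 1)).eval (y i)
      rcases neg_one_pow_eq_or ℝ (N + i) with h | h <;> rw [h] at h2 ⊢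
      · have hu : 0 < u := by linarith
        have : v = -α ^ 2 / u := by field_simp; linarith
        rw [this, ← sub_nonneg]
        have h5 : 1 * (u - -α ^ 2 / u) - 2 * α = (u - α) ^ 2 / u := by field_simp; ring
        rw [h5]; positivity
      · have hu : 0 < -u := by linarith
        have hu' : u ≠ 0 := by linarith
        have : v = -α ^ 2 / u := by field_simp; linarith
        rw [this, ← sub_nonneg]
        have h5 : -1 * (u - -α ^ 2 / u) - 2 * α = (u + α) ^ 2 / (-u) := by field_simp; ring
        rw [h5]; positivity
    · have : i = N := by omega
      subst this
      rw [hσN, ← two_mul, pow_mul]; simpa using hM1.le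
  have hlev := ((discrPoly_monic hN a b).exists_sub_C_eq_prod hN (discrPoly_natDegree hN a b) hmono
    (by positivity : 0 < 2 * α) halt).2
  obtain ⟨x, hx, hPx⟩ := hlev (2 * α) ⟨by linarith, le_rfl⟩
  obtain ⟨x', hx', hPx'⟩ := hlev (-(2 * α)) ⟨le_rfl, by linarith⟩
  set ξ : ℕ → ℝ := fun i => if i % 2 = 1 then min (x (i / 2)) (x' (i / 2)) else
    max (x (i / 2 - 1)) (x' (i / 2 - 1)) with hξ
  have hodd : ∀ m, ξ (2 * m + 1) = min (x m) (x' m) := by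
    intro m
    simp only [hξ]
    rw [if_pos (by omega), show (2 * m + 1) / 2 = m by omega]
  have heven : ∀ m, ξ (2 * m + 2) = max (x m) (x' m) := by
    intro m
    simp only [hξ]
    rw [if_neg (by omega), show (2 * m + 2) / 2 - 1 = m by omega]
  refine ⟨ξ, σ, hN, hα, hmono, ?_, halt, ?_, ?_, ?_, ?_, ?_, ?_⟩
  · rw [hB]
    exact Finset.prod_congr rfl fun j hj => by rw [hσj j hj]
  · intro j hj; rw [hσj j hj]; exact hBs j hj
  · intro j hj; rw [hσj j hj]; exact hcas j hj
  · intro m hm; rw [hodd]; exact le_min (hx m hm).1 (hx' m hm).1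
  · intro m; rw [hodd, heven]; exact min_le_max
  · intro m hm; rw [heven]; exact max_le (hx m hm).2 (hx' m hm).2
  · have h1 : P ^ 2 - C (4 * α ^ 2) = (P - C (2 * α)) * (P - C (-(2 * α))) := by
      simp only [C_mul, C_neg, C_pow]
      have : (C (4 : ℝ)) = C 2 * C 2 := by rw [← C_mul]; norm_num
      rw [this]; ring
    rw [h1, hPx, hPx', ← Finset.prod_mul_distrib]
    refine Finset.prod_congr rfl fun m _ => ?_
    rw [hodd, heven]
    rcases le_total (x m) (x' m) with h | h
    · rw [min_eq_left h, max_eq_right h]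
    · rw [min_eq_right h, max_eq_left h, mul_comm]

/-! ### The square root off the bands -/

theorem prod_Icc_one_two_mul {M : Type*} [CommMonoid M] (f : ℕ → M) (n : ℕ) :
    ∏ i ∈ Finset.Icc 1 (2 * n), f i = ∏ m ∈ Finset.range n, (f (2 * m + 1) * f (2 * m + 2)) := by
  induction n with
  | zero => simp
  | succ n ih =>
    rw [mul_add, mul_one, Finset.prod_Icc_succ_top (by omega), Finset.prod_Icc_succ_top (by omega), ih,
      Finset.prod_range_succ, mul_assoc]

theorem Complex.cpow_half_sq (w : ℂ) : (w ^ (1 / 2 : ℂ)) ^ 2 = w := by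
  rw [one_div]; exact Complex.cpow_ofNat_inv_pow w 2

/-- Principal square root of a negative number. -/
theorem Complex.cpow_half_of_nonpos {x : ℝ} (hx : x ≤ 0) :
    (x : ℂ) ^ (1 / 2 : ℂ) = Complex.I * (Real.sqrt (-x) : ℝ) := by
  rw [Complex.ofReal_cpow_of_nonpos hx, Real.sqrt_eq_rpow, Complex.ofReal_cpow (by linarith)]
  have : Complex.exp (Real.pi * Complex.I * (1 / 2)) = Complex.I := by
    rw [show (Real.pi : ℂ) * Complex.I * (1 / 2) = Real.pi / 2 * Complex.I by ring,
      Complex.exp_pi_div_two_mul_I]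
  rw [this]
  push_cast
  ring

theorem Complex.cpow_half_of_nonneg {x : ℝ} (hx : 0 ≤ x) :
    (x : ℂ) ^ (1 / 2 : ℂ) = (Real.sqrt x : ℝ) := by
  rw [Real.sqrt_eq_rpow, Complex.ofReal_cpow hx]
  norm_num

/-- On the left half-plane, the product of two principal square roots is, up to sign, the product of
the square roots of the opposites, which has no cut there. -/
theorem Complex.cpow_half_mul_cpow_half_of_re_neg {u v : ℂ} (hu : u.re < 0) (hv : v.re < 0)
    (him : u.im = v.im) :
    u ^ (1 / 2 : ℂ) * v ^ (1 / 2 : ℂ) = -((-u) ^ (1 / 2 : ℂ) * (-v) ^ (1 / 2 : ℂ)) := by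
  have hne : ∀ w : ℂ, w.re < 0 → w ≠ 0 := fun w hw h => by simp [h] at hw
  rcases lt_or_ge u.im 0 with h | h
  · have key : ∀ w : ℂ, w.re < 0 → w.im < 0 →
        w ^ (1 / 2 : ℂ) = -Complex.I * (-w) ^ (1 / 2 : ℂ) := by
      intro w hw hwi
      rw [Complex.cpow_def_of_ne_zero (hne w hw), Complex.cpow_def_of_ne_zero (neg_ne_zero.2 (hne w hw))]
      have hlog : Complex.log w = Complex.log (-w) - Real.pi * Complex.I := by
        rw [Complex.log, Complex.log, norm_neg,
          Complex.arg_neg_eq_arg_add_pi_of_im_neg hwi]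
        push_cast; ring
      rw [hlog, sub_mul, Complex.exp_sub, show (Real.pi : ℂ) * Complex.I * (1 / 2) =
        Real.pi / 2 * Complex.I by ring, Complex.exp_pi_div_two_mul_I, div_eq_mul_inv, Complex.inv_I]
      ring
    rw [key u hu h, key v hv (him ▸ h)]
    linear_combination (-u) ^ (1 / 2 : ℂ) * (-v) ^ (1 / 2 : ℂ) * Complex.I_sq
  · have key : ∀ w : ℂ, w.re < 0 → 0 ≤ w.im →
        w ^ (1 / 2 : ℂ) = Complex.I * (-w) ^ (1 / 2 : ℂ) := by
      intro w hw hwi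
      rw [Complex.cpow_def_of_ne_zero (hne w hw), Complex.cpow_def_of_ne_zero (neg_ne_zero.2 (hne w hw))]
      have hlog : Complex.log w = Complex.log (-w) + Real.pi * Complex.I := by
        rw [Complex.log, Complex.log, norm_neg]
        have : (-w).arg = w.arg - Real.pi := by
          rcases hwi.lt_or_eq with h | h
          · exact Complex.arg_neg_eq_arg_sub_pi_of_im_pos h
          · rw [Complex.arg_eq_zero_iff.2 (by simp [hw.le, ← h]),
              Complex.arg_eq_pi_iff.2 ⟨hw, h.symm⟩, sub_self]
        rw [this]; push_cast; ring
      rw [hlog, add_mul, Complex.exp_add, show (Real.pi : ℂ) * Complex.I * (1 / 2) =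
        Real.pi / 2 * Complex.I by ring, Complex.exp_pi_div_two_mul_I]
      ring
    rw [key u hu h, key v hv (him ▸ h)]
    linear_combination (-u) ^ (1 / 2 : ℂ) * (-v) ^ (1 / 2 : ℂ) * Complex.I_sq

/-- `√(z - p) √(z - q)` is holomorphic off the segment `[p, q]`. -/
theorem differentiableAt_cpow_half_mul_cpow_half {p q : ℝ} (hpq : p ≤ q) {z : ℂ}
    (hz : ∀ x ∈ Set.Icc p q, z ≠ (x : ℂ)) :
    DifferentiableAt ℂ (fun z : ℂ => (z - p) ^ (1 / 2 : ℂ) * (z - q) ^ (1 / 2 : ℂ)) z := by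
  by_cases hre : z.re < p
  · have hev : (fun z : ℂ => (z - p) ^ (1 / 2 : ℂ) * (z - q) ^ (1 / 2 : ℂ)) =ᶠ[𝓝 z]
        fun z => -((-(z - p)) ^ (1 / 2 : ℂ) * (-(z - q)) ^ (1 / 2 : ℂ)) := by
      filter_upwards [(isOpen_lt Complex.continuous_re continuous_const).mem_nhds hre] with w hw
      have hw' : w.re < p := hw
      exact Complex.cpow_half_mul_cpow_half_of_re_neg (by simpa using hw') (by simp; linarith) (by simp)
    refine DifferentiableAt.congr_of_eventuallyEq ?_ hev
    refine DifferentiableAt.neg (DifferentiableAt.mul ?_ ?_) <;>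
    · refine DifferentiableAt.cpow_const (by fun_prop) (Or.inl ?_)
      simp; linarith
  · have hslit : z - p ∈ Complex.slitPlane ∧ z - q ∈ Complex.slitPlane := by
      rw [Complex.mem_slitPlane_iff, Complex.mem_slitPlane_iff]
      simp only [Complex.sub_re, Complex.ofReal_re, Complex.sub_im, Complex.ofReal_im, sub_zero, sub_pos]
      by_cases him : z.im = 0
      · have hlt : q < z.re := by
          by_contra hcon
          exact hz z.re ⟨not_lt.1 hre, not_lt.1 hcon⟩ (Complex.ext (by simp) (by simp [him]))
        exact ⟨Or.inl (by linarith), Or.inl hlt⟩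
      · exact ⟨Or.inr him, Or.inr him⟩
    exact ((differentiableAt_id.sub_const (p : ℂ)).cpow_const hslit.1).mul
      ((differentiableAt_id.sub_const (q : ℂ)).cpow_const hslit.2)

theorem sqrtDiscr_eq_prod_range (N : ℕ) (ξ : ℕ → ℝ) (z : ℂ) :
    sqrtDiscr N ξ z = ∏ m ∈ Finset.range N,
      ((z - (ξ (2 * m + 1) : ℂ)) ^ (1 / 2 : ℂ) * (z - (ξ (2 * m + 2) : ℂ)) ^ (1 / 2 : ℂ)) := by
  rw [sqrtDiscr, prod_Icc_one_two_mul]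

theorem mem_stableBands_iff {N : ℕ} {ξ : ℕ → ℝ} {x : ℝ} :
    x ∈ stableBands N ξ ↔ ∃ m < N, x ∈ Set.Icc (ξ (2 * m + 1)) (ξ (2 * m + 2)) := by
  simp only [stableBands, Set.mem_iUnion, Finset.mem_Icc, exists_prop]
  constructor
  · rintro ⟨l, ⟨h1, h2⟩, hx⟩
    refine ⟨l - 1, by omega, ?_⟩
    rwa [show 2 * (l - 1) + 1 = 2 * l - 1 by omega, show 2 * (l - 1) + 2 = 2 * l by omega]
  · rintro ⟨m, hm, hx⟩
    refine ⟨m + 1, by omega, ?_⟩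
    rwa [show 2 * (m + 1) - 1 = 2 * m + 1 by omega, show 2 * (m + 1) = 2 * m + 2 by omega]

theorem isCompact_stableBands (N : ℕ) (ξ : ℕ → ℝ) : IsCompact (stableBands N ξ) :=
  (Finset.Icc 1 N).isCompact_biUnion fun _ _ => isCompact_Icc

/-- A compact subset of the real line does not disconnect the plane. -/
theorem isPreconnected_compl_ofReal_image {K : Set ℝ} (hK : IsCompact K) :
    IsPreconnected ((fun x : ℝ => (x : ℂ)) '' K)ᶜ := by
  obtain ⟨R, hR⟩ := hK.isBounded.subset_closedBall 0
  set U := ((fun x : ℝ => (x : ℂ)) '' K)ᶜ with hU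
  have hmem : ((|R| + 1 : ℝ) : ℂ) ∈ U := by
    rintro ⟨x, hx, hxe⟩
    have h1 := hR hx
    have h2 : x = |R| + 1 := Complex.ofReal_injective hxe
    rw [Metric.mem_closedBall, dist_zero_right, Real.norm_eq_abs] at h1
    have := le_abs_self x
    have := le_abs_self R
    linarith
  have hup : IsPreconnected (U ∩ {z : ℂ | 0 ≤ z.im}) := by
    refine IsPreconnected.subset_closure (s := {z : ℂ | 0 < z.im})
      (convex_halfSpace_im_gt 0).isPreconnected ?_ ?_
    · intro z hz
      refine ⟨?_, Set.mem_ofPred.2 (le_of_lt (Set.mem_ofPred.1 hz))⟩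
      rintro ⟨x, _, rfl⟩
      simp at hz
    · rw [Complex.closure_setOfPred_lt_im]; exact Set.inter_subset_right
  have hdown : IsPreconnected (U ∩ {z : ℂ | z.im ≤ 0}) := by
    refine IsPreconnected.subset_closure (s := {z : ℂ | z.im < 0})
      (convex_halfSpace_im_lt 0).isPreconnected ?_ ?_
    · intro z hz
      refine ⟨?_, Set.mem_ofPred.2 (le_of_lt (Set.mem_ofPred.1 hz))⟩
      rintro ⟨x, _, rfl⟩
      simp at hz
    · rw [Complex.closure_setOfPred_im_lt]; exact Set.inter_subset_right
  have hunion : U = (U ∩ {z : ℂ | 0 ≤ z.im}) ∪ (U ∩ {z : ℂ | z.im ≤ 0}) := by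
    rw [← Set.inter_union_distrib_left, Set.inter_eq_left.2]
    intro z _
    exact le_total 0 z.im
  rw [hunion]
  exact hup.union _ ⟨hmem, by simp [-Complex.ofReal_add]⟩
    ⟨hmem, by simp [-Complex.ofReal_add]⟩ hdown

namespace BandData

variable {N : ℕ} {a b : ℤ → ℝ} {ξ σ : ℕ → ℝ}

theorem sigma_le (H : BandData N a b ξ σ) {i j : ℕ} (hij : i ≤ j) (hj : j ≤ N) : σ i ≤ σ j :=
  H.strictMono.monotoneOn (Set.mem_Iic.2 (hij.trans hj)) (Set.mem_Iic.2 hj) hij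

theorem differentiableAt_sqrtDiscr (H : BandData N a b ξ σ) {z : ℂ}
    (hz : z ∉ (fun x : ℝ => (x : ℂ)) '' stableBands N ξ) :
    DifferentiableAt ℂ (sqrtDiscr N ξ) z := by
  rw [show sqrtDiscr N ξ = fun z => _ from funext (sqrtDiscr_eq_prod_range N ξ)]
  refine DifferentiableAt.fun_finsetProd fun m hm => ?_
  refine differentiableAt_cpow_half_mul_cpow_half (H.left_le_right m) fun x hx hzx => hz ?_
  exact ⟨x, mem_stableBands_iff.2 ⟨m, Finset.mem_range.1 hm, hx⟩, hzx.symm⟩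

theorem discr_sq_sub (H : BandData N a b ξ σ) (z : ℂ) :
    discrP N a b z ^ 2 - 4 * (alphaProd N a : ℂ) ^ 2 =
      ∏ i ∈ Finset.Icc 1 (2 * N), (z - (ξ i : ℂ)) := by
  have h := congrArg (Polynomial.aeval z) H.disc_eq
  rw [prod_Icc_one_two_mul, discrP_eq H.one_le]
  simp only [map_sub, map_pow, map_prod, map_mul, Polynomial.aeval_X, Polynomial.aeval_C,
    Complex.coe_algebraMap] at h
  rw [← h]
  norm_num

theorem eval_sq_sub (H : BandData N a b ξ σ) (x : ℝ) :
    (discrPoly N a b).eval x ^ 2 - 4 * alphaProd N a ^ 2 =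
      ∏ m ∈ Finset.range N, ((x - ξ (2 * m + 1)) * (x - ξ (2 * m + 2))) := by
  have h := congrArg (Polynomial.eval x) H.disc_eq
  simpa [Polynomial.eval_prod] using h

theorem sqrtDiscr_sq (H : BandData N a b ξ σ) (z : ℂ) :
    sqrtDiscr N ξ z ^ 2 = discrP N a b z ^ 2 - 4 * (alphaProd N a : ℂ) ^ 2 := by
  rw [H.discr_sq_sub, sqrtDiscr, ← Finset.prod_pow]
  exact Finset.prod_congr rfl fun i _ => Complex.cpow_half_sq _

theorem alpha_ne_zero (H : BandData N a b ξ σ) : (alphaProd N a : ℂ) ≠ 0 :=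
  Complex.ofReal_ne_zero.2 H.alpha_pos.ne'

theorem hMinus_quadratic (H : BandData N a b ξ σ) (z : ℂ) :
    (alphaProd N a : ℂ) * (hMinus N a b ξ z ^ 2 + 1) = discrP N a b z * hMinus N a b ξ z := by
  have h1 := H.sqrtDiscr_sq z
  have h2 := H.alpha_ne_zero
  rw [hMinus]
  field_simp
  linear_combination h1

theorem hMinus_ne_zero (H : BandData N a b ξ σ) (z : ℂ) : hMinus N a b ξ z ≠ 0 := by
  intro h
  have h1 := H.hMinus_quadratic z
  rw [h] at h1
  simp [H.alpha_ne_zero] at h1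

theorem alpha_mul_hMinus_add_inv (H : BandData N a b ξ σ) (z : ℂ) :
    (alphaProd N a : ℂ) * (hMinus N a b ξ z + (hMinus N a b ξ z)⁻¹) = discrP N a b z := by
  have h1 := H.hMinus_quadratic z
  have h2 := H.hMinus_ne_zero z
  field_simp
  linear_combination h1

theorem gap_factor_nonneg (H : BandData N a b ξ σ) {m k : ℕ} (hm : m < N) (hk : k < N) (hmk : m ≠ k)
    {x : ℝ} (h1 : σ m ≤ x) (h2 : x ≤ σ (m + 1)) :
    0 ≤ (x - ξ (2 * k + 1)) * (x - ξ (2 * k + 2)) := by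
  have h3 := H.left_le_right k
  rcases lt_or_gt_of_ne hmk with h | h
  · have h4 := H.sigma_le (i := m + 1) (j := k) h hk.le
    have h5 := H.le_left k hk
    exact mul_nonneg_of_nonpos_of_nonpos (by linarith) (by linarith)
  · have h4 := H.sigma_le (i := k + 1) (j := m) h hm.le
    have h5 := H.right_le k hk
    exact mul_nonneg (by linarith) (by linarith)

/-- The stable bands are the set where `|P| ≤ 2 α`. -/
theorem mem_stableBands_iff_sq_le (H : BandData N a b ξ σ) (x : ℝ) :
    x ∈ stableBands N ξ ↔ (discrPoly N a b).eval x ^ 2 ≤ 4 * alphaProd N a ^ 2 := by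
  rw [← sub_nonpos, H.eval_sq_sub, mem_stableBands_iff]
  constructor
  · rintro ⟨m, hm, hx1, hx2⟩
    rw [← Finset.mul_prod_erase _ _ (Finset.mem_range.2 hm)]
    refine mul_nonpos_of_nonpos_of_nonneg
      (mul_nonpos_of_nonneg_of_nonpos (by linarith) (by linarith)) (Finset.prod_nonneg fun k hk => ?_)
    obtain ⟨hk1, hk2⟩ := Finset.mem_erase.1 hk
    exact H.gap_factor_nonneg hm (Finset.mem_range.1 hk2) hk1.symm
      ((H.le_left m hm).trans hx1) (hx2.trans (H.right_le m hm))
  · intro h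
    by_contra hcon
    push Not at hcon
    refine absurd h (not_le.2 (Finset.prod_pos fun m hm => ?_))
    have h1 := hcon m (Finset.mem_range.1 hm)
    have h2 := H.left_le_right m
    rw [Set.mem_Icc, not_and_or, not_le, not_le] at h1
    rcases h1 with h1 | h1
    · exact mul_pos_of_neg_of_neg (by linarith) (by linarith)
    · exact mul_pos (by linarith) (by linarith)

theorem exists_fiber (H : BandData N a b ξ σ) :
    (∀ t ∈ Set.Ioo (-(2 * alphaProd N a)) (2 * alphaProd N a), ∃ x : ℕ → ℝ,
      (∀ m < N, σ m < x m ∧ x m < σ (m + 1)) ∧ discrPoly N a b - Polynomial.C t =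
        ∏ m ∈ Finset.range N, (Polynomial.X - Polynomial.C (x m))) ∧
    (∀ t ∈ Set.Icc (-(2 * alphaProd N a)) (2 * alphaProd N a), ∃ x : ℕ → ℝ,
      (∀ m < N, σ m ≤ x m ∧ x m ≤ σ (m + 1)) ∧ discrPoly N a b - Polynomial.C t =
        ∏ m ∈ Finset.range N, (Polynomial.X - Polynomial.C (x m))) :=
  (discrPoly_monic H.one_le a b).exists_sub_C_eq_prod H.one_le (discrPoly_natDegree H.one_le a b)
    H.strictMono (by have := H.alpha_pos; positivity) H.two_alpha_le

/-- All solutions of `P = t` with `|t| ≤ 2 α` are real and lie in the bands. -/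
theorem mem_bands_of_discrP_eq (H : BandData N a b ξ σ) {z : ℂ} {t : ℝ}
    (ht : t ∈ Set.Icc (-(2 * alphaProd N a)) (2 * alphaProd N a)) (hz : discrP N a b z = t) :
    z ∈ (fun x : ℝ => (x : ℂ)) '' stableBands N ξ := by
  obtain ⟨x, -, hx⟩ := H.exists_fiber.2 t ht
  have h := congrArg (Polynomial.aeval z) hx
  simp only [map_sub, map_prod, Polynomial.aeval_X, Polynomial.aeval_C, Complex.coe_algebraMap] at h
  rw [← discrP_eq H.one_le, hz, sub_self, eq_comm, Finset.prod_eq_zero_iff] at h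
  obtain ⟨m, _, hm⟩ := h
  have hzm : z = (x m : ℂ) := sub_eq_zero.1 hm
  refine ⟨x m, ?_, hzm.symm⟩
  rw [H.mem_stableBands_iff_sq_le]
  rw [hzm, discrP_eq H.one_le, Polynomial.aeval_complex_ofReal] at hz
  have : (discrPoly N a b).eval (x m) = t := by exact_mod_cast hz
  rw [this]
  nlinarith [ht.1, ht.2]

theorem norm_hMinus_ne_one (H : BandData N a b ξ σ) {z : ℂ}
    (hz : z ∉ (fun x : ℝ => (x : ℂ)) '' stableBands N ξ) : ‖hMinus N a b ξ z‖ ≠ 1 := by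
  intro h
  have h1 := H.alpha_mul_hMinus_add_inv z
  set u := hMinus N a b ξ z
  have h2 : u⁻¹ = (starRingEnd ℂ) u := by
    rw [Complex.inv_def, Complex.normSq_eq_norm_sq, h]; simp
  rw [h2, Complex.add_conj] at h1
  have h3 : |u.re| ≤ 1 := h ▸ Complex.abs_re_le_norm u
  obtain ⟨h4, h5⟩ := abs_le.1 h3
  have h6 := H.alpha_pos
  refine hz (H.mem_bands_of_discrP_eq (t := alphaProd N a * (2 * u.re)) ⟨?_, ?_⟩ ?_)
  · nlinarith
  · nlinarith
  · rw [← h1]; push_cast; ring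

theorem continuous_discrP (hN : 1 ≤ N) : Continuous (discrP N a b) := by
  rw [show discrP N a b = fun z => _ from funext (discrP_eq hN a b)]
  exact Polynomial.continuous_aeval _

theorem differentiable_discrP (hN : 1 ≤ N) : Differentiable ℂ (discrP N a b) := by
  rw [show discrP N a b = fun z => _ from funext (discrP_eq hN a b)]
  exact Polynomial.differentiable_aeval _

theorem differentiableAt_hMinus (H : BandData N a b ξ σ) {z : ℂ}
    (hz : z ∉ (fun x : ℝ => (x : ℂ)) '' stableBands N ξ) :
    DifferentiableAt ℂ (hMinus N a b ξ) z :=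
  ((differentiable_discrP H.one_le z).sub (H.differentiableAt_sqrtDiscr hz)).div_const _

/-- Off the bands, `h` lies in the open unit disc: it never meets the unit circle there, and
`0 < h < 1` far out on the positive real axis. -/
theorem norm_hMinus_lt_one (H : BandData N a b ξ σ) {z : ℂ}
    (hz : z ∉ (fun x : ℝ => (x : ℂ)) '' stableBands N ξ) : ‖hMinus N a b ξ z‖ < 1 := by
  obtain ⟨M, hM, hPM, -⟩ := (discrPoly_monic H.one_le a b).exists_large_abscissa H.one_le
    (discrPoly_natDegree H.one_le a b) (2 * alphaProd N a) (σ N)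
  have hα := H.alpha_pos
  have hMb : (M : ℂ) ∉ (fun x : ℝ => (x : ℂ)) '' stableBands N ξ := by
    rintro ⟨x, hx, hxM⟩
    have hxM' : x = M := Complex.ofReal_injective hxM
    subst hxM'
    rw [H.mem_stableBands_iff_sq_le] at hx
    nlinarith
  have hMlt : ‖hMinus N a b ξ M‖ < 1 := by
    have hs : sqrtDiscr N ξ M = ((∏ i ∈ Finset.Icc 1 (2 * N), Real.sqrt (M - ξ i) : ℝ) : ℂ) := by
      rw [sqrtDiscr]
      push_cast
      refine Finset.prod_congr rfl fun i hi => ?_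
      rw [← Complex.ofReal_sub, Complex.cpow_half_of_nonneg]
      obtain ⟨h1, h2⟩ := Finset.mem_Icc.1 hi
      have h3 : ξ (2 * ((i - 1) / 2) + 2) ≤ σ N :=
        (H.right_le _ (by omega)).trans (H.sigma_le (by omega) le_rfl)
      have h4 := H.left_le_right ((i - 1) / 2)
      have h5 : ξ i ≤ σ N := by
        rcases Nat.even_or_odd' i with ⟨k, hk | hk⟩
        · rw [show 2 * ((i - 1) / 2) + 2 = i by omega] at h3; exact h3
        · rw [show 2 * ((i - 1) / 2) + 1 = i by omega] at h4; exact h4.trans h3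
      linarith
    set s : ℝ := ∏ i ∈ Finset.Icc 1 (2 * N), Real.sqrt (M - ξ i)
    have hs0 : 0 ≤ s := Finset.prod_nonneg fun i _ => Real.sqrt_nonneg _
    have hsq := H.sqrtDiscr_sq M
    rw [hs, discrP_eq H.one_le, Polynomial.aeval_complex_ofReal] at hsq
    rw [hMinus, hs, discrP_eq H.one_le, Polynomial.aeval_complex_ofReal]
    set p := (discrPoly N a b).eval M
    have hsq' : s ^ 2 = p ^ 2 - 4 * alphaProd N a ^ 2 := by exact_mod_cast hsq
    have : ((p : ℂ) - s) / (2 * (alphaProd N a : ℂ)) = ((p - s) / (2 * alphaProd N a) : ℝ) := by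
      push_cast; ring
    rw [this, Complex.norm_real, Real.norm_eq_abs, abs_lt, lt_div_iff₀ (by positivity),
      div_lt_iff₀ (by positivity)]
    constructor <;> nlinarith
  by_contra hcon
  have hU := isPreconnected_compl_ofReal_image (isCompact_stableBands N ξ)
  have hcont : ContinuousOn (fun z => ‖hMinus N a b ξ z‖)
      ((fun x : ℝ => (x : ℂ)) '' stableBands N ξ)ᶜ := fun w hw =>
    (H.differentiableAt_hMinus hw).continuousAt.norm.continuousWithinAt
  obtain ⟨w, hw, hw1⟩ := hU.intermediate_value (Set.mem_compl hMb) (Set.mem_compl hz) hcont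
    ⟨hMlt.le, not_lt.1 hcon⟩
  exact H.norm_hMinus_ne_one hw hw1

end BandData

/-! ### The function `h` at the zeros of `B_{N-1}`, the masses and the density -/

theorem prod_erase_range_ite_lt {N m : ℕ} (hm : m < N) :
    ∏ k ∈ (Finset.range N).erase m, (if k < m then (1 : ℝ) else -1) = (-1) ^ (N - 1 - m) := by
  rw [Finset.prod_ite, Finset.prod_const_one, one_mul, Finset.prod_const]
  congr 1
  rw [show ((Finset.range N).erase m).filter (fun k => ¬ k < m) = Finset.Ioo m N by
    ext k; simp; omega]
  simp; omega

namespace BandData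

variable {N : ℕ} {a b : ℤ → ℝ} {ξ σ : ℕ → ℝ}

theorem discrP_ofReal (H : BandData N a b ξ σ) (x : ℝ) :
    discrP N a b x = ((discrPoly N a b).eval x : ℝ) := by
  rw [discrP_eq H.one_le, Polynomial.aeval_complex_ofReal]

theorem den_eval_sigma (H : BandData N a b ξ σ) {j : ℕ} (hj : j ∈ Finset.Icc 1 (N - 1)) :
    (convDen a b (N - 1)).eval (σ j) = 0 := by
  rw [H.den_eq, Polynomial.eval_prod]; exact Finset.prod_eq_zero hj (by simp)

theorem sq_le_eval_sigma_sq (H : BandData N a b ξ σ) {i : ℕ} (hi : i ≤ N) :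
    4 * alphaProd N a ^ 2 ≤ (discrPoly N a b).eval (σ i) ^ 2 := by
  have h1 := H.two_alpha_le i hi
  have h2 := H.alpha_pos
  rcases neg_one_pow_eq_or ℝ (N + i) with h | h <;> rw [h] at h1 <;> nlinarith

/-- A zero `σ_j` that lies in the bands is a branch point, so that `h = ±1` there. -/
theorem hMinus_sigma_of_mem_bands (H : BandData N a b ξ σ) {i : ℕ} (hi : i ≤ N)
    (hb : σ i ∈ stableBands N ξ) :
    sqrtDiscr N ξ (σ i) = 0 ∧ (hMinus N a b ξ (σ i) = 1 ∨ hMinus N a b ξ (σ i) = -1) := by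
  have h1 := le_antisymm ((H.mem_stableBands_iff_sq_le _).1 hb) (H.sq_le_eval_sigma_sq hi)
  have h2 : sqrtDiscr N ξ (σ i) = 0 := by
    have h3 := H.sqrtDiscr_sq (σ i)
    rw [H.discrP_ofReal] at h3
    have h4 : (((discrPoly N a b).eval (σ i) : ℝ) : ℂ) ^ 2 = 4 * (alphaProd N a : ℂ) ^ 2 := by
      exact_mod_cast h1
    rw [h4, sub_self] at h3
    exact pow_eq_zero_iff (two_ne_zero) |>.1 h3
  refine ⟨h2, ?_⟩
  have h5 := H.alpha_pos
  have h6 : ((discrPoly N a b).eval (σ i) - 2 * alphaProd N a) *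
      ((discrPoly N a b).eval (σ i) + 2 * alphaProd N a) = 0 := by linarith
  have hα := H.alpha_ne_zero
  rw [hMinus, h2, H.discrP_ofReal, sub_zero]
  rcases mul_eq_zero.1 h6 with h | h
  · left
    rw [sub_eq_zero.1 h]; push_cast; field_simp
  · right
    rw [eq_neg_of_add_eq_zero_left h]; push_cast; field_simp

theorem ofReal_mem_image_iff {x : ℝ} {s : Set ℝ} :
    (x : ℂ) ∈ (fun x : ℝ => (x : ℂ)) '' s ↔ x ∈ s :=
  Complex.ofReal_injective.mem_set_image

theorem norm_hMinus_sigma_le_one (H : BandData N a b ξ σ) {i : ℕ} (hi : i ≤ N) :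
    ‖hMinus N a b ξ (σ i)‖ ≤ 1 := by
  by_cases hb : σ i ∈ stableBands N ξ
  · rcases (H.hMinus_sigma_of_mem_bands hi hb).2 with h | h <;> simp [h]
  · exact (H.norm_hMinus_lt_one (fun h => hb (ofReal_mem_image_iff.1 h))).le

/-- At a zero of `B_{N-1}` the monodromy matrix is triangular: `α h` is one of its diagonal entries. -/
theorem alpha_mul_hMinus_sigma (H : BandData N a b ξ σ) {j : ℕ} (hj : j ∈ Finset.Icc 1 (N - 1)) :
    (alphaProd N a : ℂ) * hMinus N a b ξ (σ j) = ((convDen a b N).eval (σ j) : ℝ) ∨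
      (alphaProd N a : ℂ) * hMinus N a b ξ (σ j) = (-(convNum a b (N - 1)).eval (σ j) : ℝ) := by
  have h1 := H.hMinus_quadratic (σ j)
  have h2 := H.num_mul_den j hj
  rw [H.discrP_ofReal, discrPoly, Polynomial.eval_sub] at h1
  have h2' : (((convNum a b (N - 1)).eval (σ j) : ℝ) : ℂ) * ((convDen a b N).eval (σ j) : ℝ) =
      -(alphaProd N a : ℂ) ^ 2 := by exact_mod_cast h2
  push_cast at h1 ⊢
  set u := hMinus N a b ξ (σ j)
  set A : ℂ := (((convNum a b (N - 1)).eval (σ j) : ℝ) : ℂ)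
  set B : ℂ := (((convDen a b N).eval (σ j) : ℝ) : ℂ)
  have h3 : ((alphaProd N a : ℂ) * u - B) * ((alphaProd N a : ℂ) * u + A) = 0 := by
    linear_combination (alphaProd N a : ℂ) * h1 - h2'
  rcases mul_eq_zero.1 h3 with h | h
  · exact Or.inl (sub_eq_zero.1 h)
  · exact Or.inr (eq_neg_of_add_eq_zero_left h)

theorem den_derivative_sigma (H : BandData N a b ξ σ) {j : ℕ} (hj : j ∈ Finset.Icc 1 (N - 1)) :
    (convDen a b (N - 1)).derivative.eval (σ j) =
      ∏ l ∈ (Finset.Icc 1 (N - 1)).erase j, (σ j - σ l) := by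
  rw [H.den_eq, ← Lagrange.nodal_eq, Lagrange.eval_nodal_derivative_eval_node_eq hj,
    Lagrange.eval_nodal]

theorem den_derivative_sign (H : BandData N a b ξ σ) {j : ℕ} (hj : j ∈ Finset.Icc 1 (N - 1)) :
    0 < (-1) ^ (N - 1 + j) * (convDen a b (N - 1)).derivative.eval (σ j) := by
  rw [H.den_derivative_sigma hj]
  obtain ⟨hj1, hj2⟩ := Finset.mem_Icc.1 hj
  -- the missing factor is replaced by `1`, by moving the node `σ j` one unit to the left
  have h1 := prod_sub_eq_sign_mul_prod_abs (Function.update σ j (σ j - 1)) (σ j) j (N - 1) hj2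
    (fun l hl hlj => by
      rcases hlj.eq_or_lt with h | h
      · subst h; simp
      · rw [Function.update_of_ne h.ne]; exact H.sigma_le hlj (by omega))
    (fun l hl hlj => by
      rw [Function.update_of_ne hlj.ne']; exact H.sigma_le hlj.le (by
        have := (Finset.mem_Icc.1 hl).2; omega))
  have h2 : ∀ f : ℝ → ℝ, ∏ l ∈ (Finset.Icc 1 (N - 1)).erase j,
      f (σ j - Function.update σ j (σ j - 1) l) =
      ∏ l ∈ (Finset.Icc 1 (N - 1)).erase j, f (σ j - σ l) := fun f =>
    Finset.prod_congr rfl fun l hl => by rw [Function.update_of_ne (Finset.mem_erase.1 hl).1]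
  rw [← Finset.mul_prod_erase _ _ hj, ← Finset.mul_prod_erase _ _ hj, h2 (fun x => x),
    h2 (fun x => |x|)] at h1
  simp only [Function.update_self, sub_sub_cancel, one_mul, abs_one] at h1
  rw [h1, ← mul_assoc, ← pow_add, ← two_mul, pow_mul, neg_one_sq, one_pow, one_mul]
  refine Finset.prod_pos fun l hl => abs_pos.2 (sub_ne_zero.2 fun h => ?_)
  obtain ⟨hl1, hl2⟩ := Finset.mem_erase.1 hl
  exact hl1 (H.strictMono.injOn (Set.mem_Iic.2 (by omega))
    (Set.mem_Iic.2 (by have := (Finset.mem_Icc.1 hl2).2; omega)) h).symm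

theorem den_derivative_ne_zero (H : BandData N a b ξ σ) {j : ℕ} (hj : j ∈ Finset.Icc 1 (N - 1)) :
    (convDen a b (N - 1)).derivative.eval (σ j) ≠ 0 := fun h => by
  have := H.den_derivative_sign hj
  rw [h, mul_zero] at this
  exact lt_irrefl _ this

theorem resCoeff_eq (H : BandData N a b ξ σ) {j : ℕ} (hj : j ∈ Finset.Icc 1 (N - 1)) :
    resCoeff N a b ξ σ j = ((alphaProd N a : ℂ) * hMinus N a b ξ (σ j) +
      ((convNum a b (N - 1)).eval (σ j) : ℝ)) /
        ((convDen a b (N - 1)).derivative.eval (σ j) : ℝ) := by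
  obtain ⟨m, rfl⟩ : ∃ m, N = m + 2 := ⟨N - 2, by
    obtain ⟨h1, h2⟩ := Finset.mem_Icc.1 hj; omega⟩
  have h1 := jacobiDet_two_eq a b m (σ j)
  rw [Polynomial.aeval_complex_ofReal] at h1
  have h2 : ((-1 : ℂ) ^ m) * (-1) ^ m = 1 := by rw [← mul_pow]; simp
  rw [resCoeff, H.den_derivative_sigma hj]
  push_cast
  congr 2
  rw [mul_assoc, h1]
  linear_combination (((convNum a b (m + 1)).eval (σ j) : ℝ) : ℂ) * h2

/-- The mass at `σ j` vanishes if `α h = -A_{N-1}`. Otherwise `α h = B_N`, and `A_{N-1}` has the larger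
modulus, with the sign of `B_{N-1}'`. -/
theorem resCoeff_nonneg (H : BandData N a b ξ σ) {j : ℕ} (hj : j ∈ Finset.Icc 1 (N - 1)) :
    (resCoeff N a b ξ σ j).im = 0 ∧ 0 ≤ (resCoeff N a b ξ σ j).re := by
  obtain ⟨hj1, hj2⟩ := Finset.mem_Icc.1 hj
  rw [H.resCoeff_eq hj]
  have hα := H.alpha_pos
  have hnorm : ‖(alphaProd N a : ℂ) * hMinus N a b ξ (σ j)‖ ≤ alphaProd N a := by
    rw [norm_mul, Complex.norm_real, Real.norm_of_nonneg hα.le]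
    exact mul_le_of_le_one_right hα.le (H.norm_hMinus_sigma_le_one (by omega))
  have hprod := H.num_mul_den j hj
  have hB := H.den_pos j hj
  have hD := H.den_derivative_sign hj
  rcases H.alpha_mul_hMinus_sigma hj with h | h
  · rw [h] at hnorm ⊢
    set A := (convNum a b (N - 1)).eval (σ j)
    set B := (convDen a b N).eval (σ j)
    set D := (convDen a b (N - 1)).derivative.eval (σ j)
    rw [← Complex.ofReal_add, ← Complex.ofReal_div]
    refine ⟨Complex.ofReal_im _, ?_⟩
    rw [Complex.ofReal_re]
    rw [Complex.norm_real, Real.norm_eq_abs] at hnorm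
    have hs : (-1 : ℝ) ^ (N - 1 + j) = -(-1) ^ (N + j) := by
      rw [show N + j = N - 1 + j + 1 by omega, pow_succ]; ring
    rw [hs] at hD
    obtain ⟨h1, h2⟩ := abs_le.1 hnorm
    rcases neg_one_pow_eq_or ℝ (N + j) with hε | hε <;> rw [hε] at hB hD
    · have hB' : 0 < B := by linarith
      refine div_nonneg_of_nonpos ?_ (by linarith)
      by_contra hcon
      nlinarith
    · refine div_nonneg ?_ (by linarith)
      by_contra hcon
      nlinarith
  · rw [h]; simp

/-- The boundary value of the branch from above on the `m`-th band. -/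
theorem sqrtDiscr_on_band (H : BandData N a b ξ σ) {m : ℕ} (hm : m < N) {x : ℝ}
    (hx : x ∈ Set.Icc (ξ (2 * m + 1)) (ξ (2 * m + 2))) :
    sqrtDiscr N ξ x = Complex.I * (((-1) ^ (N - 1 - m) *
      Real.sqrt (4 * alphaProd N a ^ 2 - (discrPoly N a b).eval x ^ 2) : ℝ) : ℂ) := by
  have hsq : 4 * alphaProd N a ^ 2 - (discrPoly N a b).eval x ^ 2 =
      ((x - ξ (2 * m + 1)) * (ξ (2 * m + 2) - x)) *
        ∏ k ∈ (Finset.range N).erase m, ((x - ξ (2 * k + 1)) * (x - ξ (2 * k + 2))) := by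
    have h := H.eval_sq_sub x
    rw [← Finset.mul_prod_erase _ _ (Finset.mem_range.2 hm)] at h
    linear_combination -h
  have hσ1 := (H.le_left m hm).trans hx.1
  have hσ2 := hx.2.trans (H.right_le m hm)
  -- the pair of roots attached to another band contributes `±1` times a positive root
  have hpair : ∀ k ∈ (Finset.range N).erase m,
      ((x : ℂ) - (ξ (2 * k + 1) : ℂ)) ^ (1 / 2 : ℂ) * ((x : ℂ) - (ξ (2 * k + 2) : ℂ)) ^ (1 / 2 : ℂ) =
      (((if k < m then 1 else -1) *
        Real.sqrt ((x - ξ (2 * k + 1)) * (x - ξ (2 * k + 2))) : ℝ) : ℂ) := by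
    intro k hk
    obtain ⟨hkm, hkN⟩ := Finset.mem_erase.1 hk
    have hkN' := Finset.mem_range.1 hkN
    have h3 := H.left_le_right k
    rw [← Complex.ofReal_sub, ← Complex.ofReal_sub]
    rcases lt_or_gt_of_ne hkm with h | h
    · have h4 := H.sigma_le (i := k + 1) (j := m) h hm.le
      have h5 := H.right_le k hkN'
      rw [if_pos h, Complex.cpow_half_of_nonneg (by linarith), Complex.cpow_half_of_nonneg (by linarith),
        Real.sqrt_mul (by linarith)]
      push_cast; ring
    · have h4 := H.sigma_le (i := m + 1) (j := k) h hkN'.le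
      have h5 := H.le_left k hkN'
      rw [if_neg h.not_gt, Complex.cpow_half_of_nonpos (by linarith),
        Complex.cpow_half_of_nonpos (by linarith), ← neg_mul_neg (x - ξ (2 * k + 1)), Real.sqrt_mul (by linarith)]
      push_cast
      linear_combination (Real.sqrt (-(x - ξ (2 * k + 1))) : ℂ) *
        (Real.sqrt (-(x - ξ (2 * k + 2))) : ℂ) * Complex.I_sq
  rw [sqrtDiscr_eq_prod_range, ← Finset.mul_prod_erase _ _ (Finset.mem_range.2 hm),
    Finset.prod_congr rfl hpair, ← Complex.ofReal_prod, Finset.prod_mul_distrib, prod_erase_range_ite_lt hm, hsq,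
    ← Real.sqrt_prod _ (fun k hk => by
      obtain ⟨hk1, hk2⟩ := Finset.mem_erase.1 hk
      exact H.gap_factor_nonneg hm (Finset.mem_range.1 hk2) hk1.symm hσ1 hσ2),
    Real.sqrt_mul (mul_nonneg (sub_nonneg.2 hx.1) (sub_nonneg.2 hx.2)),
    Real.sqrt_mul (sub_nonneg.2 hx.1), ← Complex.ofReal_sub, ← Complex.ofReal_sub,
    Complex.cpow_half_of_nonneg (sub_nonneg.2 hx.1), Complex.cpow_half_of_nonpos (sub_nonpos.2 hx.2),
    neg_sub]
  push_cast
  ring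

theorem den_sign_on_gap (H : BandData N a b ξ σ) {m : ℕ} (hm : m < N) {x : ℝ}
    (h1 : σ m ≤ x) (h2 : x ≤ σ (m + 1)) :
    (convDen a b (N - 1)).eval x = (-1) ^ (N - 1 - m) * |(convDen a b (N - 1)).eval x| := by
  have h : (convDen a b (N - 1)).eval x = ∏ j ∈ Finset.Icc 1 (N - 1), (x - σ j) := by
    rw [H.den_eq, Polynomial.eval_prod]; simp
  rw [h, Finset.abs_prod, prod_sub_eq_sign_mul_prod_abs σ x m (N - 1) (by omega)
    (fun j hj hjm => (H.sigma_le hjm hm.le).trans h1)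
    (fun j hj hjm => h2.trans (H.sigma_le hjm (by have := (Finset.mem_Icc.1 hj).2; omega)))]
  congr 1
  obtain ⟨k, hk⟩ : ∃ k, N - 1 = m + k := ⟨N - 1 - m, by omega⟩
  rw [hk, show m + k + m = k + 2 * m by ring, pow_add, pow_mul]
  simp

/-- The density on the bands, in real form. -/
theorem bandDensity_eq (H : BandData N a b ξ σ) {x : ℝ} (hx : x ∈ stableBands N ξ) :
    bandDensity N a b ξ x = ((Real.sqrt (4 * alphaProd N a ^ 2 - (discrPoly N a b).eval x ^ 2) /
      (2 * Real.pi) / |(convDen a b (N - 1)).eval x| : ℝ) : ℂ) := by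
  obtain ⟨m, hm, hxm⟩ := mem_stableBands_iff.1 hx
  have hB := H.den_sign_on_gap hm ((H.le_left m hm).trans hxm.1) (hxm.2.trans (H.right_le m hm))
  rw [bandDensity, H.sqrtDiscr_on_band hm hxm, deltaNN_eq, Polynomial.aeval_complex_ofReal, hB,
    abs_mul, abs_pow, abs_neg, abs_one, one_pow, one_mul, abs_abs]
  have h1 : ((-1 : ℂ) ^ (N + 1)) = (-1) ^ (N - 1) := by
    rw [show N + 1 = N - 1 + 2 by have := H.one_le; omega, pow_add]; simp
  have h2 : (-1 : ℂ) ^ (N - 1) ≠ 0 := by simp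
  have h3 : (-1 : ℂ) ^ (N - 1 - m) ≠ 0 := by simp
  rw [h1]
  push_cast
  by_cases h0 : ((|(convDen a b (N - 1)).eval x| : ℝ) : ℂ) = 0
  · rw [h0]; simp
  · have := Complex.I_ne_zero
    have hpi : (Real.pi : ℂ) ≠ 0 := Complex.ofReal_ne_zero.2 Real.pi_ne_zero
    field_simp

theorem bandDensity_nonneg (H : BandData N a b ξ σ) {x : ℝ} (hx : x ∈ stableBands N ξ) :
    (bandDensity N a b ξ x).im = 0 ∧ 0 ≤ (bandDensity N a b ξ x).re := by
  rw [H.bandDensity_eq hx, Complex.ofReal_im, Complex.ofReal_re]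
  exact ⟨rfl, by positivity⟩

end BandData

/-! ### Points of the spectral curve -/

/-- The product of `A(h) - z` with a vector, row by row. -/
theorem periodicMatrix_sub_mulVec (n : ℕ) (a b : ℤ → ℝ) (z h : ℂ) (u : ℕ → ℂ) (p : Fin (n + 2)) :
    (periodicMatrix (n + 2) a b h - z • (1 : Matrix (Fin (n + 2)) (Fin (n + 2)) ℂ)).mulVec
        (fun q => u q) p =
      (b (p + 1) - z) * u p + (if (p : ℕ) = n + 1 then 0 else (a (p + 1) : ℂ) * u (p + 1)) +
        (if (p : ℕ) = 0 then 0 else (a p : ℂ) * u (p - 1)) +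
        (if (p : ℕ) = 0 then (a (n + 2 : ℕ) : ℂ) * h⁻¹ * u (n + 1) else 0) +
        (if (p : ℕ) = n + 1 then (a (n + 2 : ℕ) : ℂ) * h * u 0 else 0) := by
  obtain ⟨p, hp⟩ := p
  let F : ℕ → ℂ := fun q => (if q = p then (b (p + 1) - z) * u q else 0) +
    (if q = p + 1 then (a (p + 1) : ℂ) * u q else 0) +
    (if p = q + 1 then (a (q + 1) : ℂ) * u q else 0) +
    (if q = n + 1 then (if p = 0 then (a (n + 2 : ℕ) : ℂ) * h⁻¹ * u q else 0) else 0) +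
    (if q = 0 then (if p = n + 1 then (a (n + 2 : ℕ) : ℂ) * h * u q else 0) else 0)
  have hentry : ∀ q : Fin (n + 2),
      (periodicMatrix (n + 2) a b h - z • (1 : Matrix (Fin (n + 2)) (Fin (n + 2)) ℂ)) ⟨p, hp⟩ q * u q =
      F q := by
    rintro ⟨q, hq⟩
    simp only [periodicMatrix, jacobiBlock, Matrix.sub_apply, Matrix.add_apply, Matrix.of_apply,
      Matrix.smul_apply, Matrix.one_apply, Fin.mk.injEq, smul_eq_mul, add_comm (1 : ℤ), F]
    rcases lt_trichotomy p q with h1 | h1 | h1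
    · rw [if_neg h1.ne, if_neg (by omega : ¬ q + 1 = p), if_neg h1.ne, if_neg h1.ne',
        if_neg (by omega : ¬ p = q + 1), if_neg (by omega : ¬ (p + 1 = n + 2 ∧ q = 0)),
        if_neg (by omega : ¬ q = 0)]
      split_ifs <;> first | omega | ring
    · subst h1
      rw [if_pos rfl, if_pos rfl, if_pos rfl, if_neg (by omega : ¬ p = p + 1)]
      split_ifs <;> first | omega | ring
    · rw [if_neg h1.ne', if_neg (by omega : ¬ p + 1 = q), if_neg h1.ne', if_neg h1.ne,
        if_neg (by omega : ¬ q = p + 1), if_neg (by omega : ¬ (p = 0 ∧ q + 1 = n + 2))]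
      split_ifs <;> first | omega | ring
  rw [Matrix.mulVec, dotProduct, Finset.sum_congr rfl fun q _ => hentry q, ← Finset.sum_range F]
  simp only [F, Finset.sum_add_distrib, Finset.sum_ite_eq', Finset.mem_range]
  rw [if_pos hp, if_pos (by omega : n + 1 < n + 2), if_pos (by omega : 0 < n + 2)]
  congr 3
  · congr 1
    by_cases h : p = n + 1
    · rw [if_pos h, if_neg (by omega)]
    · rw [if_neg h, if_pos (by omega)]
  · rcases Nat.eq_zero_or_pos p with h | h
    · subst h
      simp
    · obtain ⟨k, rfl⟩ : ∃ k, p = k + 1 := ⟨p - 1, by omega⟩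
      simp only [Nat.add_right_cancel_iff]
      simp [show k < n + 2 by omega]

theorem det_periodicMatrix_sub_eq_zero {n : ℕ} {a b : ℤ → ℝ} (ha : ∀ i, 0 < a i)
    (h0 : a ((n + 2 : ℕ) : ℤ) = a 0) {z h c d : ℂ} (hh : h ≠ 0) (hcd : c ≠ 0 ∨ d ≠ 0)
    (h1 : c * Polynomial.aeval z (convDen a b (n + 2)) + d * Polynomial.aeval z (convNum a b (n + 2)) =
      alphaProd (n + 2) a * h * c)
    (h2 : c * Polynomial.aeval z (convDen a b (n + 1)) + d * Polynomial.aeval z (convNum a b (n + 1)) =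
      -(alphaProd (n + 2) a * h * d)) :
    (periodicMatrix (n + 2) a b h - z • (1 : Matrix (Fin (n + 2)) (Fin (n + 2)) ℂ)).det = 0 := by
  -- the Bloch solution of the three-term recurrence with initial data `(c, d)` is a kernel vector
  set π : ℕ → ℂ := fun k => ∏ i ∈ Finset.range k, (a (i + 1) : ℂ) with hπ
  have ha' : ∀ i, (a i : ℂ) ≠ 0 := fun i => Complex.ofReal_ne_zero.2 (ha i).ne'
  have hπ0 : ∀ k, π k ≠ 0 := fun k => Finset.prod_ne_zero_iff.2 fun i _ => ha' _
  have hπs : ∀ k, π (k + 1) = π k * a (k + 1) := fun k => Finset.prod_range_succ _ _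
  have hπα : π (n + 2) = alphaProd (n + 2) a := by
    rw [alphaProd, prod_Icc_one_eq_prod_range]; simp [hπ]
  set u : ℕ → ℂ := fun k => (c * Polynomial.aeval z (convDen a b k) +
    d * Polynomial.aeval z (convNum a b k)) / π k with hu
  have hu0 : u 0 = c := by simp [hu, hπ, convDen, convNum]
  have hu1 : (a 1 : ℂ) * u 1 = (z - b 1) * c + d * a 0 ^ 2 := by
    have := ha' 1
    simp [hu, hπ, convDen, convNum]
    field_simp
  have hrec : ∀ k : ℕ, (a (k + 2) : ℂ) * u (k + 2) = (z - b (k + 2)) * u (k + 1) - a (k + 1) * u k := by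
    intro k
    have e1 := hπs (k + 1)
    have e2 := hπs k
    push_cast at e1
    rw [show (k : ℤ) + 1 + 1 = k + 2 by ring] at e1
    have n1 := ha' (k + 2)
    have n2 := ha' (k + 1)
    have n3 := hπ0 k
    simp only [hu, convDen, convNum]
    rw [e1, e2]
    simp only [map_sub, map_mul, Polynomial.aeval_X, Polynomial.aeval_C, Complex.coe_algebraMap]
    push_cast
    field_simp
    ring
  have hlast : u (n + 1) = -(a 0 * h * d) := by
    have e1 := hπs (n + 1)
    push_cast at e1
    rw [show (n : ℤ) + 1 + 1 = ((n + 2 : ℕ) : ℤ) by push_cast; ring, h0] at e1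
    simp only [hu]
    rw [h2, ← hπα, e1]
    have := hπ0 (n + 1)
    field_simp
  have hnext : u (n + 2) = h * c := by
    simp only [hu]
    rw [h1, ← hπα]
    have := hπ0 (n + 2)
    field_simp
  refine Matrix.exists_mulVec_eq_zero_iff.1 ⟨fun q => u q, ?_, ?_⟩
  · intro hzero
    have e0 : u 0 = 0 := congrFun hzero ⟨0, by omega⟩
    have e1 : u 1 = 0 := congrFun hzero ⟨1, by omega⟩
    rw [hu0] at e0
    rw [e1, e0] at hu1
    have := ha' 0
    rcases hcd with hc | hd
    · exact hc e0
    · simp [hd, this] at hu1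
  · ext p
    rw [periodicMatrix_sub_mulVec, Pi.zero_apply]
    obtain ⟨p, hp⟩ := p
    simp only
    rcases Nat.eq_zero_or_pos p with hp0 | hp0
    · subst hp0
      simp only [Nat.cast_zero, zero_add, hu0, hlast, h0, if_true]
      rw [if_neg (by omega), if_neg (by omega), hu1]
      field_simp
      ring
    · obtain ⟨k, rfl⟩ : ∃ k, p = k + 1 := ⟨p - 1, by omega⟩
      have e := hrec k
      by_cases hk : k = n
      · subst hk
        rw [hnext] at e
        simp [hu0]
        rw [show (k : ℤ) + 1 + 1 = k + 2 by ring]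
        linear_combination e
      · simp [hk]
        rw [show (k : ℤ) + 1 + 1 = k + 2 by ring]
        linear_combination e

namespace BandData

variable {N : ℕ} {a b : ℤ → ℝ} {ξ σ : ℕ → ℝ}

theorem sigma_mem_spectralCurve (H : BandData N a b ξ σ) (ha : ∀ i, 0 < a i)
    (hpa : ∀ i, a (i + N) = a i) {j : ℕ} (hj : j ∈ Finset.Icc 1 (N - 1)) :
    ((σ j : ℂ), hMinus N a b ξ (σ j)) ∈ spectralCurve N a b := by
  refine ⟨H.hMinus_ne_zero _, ?_⟩
  obtain ⟨n, rfl⟩ : ∃ n, N = n + 2 := ⟨N - 2, by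
    obtain ⟨h1, h2⟩ := Finset.mem_Icc.1 hj; omega⟩
  have h0 : a ((n + 2 : ℕ) : ℤ) = a 0 := by simpa using hpa 0
  have hB : Polynomial.aeval (σ j : ℂ) (convDen a b (n + 1)) = 0 := by
    rw [Polynomial.aeval_complex_ofReal]
    exact_mod_cast H.den_eval_sigma hj
  -- the eigenvector of the triangular monodromy matrix for the eigenvalue `h`
  by_cases hc : (alphaProd (n + 2) a : ℂ) * hMinus (n + 2) a b ξ (σ j) =
      ((convDen a b (n + 2)).eval (σ j) : ℝ)
  · refine det_periodicMatrix_sub_eq_zero ha h0 (c := 1) (d := 0) (H.hMinus_ne_zero _)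
      (Or.inl one_ne_zero) ?_ ?_
    · rw [hc, Polynomial.aeval_complex_ofReal]; ring
    · rw [hB]; ring
  · have hd := (H.alpha_mul_hMinus_sigma hj).resolve_left hc
    refine det_periodicMatrix_sub_eq_zero ha h0
      (c := ((convNum a b (n + 2)).eval (σ j) : ℝ))
      (d := (alphaProd (n + 2) a : ℂ) * hMinus (n + 2) a b ξ (σ j) -
        ((convDen a b (n + 2)).eval (σ j) : ℝ)) (H.hMinus_ne_zero _)
      (Or.inr (sub_ne_zero.2 hc)) ?_ ?_
    · simp only [Polynomial.aeval_complex_ofReal]; ring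
    · rw [hB, hd, Polynomial.aeval_complex_ofReal]
      change _ + _ * (((convNum a b (n + 1)).eval (σ j) : ℝ) : ℂ) =
        -(((-(convNum a b (n + 1)).eval (σ j) : ℝ) : ℂ) * _)
      push_cast; ring

end BandData

/-! ### Convergence of the continued fraction -/

theorem gammaFraction_nums_dens (a b : ℤ → ℝ) (z : ℂ) (k : ℕ) :
    (gammaFraction a b z).nums k = Polynomial.aeval z (convNum a b k) ∧
      (gammaFraction a b z).dens k = Polynomial.aeval z (convDen a b k) := by
  have hget : ∀ n : ℕ, (gammaFraction a b z).s.get? n =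
      some ⟨if n = 0 then (a 0 : ℂ) ^ 2 else -(a n : ℂ) ^ 2, z - (b (n + 1) : ℂ)⟩ := fun n => rfl
  have key : ∀ k : ℕ, ((gammaFraction a b z).nums k = Polynomial.aeval z (convNum a b k) ∧
      (gammaFraction a b z).dens k = Polynomial.aeval z (convDen a b k)) ∧
      ((gammaFraction a b z).nums (k + 1) = Polynomial.aeval z (convNum a b (k + 1)) ∧
      (gammaFraction a b z).dens (k + 1) = Polynomial.aeval z (convDen a b (k + 1))) := by
    intro k
    induction k with
    | zero =>
      refine ⟨⟨?_, ?_⟩, ?_, ?_⟩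
      · rw [GenContFract.zeroth_num_eq_h]; simp [gammaFraction, convNum]
      · rw [GenContFract.zeroth_den_eq_one]; simp [convDen]
      · rw [GenContFract.first_num_eq (hget 0)]; simp [gammaFraction, convNum]
      · rw [GenContFract.first_den_eq (hget 0)]; simp [convDen]
    | succ k ih =>
      refine ⟨ih.2, ?_, ?_⟩
      · rw [GenContFract.nums_recurrence (hget (k + 1)) ih.1.1 ih.2.1, convNum]
        simp only [map_sub, map_mul, Polynomial.aeval_X, Polynomial.aeval_C, Complex.coe_algebraMap]
        rw [if_neg (by omega)]
        push_cast
        rw [show (k : ℤ) + 1 + 1 = k + 2 by ring]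
        ring
      · rw [GenContFract.dens_recurrence (hget (k + 1)) ih.1.2 ih.2.2, convDen]
        simp only [map_sub, map_mul, Polynomial.aeval_X, Polynomial.aeval_C, Complex.coe_algebraMap]
        rw [if_neg (by omega)]
        push_cast
        rw [show (k : ℤ) + 1 + 1 = k + 2 by ring]
        ring
  exact (key k).1

theorem gammaFraction_convs (a b : ℤ → ℝ) (z : ℂ) (k : ℕ) :
    (gammaFraction a b z).convs k =
      Polynomial.aeval z (convNum a b k) / Polynomial.aeval z (convDen a b k) := by
  obtain ⟨h1, h2⟩ := gammaFraction_nums_dens a b z k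
  rw [← h1, ← h2]; rfl

theorem exists_bound_of_periodic {N : ℕ} (hN : 1 ≤ N) {f : ℤ → ℝ} (hf : ∀ i, f (i + N) = f i) :
    ∃ C, 0 ≤ C ∧ ∀ i, |f i| ≤ C := by
  have hper : Function.Periodic f (N : ℤ) := hf
  refine ⟨∑ k ∈ Finset.range N, |f k|, Finset.sum_nonneg fun _ _ => abs_nonneg _, fun i => ?_⟩
  have h1 : f i = f (i % N) := by
    conv_lhs => rw [← Int.emod_add_mul_ediv i N]
    rw [mul_comm]
    exact hper.int_mul (i / N) (i % N)
  have h2 := Int.emod_nonneg i (by omega : (N : ℤ) ≠ 0)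
  have h3 := Int.emod_lt_of_pos i (by omega : (0 : ℤ) < N)
  obtain ⟨k, hk⟩ := Int.eq_ofNat_of_zero_le h2
  rw [h1, hk]
  exact Finset.single_le_sum (f := fun k : ℕ => |f k|) (fun _ _ => abs_nonneg _)
    (Finset.mem_range.2 (by omega))

/-- Far from the origin the denominators of the convergents grow at least geometrically. -/
theorem pow_le_norm_convDen {a b : ℤ → ℝ} {C R : ℝ} (hC : 0 ≤ C) (hR : 1 ≤ R)
    (ha : ∀ i, a i ^ 2 ≤ C) (hb : ∀ i, |b i| ≤ C) {z : ℂ} (hz : R + 2 * C ≤ ‖z‖) (k : ℕ) :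
    R ^ k ≤ ‖Polynomial.aeval z (convDen a b k)‖ := by
  have hzb : ∀ i, R + C ≤ ‖z - (b i : ℂ)‖ := fun i => by
    have h1 := norm_sub_norm_le z (b i : ℂ)
    rw [Complex.norm_real, Real.norm_eq_abs] at h1
    linarith [hb i]
  have key : ∀ k, R ^ k ≤ ‖Polynomial.aeval z (convDen a b k)‖ ∧
      R * ‖Polynomial.aeval z (convDen a b k)‖ ≤ ‖Polynomial.aeval z (convDen a b (k + 1))‖ := by
    intro k
    induction k with
    | zero =>
      simp only [convDen, map_one, norm_one, pow_zero, mul_one, map_sub, Polynomial.aeval_X,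
        Polynomial.aeval_C, Complex.coe_algebraMap, le_refl, true_and]
      linarith [hzb 1]
    | succ k ih =>
      obtain ⟨h1, h2⟩ := ih
      set u := Polynomial.aeval z (convDen a b k)
      set v := Polynomial.aeval z (convDen a b (k + 1))
      refine ⟨?_, ?_⟩
      · rw [pow_succ, mul_comm]
        exact (mul_le_mul_of_nonneg_left h1 (by linarith)).trans h2
      · have h3 : Polynomial.aeval z (convDen a b (k + 2)) =
            (z - b (k + 2)) * v - (a (k + 1) : ℂ) ^ 2 * u := by
          rw [convDen]
          simp only [map_sub, map_mul, Polynomial.aeval_X, Polynomial.aeval_C, Complex.coe_algebraMap]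
          push_cast; rfl
        rw [h3]
        have h4 := norm_sub_norm_le ((z - b (k + 2)) * v) ((a (k + 1) : ℂ) ^ 2 * u)
        rw [norm_mul, norm_mul, norm_pow, Complex.norm_real, Real.norm_eq_abs, sq_abs] at h4
        have h5 := mul_le_mul_of_nonneg_right (hzb (k + 2)) (norm_nonneg v)
        have h6 := mul_le_mul_of_nonneg_right (ha (k + 1)) (norm_nonneg u)
        have h7 : ‖u‖ ≤ ‖v‖ := le_trans (le_mul_of_one_le_left (norm_nonneg u) hR) h2
        have h8 := mul_le_mul_of_nonneg_left h7 hC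
        linarith
  exact (key k).1

namespace BandData

variable {N : ℕ} {a b : ℤ → ℝ} {ξ σ : ℕ → ℝ}

/-- If `φ` is the fixed point of the Möbius map of one period with multiplier `μ`, `|μ| ≤ α`, the
sequence `A_k - φ B_k` is multiplied by `μ` over a period and so is negligible against `B_k`. -/
theorem tendsto_convs (hN : 1 ≤ N) (hα : 0 < alphaProd N a) (hpa : ∀ i, a (i + N) = a i)
    (hpb : ∀ i, b (i + N) = b i) {C : ℝ} (hC : 0 ≤ C) (haC : ∀ i, a i ^ 2 ≤ C) (hbC : ∀ i, |b i| ≤ C)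
    {z φ μ : ℂ} (hz : max 1 (alphaProd N a) + 1 + 2 * C ≤ ‖z‖)
    (hφ : φ * Polynomial.aeval z (convDen a b (N - 1)) =
      μ + Polynomial.aeval z (convNum a b (N - 1)))
    (hμ : (alphaProd N a : ℂ) ^ 2 + μ ^ 2 = μ * discrP N a b z) (hμα : ‖μ‖ ≤ alphaProd N a) :
    Tendsto (fun k : ℕ => (gammaFraction a b z).convs k) atTop (𝓝 φ) := by
  set M := max 1 (alphaProd N a) with hM
  have hM1 : 1 ≤ M := le_max_left _ _
  have hMα : alphaProd N a ≤ M := le_max_right _ _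
  have hB := pow_le_norm_convDen (a := a) (b := b) hC (by linarith : 1 ≤ M + 1) haC hbC hz
  set E : ℕ → ℂ := fun k => Polynomial.aeval z (convNum a b k) -
    φ * Polynomial.aeval z (convDen a b k) with hE
  obtain ⟨m, rfl⟩ : ∃ m, N = m + 1 := ⟨N - 1, by omega⟩
  rw [Nat.add_sub_cancel] at hφ
  have hEm : E m = -μ := by simp only [hE]; rw [hφ]; ring
  have hBm : Polynomial.aeval z (convDen a b m) ≠ 0 := by
    intro h
    have := hB m
    rw [h, norm_zero] at this
    exact absurd this (not_le.2 (by positivity))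
  have hE0 : E 0 = -φ := by simp [hE, convDen, convNum]
  have hE1 : E 1 = (z - b 1) * E 0 + (a 0 : ℂ) ^ 2 := by simp [hE, convDen, convNum]; ring
  have hEN : E (m + 1) = μ * E 0 := by
    have hcas := congrArg (Polynomial.aeval z) (convNum_mul_convDen_sub a b m)
    rw [alphaProd_sq a hN hpa] at hcas
    simp only [map_sub, map_mul, Polynomial.aeval_C, Complex.coe_algebraMap] at hcas
    push_cast at hcas
    rw [discrP_eq hN, discrPoly, Nat.add_sub_cancel, map_sub] at hμ
    rw [hE0]
    simp only [hE]
    apply mul_left_cancel₀ hBm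
    linear_combination hcas + hμ + (μ - Polynomial.aeval z (convDen a b (m + 1))) * hφ
  have hrec : ∀ k : ℕ, E (k + 2) = (z - b (k + 2)) * E (k + 1) - (a (k + 1) : ℂ) ^ 2 * E k := by
    intro k
    simp only [hE, convDen, convNum, map_sub, map_mul, Polynomial.aeval_X, Polynomial.aeval_C,
      Complex.coe_algebraMap]
    push_cast
    ring
  have hper : ∀ k, E (k + (m + 1)) = μ * E k ∧ E (k + 1 + (m + 1)) = μ * E (k + 1) := by
    intro k
    induction k with
    | zero =>
      refine ⟨by rw [zero_add]; exact hEN, ?_⟩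
      have h1 := hrec m
      have h2 : b ((m : ℤ) + 2) = b 1 := by
        rw [← hpb 1]; congr 1; push_cast; ring
      have h3 : a ((m : ℤ) + 1) = a 0 := by
        rw [← hpa 0]; congr 1; push_cast; ring
      rw [h2, h3, hEN, hEm] at h1
      rw [show 0 + 1 + (m + 1) = m + 2 by ring, zero_add, h1, hE1]
      ring
    | succ k ih =>
      refine ⟨ih.2, ?_⟩
      have h1 := hrec (k + (m + 1))
      have h2 : b (((k + (m + 1) : ℕ) : ℤ) + 2) = b (k + 2) := by
        rw [← hpb (k + 2)]; congr 1; push_cast; ring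
      have h3 : a (((k + (m + 1) : ℕ) : ℤ) + 1) = a (k + 1) := by
        rw [← hpa (k + 1)]; congr 1; push_cast; ring
      rw [h2, h3, ih.1, show k + (m + 1) + 1 = k + 1 + (m + 1) by ring, ih.2] at h1
      rw [show k + 1 + 1 + (m + 1) = k + (m + 1) + 2 by ring, h1, hrec k]
      ring
  set C₀ := ∑ i ∈ Finset.range (m + 1), ‖E i‖ with hC₀
  have hC₀0 : 0 ≤ C₀ := Finset.sum_nonneg fun _ _ => norm_nonneg _
  have hbound : ∀ k, ‖E k‖ ≤ C₀ * M ^ k := by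
    intro k
    induction k using Nat.strong_induction_on with
    | _ k ih =>
      rcases Nat.lt_or_ge k (m + 1) with h | h
      · exact (Finset.single_le_sum (f := fun i => ‖E i‖) (fun _ _ => norm_nonneg _)
          (Finset.mem_range.2 h)).trans (le_mul_of_one_le_right hC₀0 (one_le_pow₀ hM1))
      · obtain ⟨l, rfl⟩ := Nat.exists_eq_add_of_le' h
        rw [(hper l).1, norm_mul, pow_add]
        have h1 := ih l (by omega)
        have h2 : ‖μ‖ ≤ M ^ (m + 1) := hμα.trans (hMα.trans (le_self_pow₀ hM1 (by omega)))
        calc ‖μ‖ * ‖E l‖ ≤ M ^ (m + 1) * (C₀ * M ^ l) := by gcongr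
          _ = C₀ * (M ^ l * M ^ (m + 1)) := by ring
  rw [tendsto_iff_norm_sub_tendsto_zero]
  have hgeom : Tendsto (fun k : ℕ => C₀ * (M / (M + 1)) ^ k) atTop (𝓝 0) := by
    rw [← mul_zero C₀]
    refine (tendsto_pow_atTop_nhds_zero_of_lt_one (by positivity) ?_).const_mul _
    rw [div_lt_one (by linarith)]; linarith
  refine squeeze_zero (fun _ => norm_nonneg _) (fun k => ?_) hgeom
  have hBk : 0 < ‖Polynomial.aeval z (convDen a b k)‖ :=
    lt_of_lt_of_le (by positivity) (hB k)
  have hBk' : Polynomial.aeval z (convDen a b k) ≠ 0 := norm_pos_iff.1 hBk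
  have heq : (gammaFraction a b z).convs k - φ = E k / Polynomial.aeval z (convDen a b k) := by
    rw [gammaFraction_convs]
    simp only [hE]
    field_simp
  rw [heq, norm_div, div_pow, ← mul_div_assoc]
  exact div_le_div₀ (by positivity) (hbound k) (by positivity) (hB k)

end BandData

/-! ### The Stieltjes transform of the semicircle -/

theorem one_add_sq_sub_two_mul_cos (u : ℂ) (θ : ℝ) :
    1 + u ^ 2 - 2 * u * (Real.cos θ : ℝ) =
      (1 - u * Complex.exp (θ * Complex.I)) * (1 - u * Complex.exp (-(θ * Complex.I))) := by
  have h : Complex.exp (θ * Complex.I) * Complex.exp (-(θ * Complex.I)) = 1 := by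
    rw [← Complex.exp_add]; simp
  rw [Complex.ofReal_cos, Complex.cos, neg_mul]
  linear_combination -u ^ 2 * h

theorem one_sub_mul_exp_ne_zero {u : ℂ} (hu : ‖u‖ < 1) {w : ℂ} (hw : ‖w‖ ≤ 1) : 1 - u * w ≠ 0 := by
  intro h
  have h1 : ‖u * w‖ = 1 := by rw [← sub_eq_zero.1 h]; simp
  rw [norm_mul] at h1
  nlinarith [norm_nonneg u, norm_nonneg w]

theorem one_add_sq_sub_ne_zero {u : ℂ} (hu : ‖u‖ < 1) (θ : ℝ) :
    1 + u ^ 2 - 2 * u * (Real.cos θ : ℝ) ≠ 0 := by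
  rw [one_add_sq_sub_two_mul_cos]
  refine mul_ne_zero (one_sub_mul_exp_ne_zero hu ?_) (one_sub_mul_exp_ne_zero hu ?_)
  · rw [Complex.norm_exp_ofReal_mul_I]
  · rw [← neg_mul, ← Complex.ofReal_neg, Complex.norm_exp_ofReal_mul_I]

/-- The integral over the upper half-circle is half of the integral over the circle, where the
integrand splits as `g (w) + g (w⁻¹)` with `g` holomorphic in the disc; the mean value property
of `g` gives the result. -/
theorem integral_sin_sq_div_of_norm_lt_one {u : ℂ} (hu : ‖u‖ < 1) :
    ∫ θ in (0 : ℝ)..Real.pi, u * (Real.sin θ : ℂ) ^ 2 / (1 + u ^ 2 - 2 * u * (Real.cos θ : ℝ)) =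
      Real.pi / 2 * u := by
  set g : ℂ → ℂ := fun w => -(w ^ 2 - 1) / (4 * (1 - u * w)) with hg
  have hden : ∀ w : ℂ, ‖w‖ ≤ 1 → 4 * (1 - u * w) ≠ 0 := fun w hw =>
    mul_ne_zero (by norm_num) (one_sub_mul_exp_ne_zero hu hw)
  have hdiff : ∀ w : ℂ, ‖w‖ ≤ 1 → DifferentiableAt ℂ g w := fun w hw =>
    DifferentiableAt.div (by fun_prop) (by fun_prop) (hden w hw)
  have havg : Real.circleAverage g 0 1 = g 0 := by
    refine DiffContOnCl.circleAverage (DifferentiableOn.diffContOnCl fun w hw => ?_)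
    refine (hdiff w ?_).differentiableWithinAt
    rw [abs_one, closure_ball _ one_ne_zero] at hw
    simpa using hw
  have hcirc : ∫ θ in (0 : ℝ)..2 * Real.pi, g (circleMap 0 1 θ) = Real.pi / 2 := by
    rw [Real.circleAverage_def] at havg
    have h2 : ((2 * Real.pi : ℝ)) ≠ 0 := by positivity
    have h3 := congrArg (fun w => (2 * Real.pi : ℝ) • w) havg
    simp only [smul_smul, mul_inv_cancel₀ h2, one_smul] at h3
    rw [h3]
    simp [hg]; ring
  have hcont : Continuous fun θ : ℝ => g (circleMap 0 1 θ) := by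
    rw [continuous_iff_continuousAt]
    intro θ
    exact ContinuousAt.comp (hdiff _ (by simp)).continuousAt (continuous_circleMap 0 1).continuousAt
  have hsplit : ∀ θ : ℝ, u * (Real.sin θ : ℂ) ^ 2 / (1 + u ^ 2 - 2 * u * (Real.cos θ : ℝ)) =
      u * (g (circleMap 0 1 θ) + g (circleMap 0 1 (2 * Real.pi - θ))) := by
    intro θ
    have e1 : circleMap 0 1 θ = Complex.exp (θ * Complex.I) := by simp [circleMap]
    have e2 : circleMap 0 1 (2 * Real.pi - θ) = Complex.exp (-(θ * Complex.I)) := by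
      rw [circleMap, Complex.ofReal_one, zero_add, one_mul]
      push_cast
      rw [sub_mul, Complex.exp_sub, Complex.exp_two_pi_mul_I, Complex.exp_neg, one_div]
    have n1 := hden (circleMap 0 1 θ) (by simp)
    have n2 := hden (circleMap 0 1 (2 * Real.pi - θ)) (by simp)
    rw [one_add_sq_sub_two_mul_cos, Complex.ofReal_sin, Complex.sin, neg_mul]
    rw [e1] at n1
    rw [e2] at n2
    simp only [hg]
    rw [e1, e2]
    have h : Complex.exp (θ * Complex.I) * Complex.exp (-(θ * Complex.I)) = 1 := by
      rw [← Complex.exp_add]; simp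
    set w := Complex.exp (θ * Complex.I)
    set v := Complex.exp (-(θ * Complex.I))
    have n1' := right_ne_zero_of_mul n1
    have n2' := right_ne_zero_of_mul n2
    rw [mul_div_assoc]
    congr 1
    rw [div_add_div _ _ n1 n2, div_eq_div_iff (mul_ne_zero n1' n2') (mul_ne_zero n1 n2)]
    linear_combination 4 * ((1 - u * w) * (1 - u * v)) *
      ((v - w) ^ 2 * Complex.I_sq + (2 - u * (w + v)) * h)
  have hcont' : Continuous fun θ : ℝ => g (circleMap 0 1 (2 * Real.pi - θ)) :=
    hcont.comp (continuous_const.sub continuous_id)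
  simp_rw [hsplit]
  rw [intervalIntegral.integral_const_mul, intervalIntegral.integral_add (hcont.intervalIntegrable _ _)
    (hcont'.intervalIntegrable _ _),
    intervalIntegral.integral_comp_sub_left (fun θ => g (circleMap 0 1 θ)),
    show 2 * Real.pi - Real.pi = Real.pi by ring, sub_zero,
    intervalIntegral.integral_add_adjacent_intervals (hcont.intervalIntegrable _ _)
      (hcont.intervalIntegrable _ _), hcirc]
  ring

/-- The semicircle law in the angular variable. -/
theorem exists_continuous_semicircle_kernel {u : ℂ} (hu0 : u ≠ 0) (hu : ‖u‖ < 1 ∨ u = 1 ∨ u = -1) :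
    ∃ K : ℝ → ℂ, Continuous K ∧ (∀ θ ∈ Set.Ioo 0 Real.pi,
      K θ = (Real.sin θ : ℂ) ^ 2 / (u + u⁻¹ - 2 * (Real.cos θ : ℝ))) ∧
      ∫ θ in (0 : ℝ)..Real.pi, K θ = Real.pi / 2 * u := by
  have hsc : ∀ θ : ℝ, (Real.sin θ : ℂ) ^ 2 = 1 - (Real.cos θ : ℂ) ^ 2 := fun θ => by
    have := Real.sin_sq θ
    exact_mod_cast this
  have hcos : ∀ θ ∈ Set.Ioo 0 Real.pi, (1 : ℂ) - (Real.cos θ : ℂ) ≠ 0 ∧ (1 : ℂ) + (Real.cos θ : ℂ) ≠ 0 := by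
    intro θ hθ
    have hs := Real.sin_pos_of_mem_Ioo hθ
    have h1 := Real.sin_sq_add_cos_sq θ
    constructor
    · intro h
      have : 1 - Real.cos θ = 0 := by exact_mod_cast h
      nlinarith
    · intro h
      have : 1 + Real.cos θ = 0 := by exact_mod_cast h
      nlinarith
  rcases hu with hu | rfl | rfl
  · refine ⟨fun θ => u * (Real.sin θ : ℂ) ^ 2 / (1 + u ^ 2 - 2 * u * (Real.cos θ : ℝ)), ?_, ?_,
      integral_sin_sq_div_of_norm_lt_one hu⟩
    · exact Continuous.div (by fun_prop) (by fun_prop) fun θ => one_add_sq_sub_ne_zero hu θ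
    · intro θ _
      have h : 1 + u ^ 2 - 2 * u * (Real.cos θ : ℝ) = u * (u + u⁻¹ - 2 * (Real.cos θ : ℝ)) := by
        field_simp; ring
      simp only
      rw [h, mul_div_mul_left _ _ hu0]
  · refine ⟨fun θ => ((1 + Real.cos θ) / 2 : ℝ), by fun_prop, ?_, ?_⟩
    · intro θ hθ
      have h1 := (hcos θ hθ).1
      have h2 : (1 : ℂ) + 1⁻¹ - 2 * (Real.cos θ : ℝ) ≠ 0 := by
        rw [inv_one, show (1 : ℂ) + 1 - 2 * (Real.cos θ : ℝ) = 2 * (1 - Real.cos θ) by ring]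
        exact mul_ne_zero two_ne_zero h1
      rw [eq_div_iff h2, hsc]
      push_cast
      ring
    · rw [intervalIntegral.integral_ofReal, intervalIntegral.integral_div, intervalIntegral.integral_add
        (by simp) (Real.continuous_cos.intervalIntegrable _ _), integral_cos]
      simp
  · refine ⟨fun θ => (-(1 - Real.cos θ) / 2 : ℝ), by fun_prop, ?_, ?_⟩
    · intro θ hθ
      have h1 := (hcos θ hθ).2
      have h2 : (-1 : ℂ) + (-1)⁻¹ - 2 * (Real.cos θ : ℝ) ≠ 0 := by
        rw [inv_neg, inv_one, show (-1 : ℂ) + -1 - 2 * (Real.cos θ : ℝ) = -2 * (1 + Real.cos θ) by ring]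
        exact mul_ne_zero (by norm_num) h1
      rw [eq_div_iff h2, hsc, inv_neg, inv_one]
      push_cast
      ring
    · rw [intervalIntegral.integral_ofReal, intervalIntegral.integral_div, intervalIntegral.integral_neg,
        intervalIntegral.integral_sub (by simp) (Real.continuous_cos.intervalIntegrable _ _),
        integral_cos]
      simp [neg_div]

/-- The semicircle density of radius `2 α`, with total mass `α ^ 2`. -/
noncomputable def semicircle (α t : ℝ) : ℝ := Real.sqrt (4 * α ^ 2 - t ^ 2) / (2 * Real.pi)

/-- The Stieltjes transform of the semicircle density at the point `α (u + u⁻¹)` is `α u`. -/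
theorem integral_semicircle {α : ℝ} (hα : 0 < α) {u : ℂ} (hu0 : u ≠ 0)
    (hu : ‖u‖ < 1 ∨ u = 1 ∨ u = -1) :
    IntegrableOn (fun t : ℝ => (semicircle α t : ℂ) / (α * (u + u⁻¹) - t))
        (Set.Ioo (-(2 * α)) (2 * α)) ∧
      ∫ t in Set.Ioo (-(2 * α)) (2 * α), (semicircle α t : ℂ) / (α * (u + u⁻¹) - t) = α * u := by
  obtain ⟨K, hKc, hK, hKi⟩ := exists_continuous_semicircle_kernel hu0 hu
  have himage : (fun θ => 2 * α * Real.cos θ) '' Set.Ioo 0 Real.pi = Set.Ioo (-(2 * α)) (2 * α) := by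
    ext t
    constructor
    · rintro ⟨θ, hθ, rfl⟩
      have h1 : Real.cos θ < 1 := by
        rw [← Real.cos_zero]
        exact Real.cos_lt_cos_of_nonneg_of_le_pi le_rfl hθ.2.le hθ.1
      have h2 : -1 < Real.cos θ := by
        rw [← Real.cos_pi]
        exact Real.cos_lt_cos_of_nonneg_of_le_pi hθ.1.le le_rfl hθ.2
      constructor <;> simp only <;> nlinarith
    · rintro ⟨h1, h2⟩
      have h3 : -1 < t / (2 * α) := by rw [lt_div_iff₀ (by positivity)]; linarith
      have h4 : t / (2 * α) < 1 := by rw [div_lt_one (by positivity)]; linarith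
      refine ⟨Real.arccos (t / (2 * α)), ⟨Real.arccos_pos.2 h4, ?_⟩, ?_⟩
      · refine lt_of_le_of_ne (Real.arccos_le_pi _) fun h => ?_
        exact absurd (Real.arccos_eq_pi.1 h) (not_le.2 h3)
      · simp only
        rw [Real.cos_arccos h3.le h4.le]
        field_simp
  have hderiv : ∀ θ ∈ Set.Ioo 0 Real.pi, HasDerivWithinAt (fun θ => 2 * α * Real.cos θ)
      (2 * α * -Real.sin θ) (Set.Ioo 0 Real.pi) θ := fun θ _ =>
    ((Real.hasDerivAt_cos θ).const_mul _).hasDerivWithinAt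
  have hinj : Set.InjOn (fun θ => 2 * α * Real.cos θ) (Set.Ioo 0 Real.pi) := by
    intro x hx y hy hxy
    have : Real.cos x = Real.cos y := mul_left_cancel₀ (by positivity : 2 * α ≠ 0) hxy
    exact Real.injOn_cos (Set.Ioo_subset_Icc_self hx) (Set.Ioo_subset_Icc_self hy) this
  have hpull : Set.EqOn (fun θ => |2 * α * -Real.sin θ| • ((semicircle α (2 * α * Real.cos θ) : ℂ) /
      (α * (u + u⁻¹) - (2 * α * Real.cos θ : ℝ)))) (fun θ => (2 * α / Real.pi : ℂ) * K θ)
      (Set.Ioo 0 Real.pi) := by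
    intro θ hθ
    have hs := Real.sin_pos_of_mem_Ioo hθ
    have h1 : |2 * α * -Real.sin θ| = 2 * α * Real.sin θ := by
      rw [mul_neg, abs_neg, abs_of_pos (by positivity)]
    have h2 : Real.sqrt (4 * α ^ 2 - (2 * α * Real.cos θ) ^ 2) = 2 * α * Real.sin θ := by
      rw [show 4 * α ^ 2 - (2 * α * Real.cos θ) ^ 2 = (2 * α * Real.sin θ) ^ 2 by
        rw [mul_pow _ (Real.sin θ), Real.sin_sq]; ring]
      exact Real.sqrt_sq (by positivity)
    simp only
    rw [h1, semicircle, h2, hK θ hθ, Complex.real_smul]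
    have h3 : (α : ℂ) * (u + u⁻¹) - (2 * α * Real.cos θ : ℝ) =
        α * (u + u⁻¹ - 2 * (Real.cos θ : ℝ)) := by push_cast; ring
    have h4 : (α : ℂ) ≠ 0 := Complex.ofReal_ne_zero.2 hα.ne'
    have h5 : (Real.pi : ℂ) ≠ 0 := Complex.ofReal_ne_zero.2 Real.pi_ne_zero
    rw [h3]
    push_cast
    rw [div_eq_mul_inv _ ((α : ℂ) * _), mul_inv, div_eq_mul_inv _ (u + _ - _)]
    generalize (u + u⁻¹ - 2 * (Complex.cos θ : ℂ))⁻¹ = y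
    field_simp
  rw [← himage]
  constructor
  · rw [integrableOn_image_iff_integrableOn_abs_deriv_smul measurableSet_Ioo hderiv hinj,
      integrableOn_congr_fun hpull measurableSet_Ioo]
    exact ((hKc.const_mul _).integrableOn_Icc (a := 0) (b := Real.pi)).mono_set Set.Ioo_subset_Icc_self
  · rw [integral_image_eq_integral_abs_deriv_smul measurableSet_Ioo hderiv hinj,
      setIntegral_congr_fun measurableSet_Ioo hpull, ← integral_Ioc_eq_integral_Ioo,
      ← intervalIntegral.integral_of_le Real.pi_pos.le, intervalIntegral.integral_const_mul, hKi]
    have h5 : (Real.pi : ℂ) ≠ 0 := Complex.ofReal_ne_zero.2 Real.pi_ne_zero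
    field_simp

/-! ### Partial fractions and the geometry of the bands -/

open Polynomial in
/-- Partial fractions of a proper fraction whose denominator has simple zeros. -/
theorem eval_div_eval_nodal {F ι : Type*} [Field F] [DecidableEq ι] {s : Finset ι} {v : ι → F}
    (hv : Set.InjOn v s) {f : F[X]} (hf : f.degree < s.card) {z : F} (hz : ∀ i ∈ s, z ≠ v i) :
    f.eval z / (Lagrange.nodal s v).eval z =
      ∑ i ∈ s, f.eval (v i) / ((Lagrange.nodal s v).derivative.eval (v i) * (z - v i)) := by
  have h0 : (Lagrange.nodal s v).eval z ≠ 0 := by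
    rw [Lagrange.eval_nodal]
    exact Finset.prod_ne_zero_iff.2 fun i hi => sub_ne_zero.2 (hz i hi)
  have h1 := congrArg (eval z) (Lagrange.eq_interpolate hv hf)
  rw [Lagrange.eval_interpolate_not_at_node _ hz] at h1
  rw [h1, mul_div_cancel_left₀ _ h0]
  refine Finset.sum_congr rfl fun i hi => ?_
  rw [Lagrange.nodalWeight_eq_eval_derivative_nodal hi, div_eq_mul_inv, mul_inv]
  ring

namespace BandData

variable {N : ℕ} {a b : ℤ → ℝ} {ξ σ : ℕ → ℝ}

open Polynomial in
theorem num_div_den_partialFractions (H : BandData N a b ξ σ) {z : ℂ}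
    (hz : ∀ j ∈ Finset.Icc 1 (N - 1), z ≠ σ j) :
    aeval z (convNum a b (N - 1)) / aeval z (convDen a b (N - 1)) =
      ∑ j ∈ Finset.Icc 1 (N - 1), ((convNum a b (N - 1)).eval (σ j) : ℝ) /
        (((convDen a b (N - 1)).derivative.eval (σ j) : ℝ) * (z - σ j)) := by
  have hnodal : Lagrange.nodal (Finset.Icc 1 (N - 1)) (fun j => (σ j : ℂ)) =
      (convDen a b (N - 1)).map (algebraMap ℝ ℂ) := by
    rw [H.den_eq, Lagrange.nodal_eq, Polynomial.map_prod]
    simp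
  have hinj : Set.InjOn (fun j => (σ j : ℂ)) (Finset.Icc 1 (N - 1)) := fun i hi j hj hij =>
    H.strictMono.injOn (Set.mem_Iic.2 (by have := (Finset.mem_Icc.1 hi).2; omega))
      (Set.mem_Iic.2 (by have := (Finset.mem_Icc.1 hj).2; omega)) (Complex.ofReal_injective hij)
  have h := eval_div_eval_nodal hinj (f := (convNum a b (N - 1)).map (algebraMap ℝ ℂ))
    (by rw [degree_map, Nat.card_Icc, Nat.add_sub_cancel]; exact convNum_degree_lt a b (N - 1)) hz
  rw [hnodal, derivative_map] at h
  simpa only [eval_map_algebraMap, Polynomial.aeval_complex_ofReal] using h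

open Polynomial in
/-- Partial fractions of `1 / ((P - t) B_{N-1})`, solved for the sum over the level set `P = t`. -/
theorem sum_fiber_partialFractions (H : BandData N a b ξ σ) {t : ℝ} {x : ℕ → ℝ}
    (hx : ∀ m < N, σ m < x m ∧ x m < σ (m + 1))
    (hP : discrPoly N a b - C t = ∏ m ∈ Finset.range N, (X - C (x m))) {z : ℂ}
    (hzσ : ∀ j ∈ Finset.Icc 1 (N - 1), z ≠ σ j) (hzx : ∀ m ∈ Finset.range N, z ≠ x m) :
    ∑ m ∈ Finset.range N, 1 / ((((discrPoly N a b).derivative.eval (x m) *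
      (convDen a b (N - 1)).eval (x m) : ℝ) : ℂ) * (z - x m)) =
    1 / ((discrP N a b z - t) * aeval z (convDen a b (N - 1))) -
      ∑ j ∈ Finset.Icc 1 (N - 1), 1 / ((((discrPoly N a b).eval (σ j) - t : ℝ) : ℂ) *
        (((convDen a b (N - 1)).derivative.eval (σ j) : ℝ) * (z - σ j))) := by
  set s : Finset (ℕ ⊕ ℕ) := (Finset.range N).disjSum (Finset.Icc 1 (N - 1)) with hs
  set v : ℕ ⊕ ℕ → ℂ := Sum.elim (fun m => (x m : ℂ)) (fun j => (σ j : ℂ)) with hv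
  have hnodal : Lagrange.nodal s v =
      ((discrPoly N a b - C t) * convDen a b (N - 1)).map (algebraMap ℝ ℂ) := by
    rw [hP, H.den_eq, Lagrange.nodal_eq, hs, Finset.prod_disjSum, Polynomial.map_mul,
      Polynomial.map_prod, Polynomial.map_prod]
    simp [hv]
  have hxσ : ∀ m ∈ Finset.range N, ∀ j ∈ Finset.Icc 1 (N - 1), x m ≠ σ j := by
    intro m hm j hj hmj
    have hj2 := (Finset.mem_Icc.1 hj).2
    obtain ⟨h1, h2⟩ := hx m (Finset.mem_range.1 hm)
    have hm' := Finset.mem_range.1 hm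
    rcases Nat.lt_or_ge m j with h | h
    · have := H.sigma_le (i := m + 1) h (by omega); linarith
    · have := H.sigma_le h hm'.le; linarith
  have hxx : ∀ m ∈ Finset.range N, ∀ k ∈ Finset.range N, x m = x k → m = k := by
    intro m hm k hk hmk
    obtain ⟨h1, h2⟩ := hx m (Finset.mem_range.1 hm)
    obtain ⟨h3, h4⟩ := hx k (Finset.mem_range.1 hk)
    have hm' := Finset.mem_range.1 hm
    have hk' := Finset.mem_range.1 hk
    rcases lt_trichotomy m k with h | h | h
    · have := H.sigma_le (i := m + 1) h hk'.le; linarith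
    · exact h
    · have := H.sigma_le (i := k + 1) h hm'.le; linarith
  have hinj : Set.InjOn v s := by
    rintro (m | j) hi (k | l) hk h
    · rw [Finset.mem_coe, hs, Finset.inl_mem_disjSum] at hi hk
      rw [hxx m hi k hk (Complex.ofReal_injective h)]
    · rw [Finset.mem_coe, hs, Finset.inl_mem_disjSum] at hi
      rw [Finset.mem_coe, hs, Finset.inr_mem_disjSum] at hk
      exact absurd (Complex.ofReal_injective h) (hxσ m hi l hk)
    · rw [Finset.mem_coe, hs, Finset.inr_mem_disjSum] at hi
      rw [Finset.mem_coe, hs, Finset.inl_mem_disjSum] at hk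
      exact absurd (Complex.ofReal_injective h).symm (hxσ k hk j hi)
    · rw [Finset.mem_coe, hs, Finset.inr_mem_disjSum] at hi hk
      rw [H.strictMono.injOn (Set.mem_Iic.2 (by have := (Finset.mem_Icc.1 hi).2; omega))
        (Set.mem_Iic.2 (by have := (Finset.mem_Icc.1 hk).2; omega)) (Complex.ofReal_injective h)]
  have hz : ∀ i ∈ s, z ≠ v i := by
    rintro (m | j) hi
    · exact hzx m (Finset.inl_mem_disjSum.1 hi)
    · exact hzσ j (Finset.inr_mem_disjSum.1 hi)
  have h := eval_div_eval_nodal hinj (f := (1 : ℂ[X])) (by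
    rw [degree_one, hs, Finset.card_disjSum, Finset.card_range]
    have := H.one_le
    exact_mod_cast by omega) hz
  rw [hnodal, derivative_map, hs, Finset.sum_disjSum] at h
  simp only [eval_map_algebraMap, hv, Sum.elim_inl, Sum.elim_inr, eval_one,
    Polynomial.aeval_complex_ofReal, derivative_mul, derivative_sub, derivative_C, sub_zero] at h
  have hxP : ∀ m ∈ Finset.range N, (discrPoly N a b - C t).eval (x m) = 0 := by
    intro m hm
    rw [hP, eval_prod]; exact Finset.prod_eq_zero hm (by simp)
  rw [discrP_eq H.one_le, eq_sub_iff_add_eq]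
  simp only [map_mul, map_sub, aeval_C, Complex.coe_algebraMap] at h
  rw [h]
  congr 1
  · refine Finset.sum_congr rfl fun m hm => ?_
    rw [eval_add, eval_mul, eval_mul, hxP m hm, zero_mul, add_zero]
  · refine Finset.sum_congr rfl fun j hj => ?_
    rw [eval_add, eval_mul, eval_mul, H.den_eval_sigma hj, mul_zero, zero_add, eval_sub, eval_C]
    push_cast
    rw [mul_assoc]

theorem mem_gap_of_mem_band (H : BandData N a b ξ σ) {m : ℕ} (hm : m < N) {x : ℝ}
    (hx : x ∈ Set.Ioo (ξ (2 * m + 1)) (ξ (2 * m + 2))) : σ m < x ∧ x < σ (m + 1) :=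
  ⟨(H.le_left m hm).trans_lt hx.1, hx.2.trans_le (H.right_le m hm)⟩

/-- The open bands are the parts of the gaps `(σ m, σ (m + 1))` where `|P| < 2 α`. -/
theorem mem_band_iff (H : BandData N a b ξ σ) {m : ℕ} (hm : m < N) {x : ℝ} :
    x ∈ Set.Ioo (ξ (2 * m + 1)) (ξ (2 * m + 2)) ↔ (σ m < x ∧ x < σ (m + 1)) ∧
      (discrPoly N a b).eval x ∈ Set.Ioo (-(2 * alphaProd N a)) (2 * alphaProd N a) := by
  have hα := H.alpha_pos
  have hsq : (discrPoly N a b).eval x ∈ Set.Ioo (-(2 * alphaProd N a)) (2 * alphaProd N a) ↔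
      (discrPoly N a b).eval x ^ 2 - 4 * alphaProd N a ^ 2 < 0 := by
    rw [Set.mem_Ioo, ← abs_lt, ← abs_of_pos (by positivity : 0 < 2 * alphaProd N a),
      ← sq_lt_sq, sub_neg]
    ring_nf
  rw [hsq]
  constructor
  · intro hx
    obtain ⟨h1, h2⟩ := H.mem_gap_of_mem_band hm hx
    refine ⟨⟨h1, h2⟩, ?_⟩
    rw [H.eval_sq_sub, ← Finset.mul_prod_erase _ _ (Finset.mem_range.2 hm)]
    refine mul_neg_of_neg_of_pos
      (mul_neg_of_pos_of_neg (sub_pos.2 hx.1) (sub_neg.2 hx.2)) (Finset.prod_pos fun k hk => ?_)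
    obtain ⟨hk1, hk2⟩ := Finset.mem_erase.1 hk
    have hk2' := Finset.mem_range.1 hk2
    have h3 := H.left_le_right k
    rcases lt_or_gt_of_ne hk1 with h | h
    · have h4 := H.sigma_le (i := k + 1) (j := m) h hm.le
      have h5 := H.right_le k hk2'
      exact mul_pos (by linarith) (by linarith)
    · have h4 := H.sigma_le (i := m + 1) (j := k) h hk2'.le
      have h5 := H.le_left k hk2'
      exact mul_pos_of_neg_of_neg (by linarith) (by linarith)
  · rintro ⟨⟨h1, h2⟩, h3⟩
    obtain ⟨k, hk, hx1, hx2⟩ :=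
      mem_stableBands_iff.1 ((H.mem_stableBands_iff_sq_le x).2 (by linarith))
    have hkm : k = m := by
      rcases lt_trichotomy k m with h | h | h
      · have h4 := H.sigma_le (i := k + 1) (j := m) h hm.le
        have h5 := H.right_le k hk
        linarith
      · exact h
      · have h4 := H.sigma_le (i := m + 1) (j := k) h hk.le
        have h5 := H.le_left k hk
        linarith
    subst hkm
    rw [H.eval_sq_sub] at h3
    refine ⟨lt_of_le_of_ne hx1 fun h => ?_, lt_of_le_of_ne hx2 fun h => ?_⟩
    · rw [Finset.prod_eq_zero (Finset.mem_range.2 hk) (by simp [h])] at h3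
      exact lt_irrefl _ h3
    · rw [Finset.prod_eq_zero (Finset.mem_range.2 hk) (by simp [h])] at h3
      exact lt_irrefl _ h3

/-- A level set of `P` meets each gap in one point. -/
theorem eq_fiber_of_mem_gap (H : BandData N a b ξ σ) {t : ℝ} {x : ℕ → ℝ}
    (hx : ∀ m < N, σ m < x m ∧ x m < σ (m + 1))
    (hP : discrPoly N a b - Polynomial.C t =
      ∏ m ∈ Finset.range N, (Polynomial.X - Polynomial.C (x m)))
    {m : ℕ} (hm : m < N) {y : ℝ} (h1 : σ m < y) (h2 : y < σ (m + 1))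
    (hy : (discrPoly N a b).eval y = t) : x m = y := by
  have h := congrArg (Polynomial.eval y) hP
  rw [Polynomial.eval_sub, Polynomial.eval_C, hy, sub_self, Polynomial.eval_prod, eq_comm,
    Finset.prod_eq_zero_iff] at h
  obtain ⟨k, hk, hk0⟩ := h
  have hyk : y = x k := by simpa [sub_eq_zero] using hk0
  have hk' := Finset.mem_range.1 hk
  obtain ⟨h3, h4⟩ := hx k hk'
  rcases lt_trichotomy k m with h | h | h
  · have := H.sigma_le (i := k + 1) (j := m) h hm.le; linarith
  · rw [hyk, h]
  · have := H.sigma_le (i := m + 1) (j := k) h hk'.le; linarith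

theorem image_band (H : BandData N a b ξ σ) {m : ℕ} (hm : m < N) :
    (fun x => (discrPoly N a b).eval x) '' Set.Ioo (ξ (2 * m + 1)) (ξ (2 * m + 2)) =
      Set.Ioo (-(2 * alphaProd N a)) (2 * alphaProd N a) := by
  ext t
  constructor
  · rintro ⟨x, hx, rfl⟩
    exact ((H.mem_band_iff hm).1 hx).2
  · intro ht
    obtain ⟨x, hx, hP⟩ := H.exists_fiber.1 t ht
    have hxt : (discrPoly N a b).eval (x m) = t := by
      have h := congrArg (Polynomial.eval (x m)) hP
      rw [Polynomial.eval_prod, Finset.prod_eq_zero (Finset.mem_range.2 hm) (by simp)] at h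
      simpa [sub_eq_zero] using h
    exact ⟨x m, (H.mem_band_iff hm).2 ⟨hx m hm, by rwa [hxt]⟩, hxt⟩

/-- `P` is injective on each open band, since its level sets meet the band in one point. -/
theorem injOn_band (H : BandData N a b ξ σ) {m : ℕ} (hm : m < N) :
    Set.InjOn (fun x => (discrPoly N a b).eval x) (Set.Ioo (ξ (2 * m + 1)) (ξ (2 * m + 2))) := by
  intro y hy z hz hyz
  obtain ⟨hy1, hy2⟩ := (H.mem_band_iff hm).1 hy
  obtain ⟨hz1, hz2⟩ := (H.mem_band_iff hm).1 hz
  obtain ⟨x, hx, hP⟩ := H.exists_fiber.1 _ hy2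
  rw [← H.eq_fiber_of_mem_gap hx hP hm hy1.1 hy1.2 rfl,
    ← H.eq_fiber_of_mem_gap hx hP hm hz1.1 hz1.2 hyz.symm]

theorem den_ne_zero_of_mem_gap (H : BandData N a b ξ σ) {m : ℕ} (hm : m < N) {x : ℝ}
    (h1 : σ m < x) (h2 : x < σ (m + 1)) : (convDen a b (N - 1)).eval x ≠ 0 := by
  rw [H.den_eq, Polynomial.eval_prod]
  refine Finset.prod_ne_zero_iff.2 fun j hj => ?_
  have hj2 := (Finset.mem_Icc.1 hj).2
  rw [Polynomial.eval_sub, Polynomial.eval_X, Polynomial.eval_C, sub_ne_zero]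
  rcases Nat.lt_or_ge m j with h | h
  · have := H.sigma_le (i := m + 1) h (by omega); linarith
  · have := H.sigma_le h hm.le
    exact (this.trans_lt h1).ne'

/-- On the open bands `P'` and `B_{N-1}` have the same sign. -/
theorem derivative_mul_den_pos (H : BandData N a b ξ σ) {m : ℕ} (hm : m < N) {x : ℝ}
    (hx : x ∈ Set.Ioo (ξ (2 * m + 1)) (ξ (2 * m + 2))) :
    0 < (discrPoly N a b).derivative.eval x * (convDen a b (N - 1)).eval x := by
  obtain ⟨h1, h2⟩ := (H.mem_band_iff hm).1 hx
  obtain ⟨y, hy, hP⟩ := H.exists_fiber.1 _ h2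
  have hyx : y m = x := H.eq_fiber_of_mem_gap hy hP hm h1.1 h1.2 rfl
  have hder : (discrPoly N a b).derivative.eval x =
      ∏ k ∈ (Finset.range N).erase m, (x - y k) := by
    have h := congrArg Polynomial.derivative hP
    rw [Polynomial.derivative_sub, Polynomial.derivative_C, sub_zero, ← Lagrange.nodal_eq] at h
    rw [h, ← hyx, Lagrange.eval_nodal_derivative_eval_node_eq (Finset.mem_range.2 hm),
      Lagrange.eval_nodal]
  have hsign : ∏ k ∈ (Finset.range N).erase m, (x - y k) =
      (-1) ^ (N - 1 - m) * ∏ k ∈ (Finset.range N).erase m, |x - y k| := by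
    rw [← prod_erase_range_ite_lt hm, ← Finset.prod_mul_distrib]
    refine Finset.prod_congr rfl fun k hk => ?_
    obtain ⟨hk1, hk2⟩ := Finset.mem_erase.1 hk
    have hk' := Finset.mem_range.1 hk2
    obtain ⟨h3, h4⟩ := hy k hk'
    rcases lt_or_gt_of_ne hk1 with h | h
    · have := H.sigma_le (i := k + 1) (j := m) h hm.le
      rw [if_pos h, one_mul, abs_of_pos (by linarith)]
    · have := H.sigma_le (i := m + 1) (j := k) h hk'.le
      rw [if_neg h.not_gt, abs_of_neg (by linarith)]; ring
  have hne : ∀ k ∈ (Finset.range N).erase m, x - y k ≠ 0 := by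
    intro k hk h
    obtain ⟨hk1, hk2⟩ := Finset.mem_erase.1 hk
    have hk' := Finset.mem_range.1 hk2
    obtain ⟨h3, h4⟩ := hy k hk'
    rcases lt_or_gt_of_ne hk1 with h' | h'
    · have := H.sigma_le (i := k + 1) (j := m) h' hm.le; linarith
    · have := H.sigma_le (i := m + 1) (j := k) h' hk'.le; linarith
  rw [hder, hsign, H.den_sign_on_gap hm h1.1.le h1.2.le, mul_mul_mul_comm, ← mul_pow]
  norm_num
  exact mul_pos (Finset.prod_pos fun k hk => abs_pos.2 (hne k hk))
    (abs_pos.2 (H.den_ne_zero_of_mem_gap hm h1.1 h1.2))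

end BandData

/-! ### The change of variables `t = P x` -/

/-- The density of the absolutely continuous part, `√(4 α² - P²) / (2 π |B_{N-1}|)`, in real form. -/
noncomputable def realDensity (N : ℕ) (a b : ℤ → ℝ) (x : ℝ) : ℝ :=
  semicircle (alphaProd N a) ((discrPoly N a b).eval x) / |(convDen a b (N - 1)).eval x|

/-- The density in the variable `t = P x`, at the point `x = X t m` of the level set `P = t` in the
`m`-th band. -/
noncomputable def levelDensity (N : ℕ) (a b : ℤ → ℝ) (X : ℝ → ℕ → ℝ) (m : ℕ) (t : ℝ) : ℝ :=
  semicircle (alphaProd N a) t /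
    ((discrPoly N a b).derivative.eval (X t m) * (convDen a b (N - 1)).eval (X t m))

/-- The weighted sum over the level set `P = t` of the densities divided by `z - x`, in the form given by
partial fractions. -/
noncomputable def levelTransform (N : ℕ) (a b : ℤ → ℝ) (σ : ℕ → ℝ) (z : ℂ) (t : ℝ) : ℂ :=
  (semicircle (alphaProd N a) t : ℂ) / (discrP N a b z - t) *
      (Polynomial.aeval z (convDen a b (N - 1)))⁻¹ -
    ∑ j ∈ Finset.Icc 1 (N - 1), (semicircle (alphaProd N a) t : ℂ) / (discrP N a b (σ j) - t) *
      (((convDen a b (N - 1)).derivative.eval (σ j) : ℝ) * (z - σ j))⁻¹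

/-- `X t` enumerates the level set `P = t`, for `|t| < 2 α`, by the gaps between the `σ m`. -/
def IsFiber (N : ℕ) (a b : ℤ → ℝ) (σ : ℕ → ℝ) (X : ℝ → ℕ → ℝ) : Prop :=
  ∀ t ∈ Set.Ioo (-(2 * alphaProd N a)) (2 * alphaProd N a),
    (∀ m < N, σ m < X t m ∧ X t m < σ (m + 1)) ∧ discrPoly N a b - Polynomial.C t =
      ∏ m ∈ Finset.range N, (Polynomial.X - Polynomial.C (X t m))

theorem semicircle_nonneg (α t : ℝ) : 0 ≤ semicircle α t := by
  unfold semicircle; positivity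

namespace BandData

variable {N : ℕ} {a b : ℤ → ℝ} {ξ σ : ℕ → ℝ} {X : ℝ → ℕ → ℝ}

theorem exists_isFiber (H : BandData N a b ξ σ) : ∃ X, IsFiber N a b σ X := by
  have h : ∀ t, ∃ x : ℕ → ℝ, t ∈ Set.Ioo (-(2 * alphaProd N a)) (2 * alphaProd N a) →
      (∀ m < N, σ m < x m ∧ x m < σ (m + 1)) ∧ discrPoly N a b - Polynomial.C t =
        ∏ m ∈ Finset.range N, (Polynomial.X - Polynomial.C (x m)) := by
    intro t
    by_cases ht : t ∈ Set.Ioo (-(2 * alphaProd N a)) (2 * alphaProd N a)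
    · obtain ⟨x, hx⟩ := H.exists_fiber.1 t ht
      exact ⟨x, fun _ => hx⟩
    · exact ⟨fun _ => 0, fun h => absurd h ht⟩
  choose X hX using h
  exact ⟨X, hX⟩

theorem fiber_eval (hX : IsFiber N a b σ X) {t : ℝ}
    (ht : t ∈ Set.Ioo (-(2 * alphaProd N a)) (2 * alphaProd N a)) {m : ℕ} (hm : m < N) :
    (discrPoly N a b).eval (X t m) = t := by
  have h := congrArg (Polynomial.eval (X t m)) (hX t ht).2
  rw [Polynomial.eval_prod, Finset.prod_eq_zero (Finset.mem_range.2 hm) (by simp)] at h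
  simpa [sub_eq_zero] using h

theorem fiber_mem_band (H : BandData N a b ξ σ) (hX : IsFiber N a b σ X) {t : ℝ}
    (ht : t ∈ Set.Ioo (-(2 * alphaProd N a)) (2 * alphaProd N a)) {m : ℕ} (hm : m < N) :
    X t m ∈ Set.Ioo (ξ (2 * m + 1)) (ξ (2 * m + 2)) :=
  (H.mem_band_iff hm).2 ⟨(hX t ht).1 m hm, by rwa [fiber_eval hX ht hm]⟩

theorem fiber_of_mem_band (H : BandData N a b ξ σ) (hX : IsFiber N a b σ X) {m : ℕ} (hm : m < N)
    {x : ℝ} (hx : x ∈ Set.Ioo (ξ (2 * m + 1)) (ξ (2 * m + 2))) :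
    X ((discrPoly N a b).eval x) m = x := by
  obtain ⟨h1, h2⟩ := (H.mem_band_iff hm).1 hx
  exact H.eq_fiber_of_mem_gap (hX _ h2).1 (hX _ h2).2 hm h1.1 h1.2 rfl

theorem levelDensity_nonneg (H : BandData N a b ξ σ) (hX : IsFiber N a b σ X) {t : ℝ}
    (ht : t ∈ Set.Ioo (-(2 * alphaProd N a)) (2 * alphaProd N a)) {m : ℕ} (hm : m < N) :
    0 ≤ levelDensity N a b X m t :=
  div_nonneg (semicircle_nonneg _ _) (H.derivative_mul_den_pos hm (H.fiber_mem_band hX ht hm)).le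

theorem abs_derivative_mul_levelDensity (H : BandData N a b ξ σ) (hX : IsFiber N a b σ X) {m : ℕ}
    (hm : m < N) {x : ℝ} (hx : x ∈ Set.Ioo (ξ (2 * m + 1)) (ξ (2 * m + 2))) :
    |(discrPoly N a b).derivative.eval x| * levelDensity N a b X m ((discrPoly N a b).eval x) =
      realDensity N a b x := by
  have h1 := H.derivative_mul_den_pos hm hx
  have h2 : |(discrPoly N a b).derivative.eval x| ≠ 0 := abs_ne_zero.2 (left_ne_zero_of_mul h1.ne')
  rw [levelDensity, realDensity, H.fiber_of_mem_band hX hm hx, ← abs_of_pos h1, abs_mul,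
    mul_div_assoc', mul_div_mul_left _ _ h2]

theorem hasDerivWithinAt_discr (s : Set ℝ) (x : ℝ) :
    HasDerivWithinAt (fun x => (discrPoly N a b).eval x) ((discrPoly N a b).derivative.eval x) s x :=
  ((discrPoly N a b).hasDerivAt x).hasDerivWithinAt

theorem pullback_eqOn (H : BandData N a b ξ σ) (hX : IsFiber N a b σ X) {m : ℕ} (hm : m < N)
    (g : ℝ → ℂ) : Set.EqOn (fun x => |(discrPoly N a b).derivative.eval x| •
      ((levelDensity N a b X m ((discrPoly N a b).eval x) : ℂ) *
        g (X ((discrPoly N a b).eval x) m)))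
      (fun x => (realDensity N a b x : ℂ) * g x) (Set.Ioo (ξ (2 * m + 1)) (ξ (2 * m + 2))) := by
  intro x hx
  simp only
  rw [← H.abs_derivative_mul_levelDensity hX hm hx, H.fiber_of_mem_band hX hm hx, Complex.real_smul]
  push_cast
  ring

/-- The change of variables `t = P x` on a band. -/
theorem integrableOn_level_iff (H : BandData N a b ξ σ) (hX : IsFiber N a b σ X) {m : ℕ} (hm : m < N)
    (g : ℝ → ℂ) :
    IntegrableOn (fun t => (levelDensity N a b X m t : ℂ) * g (X t m))
        (Set.Ioo (-(2 * alphaProd N a)) (2 * alphaProd N a)) ↔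
      IntegrableOn (fun x => (realDensity N a b x : ℂ) * g x)
        (Set.Ioo (ξ (2 * m + 1)) (ξ (2 * m + 2))) := by
  rw [← H.image_band hm, integrableOn_image_iff_integrableOn_abs_deriv_smul measurableSet_Ioo
    (fun x _ => hasDerivWithinAt_discr _ x) (H.injOn_band hm),
    integrableOn_congr_fun (H.pullback_eqOn hX hm g) measurableSet_Ioo]

theorem integral_level_eq (H : BandData N a b ξ σ) (hX : IsFiber N a b σ X) {m : ℕ} (hm : m < N)
    (g : ℝ → ℂ) :
    ∫ t in Set.Ioo (-(2 * alphaProd N a)) (2 * alphaProd N a),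
        (levelDensity N a b X m t : ℂ) * g (X t m) =
      ∫ x in Set.Ioo (ξ (2 * m + 1)) (ξ (2 * m + 2)), (realDensity N a b x : ℂ) * g x := by
  rw [← H.image_band hm, integral_image_eq_integral_abs_deriv_smul measurableSet_Ioo
    (fun x _ => hasDerivWithinAt_discr _ x) (H.injOn_band hm),
    setIntegral_congr_fun measurableSet_Ioo (H.pullback_eqOn hX hm g)]

/-- The semicircle transform at `P z` is `α h(z)`; this includes the points `σ j`, where `P` may be
an end point `±2 α` of the semicircle. -/
theorem integral_semicircle_discrP (H : BandData N a b ξ σ) {z : ℂ}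
    (hz : z ∉ (fun x : ℝ => (x : ℂ)) '' stableBands N ξ ∨ ∃ i ≤ N, z = σ i) :
    IntegrableOn (fun t : ℝ => (semicircle (alphaProd N a) t : ℂ) / (discrP N a b z - t))
        (Set.Ioo (-(2 * alphaProd N a)) (2 * alphaProd N a)) ∧
      ∫ t in Set.Ioo (-(2 * alphaProd N a)) (2 * alphaProd N a),
        (semicircle (alphaProd N a) t : ℂ) / (discrP N a b z - t) =
          alphaProd N a * hMinus N a b ξ z := by
  have hu : ‖hMinus N a b ξ z‖ < 1 ∨ hMinus N a b ξ z = 1 ∨ hMinus N a b ξ z = -1 := by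
    by_cases h : z ∈ (fun x : ℝ => (x : ℂ)) '' stableBands N ξ
    · obtain ⟨i, hi, rfl⟩ := hz.resolve_left (not_not_intro h)
      exact Or.inr (H.hMinus_sigma_of_mem_bands hi (ofReal_mem_image_iff.1 h)).2
    · exact Or.inl (H.norm_hMinus_lt_one h)
  have h := integral_semicircle H.alpha_pos (H.hMinus_ne_zero z) hu
  rwa [H.alpha_mul_hMinus_add_inv z] at h

theorem integral_levelTransform (H : BandData N a b ξ σ) {z : ℂ}
    (hz : z ∉ (fun x : ℝ => (x : ℂ)) '' stableBands N ξ) :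
    IntegrableOn (levelTransform N a b σ z)
        (Set.Ioo (-(2 * alphaProd N a)) (2 * alphaProd N a)) ∧
      ∫ t in Set.Ioo (-(2 * alphaProd N a)) (2 * alphaProd N a), levelTransform N a b σ z t =
        alphaProd N a * hMinus N a b ξ z * (Polynomial.aeval z (convDen a b (N - 1)))⁻¹ -
        ∑ j ∈ Finset.Icc 1 (N - 1), alphaProd N a * hMinus N a b ξ (σ j) *
          (((convDen a b (N - 1)).derivative.eval (σ j) : ℝ) * (z - σ j))⁻¹ := by
  have h1 := H.integral_semicircle_discrP (Or.inl hz)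
  have h2 : ∀ j ∈ Finset.Icc 1 (N - 1), _ := fun j hj =>
    H.integral_semicircle_discrP (z := σ j)
      (Or.inr ⟨j, by have := (Finset.mem_Icc.1 hj).2; omega, rfl⟩)
  have i1 := h1.1.mul_const (Polynomial.aeval z (convDen a b (N - 1)))⁻¹
  have i2 : ∀ j ∈ Finset.Icc 1 (N - 1), IntegrableOn (fun t : ℝ =>
      (semicircle (alphaProd N a) t : ℂ) / (discrP N a b (σ j) - t) *
      (((convDen a b (N - 1)).derivative.eval (σ j) : ℝ) * (z - σ j))⁻¹)
      (Set.Ioo (-(2 * alphaProd N a)) (2 * alphaProd N a)) := fun j hj => (h2 j hj).1.mul_const _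
  have i3 := integrable_finsetSum _ i2
  refine ⟨i1.sub i3, ?_⟩
  simp only [levelTransform]
  rw [integral_sub i1 i3, integral_finsetSum _ i2, integral_mul_const, h1.2]
  congr 1
  refine Finset.sum_congr rfl fun j hj => ?_
  rw [integral_mul_const, (h2 j hj).2]

theorem levelTransform_eq_sum (H : BandData N a b ξ σ) (hX : IsFiber N a b σ X) {z : ℂ}
    (hz : z ∈ bandDomain N ξ σ) {t : ℝ}
    (ht : t ∈ Set.Ioo (-(2 * alphaProd N a)) (2 * alphaProd N a)) :
    levelTransform N a b σ z t =
      ∑ m ∈ Finset.range N, (levelDensity N a b X m t : ℂ) * (1 / (z - X t m)) := by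
  have hzσ : ∀ j ∈ Finset.Icc 1 (N - 1), z ≠ σ j := fun j hj h =>
    hz ⟨σ j, Or.inr ⟨j, Finset.mem_Icc.1 hj, rfl⟩, h.symm⟩
  have hzx : ∀ m ∈ Finset.range N, z ≠ X t m := fun m hm h => by
    refine hz ⟨X t m, Or.inl ?_, h.symm⟩
    have hm' := Finset.mem_range.1 hm
    exact mem_stableBands_iff.2 ⟨m, hm', Set.Ioo_subset_Icc_self (H.fiber_mem_band hX ht hm')⟩
  have h := H.sum_fiber_partialFractions (hX t ht).1 (hX t ht).2 hzσ hzx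
  have h' := congrArg (fun w => (semicircle (alphaProd N a) t : ℂ) * w) h
  beta_reduce at h'
  rw [mul_sub, Finset.mul_sum, Finset.mul_sum] at h'
  rw [levelTransform]
  convert h'.symm using 1
  · congr 1
    · rw [one_div, mul_inv, div_eq_mul_inv, mul_assoc]
    · refine Finset.sum_congr rfl fun j _ => ?_
      rw [H.discrP_ofReal, Complex.ofReal_sub, one_div, mul_inv (_ - _), div_eq_mul_inv, mul_assoc]
  · refine Finset.sum_congr rfl fun m _ => ?_
    rw [levelDensity]
    push_cast
    rw [one_div, one_div, mul_inv, div_eq_mul_inv, mul_assoc]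

/-- The density is integrable on each band: being nonnegative, its contribution to the sum over the
level sets is bounded by the sum, which is known from partial fractions. -/
theorem integrableOn_realDensity (H : BandData N a b ξ σ) {m : ℕ} (hm : m < N) :
    IntegrableOn (realDensity N a b) (Set.Ioo (ξ (2 * m + 1)) (ξ (2 * m + 2))) := by
  obtain ⟨X, hX⟩ := H.exists_isFiber
  have hcont : ContinuousOn (realDensity N a b) (Set.Ioo (ξ (2 * m + 1)) (ξ (2 * m + 2))) := by
    unfold realDensity semicircle
    refine ContinuousOn.div (by fun_prop) (by fun_prop) fun x hx => ?_
    obtain ⟨h1, h2⟩ := H.mem_gap_of_mem_band hm hx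
    exact abs_ne_zero.2 (H.den_ne_zero_of_mem_gap hm h1 h2)
  refine ⟨hcont.aestronglyMeasurable measurableSet_Ioo, ?_⟩
  -- a point of the real axis beyond all bands
  set z₀ : ℝ := σ N + 1 with hz₀
  have hσle : ∀ i ≤ N, σ i < z₀ := fun i hi => by have := H.sigma_le hi le_rfl; linarith
  have hz₀b : (z₀ : ℂ) ∉ (fun x : ℝ => (x : ℂ)) '' stableBands N ξ := by
    rw [ofReal_mem_image_iff, mem_stableBands_iff]
    rintro ⟨k, hk, -, hx⟩
    have := H.right_le k hk
    have := hσle (k + 1) hk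
    linarith
  have hz₀d : (z₀ : ℂ) ∈ bandDomain N ξ σ := by
    rw [bandDomain, Set.mem_compl_iff, ofReal_mem_image_iff, Set.mem_union, not_or]
    refine ⟨fun h => hz₀b (ofReal_mem_image_iff.2 h), ?_⟩
    rintro ⟨j, hj, hjz⟩
    exact (hσle j (by have := hj.2; omega)).ne hjz
  have hbound : ∀ t ∈ Set.Ioo (-(2 * alphaProd N a)) (2 * alphaProd N a),
      levelDensity N a b X m t ≤ (z₀ - σ 0) * ‖levelTransform N a b σ z₀ t‖ := by
    intro t ht
    have hpos : ∀ k < N, 0 < z₀ - X t k := fun k hk => by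
      have := ((hX t ht).1 k hk).2
      have := hσle (k + 1) hk
      linarith
    have hsum : levelTransform N a b σ z₀ t =
        ((∑ k ∈ Finset.range N, levelDensity N a b X k t * (1 / (z₀ - X t k)) : ℝ) : ℂ) := by
      rw [H.levelTransform_eq_sum hX hz₀d ht]
      push_cast
      rfl
    have hnn : ∀ k ∈ Finset.range N, 0 ≤ levelDensity N a b X k t * (1 / (z₀ - X t k)) := fun k hk =>
      mul_nonneg (H.levelDensity_nonneg hX ht (Finset.mem_range.1 hk))
        (one_div_nonneg.2 (hpos k (Finset.mem_range.1 hk)).le)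
    rw [hsum, Complex.norm_real, Real.norm_of_nonneg (Finset.sum_nonneg hnn)]
    have h1 := Finset.single_le_sum hnn (Finset.mem_range.2 hm)
    have h2 : z₀ - X t m ≤ z₀ - σ 0 := by
      have := ((hX t ht).1 m hm).1
      have := H.sigma_le (Nat.zero_le m) hm.le
      linarith
    calc levelDensity N a b X m t
        = (z₀ - X t m) * (levelDensity N a b X m t * (1 / (z₀ - X t m))) := by
          have := (hpos m hm).ne'
          field_simp
      _ ≤ (z₀ - σ 0) * (levelDensity N a b X m t * (1 / (z₀ - X t m))) :=
          mul_le_mul_of_nonneg_right h2 (hnn m (Finset.mem_range.2 hm))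
      _ ≤ _ := mul_le_mul_of_nonneg_left h1 (by have := hpos m hm; linarith)
  have hint : Integrable (fun t => (z₀ - σ 0) * ‖levelTransform N a b σ z₀ t‖)
      (volume.restrict (Set.Ioo (-(2 * alphaProd N a)) (2 * alphaProd N a))) :=
    (H.integral_levelTransform hz₀b).1.norm.const_mul _
  have hnonneg : ∀ x, 0 ≤ realDensity N a b x := fun x =>
    div_nonneg (semicircle_nonneg _ _) (abs_nonneg _)
  rw [hasFiniteIntegral_iff_ofReal (Filter.Eventually.of_forall hnonneg)]
  have hchange : ∫⁻ x in Set.Ioo (ξ (2 * m + 1)) (ξ (2 * m + 2)), ENNReal.ofReal (realDensity N a b x) =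
      ∫⁻ t in Set.Ioo (-(2 * alphaProd N a)) (2 * alphaProd N a),
        ENNReal.ofReal (levelDensity N a b X m t) := by
    rw [← H.image_band hm, lintegral_image_eq_lintegral_abs_deriv_mul measurableSet_Ioo
      (fun x _ => hasDerivWithinAt_discr _ x) (H.injOn_band hm)]
    refine setLIntegral_congr_fun measurableSet_Ioo fun x hx => ?_
    rw [← H.abs_derivative_mul_levelDensity hX hm hx, ENNReal.ofReal_mul (abs_nonneg _)]
  rw [hchange]
  refine lt_of_le_of_lt (setLIntegral_mono' measurableSet_Ioo fun t ht =>
    ENNReal.ofReal_le_ofReal (hbound t ht)) hint.lintegral_lt_top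

theorem integrableOn_realDensity_mul (H : BandData N a b ξ σ) {z : ℂ}
    (hz : z ∉ (fun x : ℝ => (x : ℂ)) '' stableBands N ξ) {m : ℕ} (hm : m < N) :
    IntegrableOn (fun x => (realDensity N a b x : ℂ) * (1 / (z - x)))
      (Set.Ioo (ξ (2 * m + 1)) (ξ (2 * m + 2))) := by
  rw [← integrableOn_Icc_iff_integrableOn_Ioo]
  have h1 : IntegrableOn (fun x => (realDensity N a b x : ℂ))
      (Set.Icc (ξ (2 * m + 1)) (ξ (2 * m + 2))) := by
    rw [integrableOn_Icc_iff_integrableOn_Ioo]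
    exact (H.integrableOn_realDensity hm).ofReal
  refine h1.mul_continuousOn ?_ isCompact_Icc
  refine ContinuousOn.div (by fun_prop) (by fun_prop) fun x hx h => hz ?_
  exact ⟨x, mem_stableBands_iff.2 ⟨m, hm, hx⟩, (sub_eq_zero.1 h).symm⟩

theorem sum_integral_realDensity (H : BandData N a b ξ σ) {z : ℂ} (hz : z ∈ bandDomain N ξ σ) :
    ∑ m ∈ Finset.range N, ∫ x in Set.Ioo (ξ (2 * m + 1)) (ξ (2 * m + 2)),
        (realDensity N a b x : ℂ) * (1 / (z - x)) =
      alphaProd N a * hMinus N a b ξ z * (Polynomial.aeval z (convDen a b (N - 1)))⁻¹ -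
        ∑ j ∈ Finset.Icc 1 (N - 1), alphaProd N a * hMinus N a b ξ (σ j) *
          (((convDen a b (N - 1)).derivative.eval (σ j) : ℝ) * (z - σ j))⁻¹ := by
  obtain ⟨X, hX⟩ := H.exists_isFiber
  have hzb : z ∉ (fun x : ℝ => (x : ℂ)) '' stableBands N ξ := fun h =>
    hz (Set.image_mono Set.subset_union_left h)
  rw [← (H.integral_levelTransform hzb).2, setIntegral_congr_fun measurableSet_Ioo
    fun t ht => H.levelTransform_eq_sum hX hz ht, integral_finsetSum]
  · exact Finset.sum_congr rfl fun m hm =>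
      (H.integral_level_eq hX (Finset.mem_range.1 hm) fun x : ℝ => 1 / (z - x)).symm
  · exact fun m hm => (H.integrableOn_level_iff hX (Finset.mem_range.1 hm) fun x : ℝ => 1 / (z - x)).2
      (H.integrableOn_realDensity_mul hzb (Finset.mem_range.1 hm))

/-- The poles of `A_{N-1} / B_{N-1}` combine with those left by the change of variables, so that the
residue at `σ j` is `resCoeff`. -/
theorem stieltjes_formula (H : BandData N a b ξ σ) {z : ℂ} (hz : z ∈ bandDomain N ξ σ) :
    (alphaProd N a * hMinus N a b ξ z + Polynomial.aeval z (convNum a b (N - 1))) /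
        Polynomial.aeval z (convDen a b (N - 1)) =
      ∑ j ∈ Finset.Icc 1 (N - 1), resCoeff N a b ξ σ j / (z - σ j) +
        ∑ m ∈ Finset.range N, ∫ x in Set.Ioo (ξ (2 * m + 1)) (ξ (2 * m + 2)),
          (realDensity N a b x : ℂ) * (1 / (z - x)) := by
  have hzσ : ∀ j ∈ Finset.Icc 1 (N - 1), z ≠ σ j := fun j hj h =>
    hz ⟨σ j, Or.inr ⟨j, Finset.mem_Icc.1 hj, rfl⟩, h.symm⟩
  rw [H.sum_integral_realDensity hz, add_div, H.num_div_den_partialFractions hzσ, add_sub_left_comm,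
    ← Finset.sum_sub_distrib, div_eq_mul_inv]
  congr 1
  refine Finset.sum_congr rfl fun j hj => ?_
  rw [H.resCoeff_eq hj, div_div, ← div_eq_mul_inv, ← sub_div]
  congr 1
  ring

end BandData

/-! ### The Stieltjes function and its measure -/

namespace BandData

variable {N : ℕ} {a b : ℤ → ℝ} {ξ σ : ℕ → ℝ}

theorem isBranchPoints (H : BandData N a b ξ σ) : IsBranchPoints N a b ξ := by
  refine ⟨monotoneOn_of_le_succ Set.ordConnected_Icc fun i _ hi hi' => ?_, H.discr_sq_sub⟩
  obtain ⟨h1, -⟩ := hi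
  have h2 : i + 1 ≤ 2 * N := hi'.2
  change ξ i ≤ ξ (i + 1)
  rcases Nat.even_or_odd' i with ⟨k, rfl | rfl⟩
  · obtain ⟨m, rfl⟩ : ∃ m, k = m + 1 := ⟨k - 1, by omega⟩
    exact (H.right_le m (by omega)).trans (H.le_left (m + 1) (by omega))
  · exact H.left_le_right k

theorem isAuxiliarySpectrum (H : BandData N a b ξ σ) : IsAuxiliarySpectrum N a b σ := by
  refine ⟨H.strictMono.mono fun i hi => Set.mem_Iic.2 (by have := hi.2; omega), fun z => ?_⟩
  rw [deltaNN_eq, H.den_eq]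
  simp

theorem isCompact_bandDomain_compl :
    IsCompact (stableBands N ξ ∪ σ '' Set.Icc 1 (N - 1)) :=
  (isCompact_stableBands N ξ).union ((Set.finite_Icc 1 (N - 1)).image σ).isCompact

theorem isOpen_bandDomain : IsOpen (bandDomain N ξ σ) :=
  (isCompact_bandDomain_compl.image Complex.continuous_ofReal).isClosed.isOpen_compl

theorem bandDomain_mem_cobounded : bandDomain N ξ σ ∈ Bornology.cobounded ℂ :=
  (isCompact_bandDomain_compl.image Complex.continuous_ofReal).isBounded

theorem notMem_bands_of_mem_bandDomain {z : ℂ} (hz : z ∈ bandDomain N ξ σ) :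
    z ∉ (fun x : ℝ => (x : ℂ)) '' stableBands N ξ := fun h =>
  hz (Set.image_mono Set.subset_union_left h)

theorem ne_sigma_of_mem_bandDomain {z : ℂ} (hz : z ∈ bandDomain N ξ σ) :
    ∀ j ∈ Finset.Icc 1 (N - 1), z ≠ σ j := fun j hj h =>
  hz ⟨σ j, Or.inr ⟨j, Finset.mem_Icc.1 hj, rfl⟩, h.symm⟩

theorem aeval_den_ne_zero (H : BandData N a b ξ σ) {z : ℂ} (hz : z ∈ bandDomain N ξ σ) :
    Polynomial.aeval z (convDen a b (N - 1)) ≠ 0 := by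
  rw [H.den_eq]
  simp only [map_prod, map_sub, Polynomial.aeval_X, Polynomial.aeval_C, Complex.coe_algebraMap]
  exact Finset.prod_ne_zero_iff.2 fun j hj => sub_ne_zero.2 (ne_sigma_of_mem_bandDomain hz j hj)

end BandData

/-- The fixed point of the Möbius map of one period of the continued fraction, on the sheet where `h`
vanishes at infinity. -/
noncomputable def stieltjesFunction (N : ℕ) (a b : ℤ → ℝ) (ξ : ℕ → ℝ) (z : ℂ) : ℂ :=
  (alphaProd N a * hMinus N a b ξ z + Polynomial.aeval z (convNum a b (N - 1))) /
    Polynomial.aeval z (convDen a b (N - 1))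

namespace BandData

variable {N : ℕ} {a b : ℤ → ℝ} {ξ σ : ℕ → ℝ}

theorem isStieltjesFunction (H : BandData N a b ξ σ) (hpa : ∀ i, a (i + N) = a i)
    (hpb : ∀ i, b (i + N) = b i) :
    IsStieltjesFunction a b (bandDomain N ξ σ) (stieltjesFunction N a b ξ) := by
  refine ⟨fun z hz => ?_, ?_⟩
  · refine (DifferentiableAt.div ?_ (Polynomial.differentiable_aeval _ z)
      (H.aeval_den_ne_zero hz)).differentiableWithinAt
    exact ((H.differentiableAt_hMinus (notMem_bands_of_mem_bandDomain hz)).const_mul _).add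
      (Polynomial.differentiable_aeval _ z)
  · obtain ⟨C₁, hC₁, ha⟩ := exists_bound_of_periodic H.one_le (f := fun i => a i ^ 2)
      (fun i => by simp only [hpa])
    obtain ⟨C₂, hC₂, hb⟩ := exists_bound_of_periodic H.one_le hpb
    set C := max C₁ C₂
    have hfar : ∀ᶠ z : ℂ in Bornology.cobounded ℂ, max 1 (alphaProd N a) + 1 + 2 * C ≤ ‖z‖ :=
      tendsto_norm_cobounded_atTop.eventually_ge_atTop _
    filter_upwards [hfar, bandDomain_mem_cobounded (N := N) (ξ := ξ) (σ := σ)] with z hz hzd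
    have hα := H.alpha_pos
    refine tendsto_convs H.one_le hα hpa hpb (hC₁.trans (le_max_left _ _))
      (fun i => (le_abs_self _).trans ((ha i).trans (le_max_left _ _)))
      (fun i => (hb i).trans (le_max_right _ _)) hz
      (μ := alphaProd N a * hMinus N a b ξ z) ?_ ?_ ?_
    · rw [stieltjesFunction, div_mul_cancel₀ _ (H.aeval_den_ne_zero hzd)]
    · linear_combination (alphaProd N a : ℂ) * H.hMinus_quadratic z
    · rw [norm_mul, Complex.norm_real, Real.norm_of_nonneg hα.le]
      exact mul_le_of_le_one_right hα.le
        (H.norm_hMinus_lt_one (notMem_bands_of_mem_bandDomain hzd)).le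

/-- The analytic prolongation is unique, the domain being connected. -/
theorem eqOn_of_isStieltjesFunction {φ ψ : ℂ → ℂ}
    (hφ : IsStieltjesFunction a b (bandDomain N ξ σ) φ)
    (hψ : IsStieltjesFunction a b (bandDomain N ξ σ) ψ) : Set.EqOn φ ψ (bandDomain N ξ σ) := by
  have hev : ∀ᶠ z in Bornology.cobounded ℂ, φ z = ψ z := by
    filter_upwards [hφ.2, hψ.2] with z h1 h2
    exact tendsto_nhds_unique h1 h2
  obtain ⟨R, -, hR⟩ := (Metric.hasBasis_cobounded_compl_closedBall (0 : ℂ)).mem_iff.1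
    (inter_mem hev (bandDomain_mem_cobounded (N := N) (ξ := ξ) (σ := σ)))
  have hopen : IsOpen (Metric.closedBall (0 : ℂ) R)ᶜ := Metric.isClosed_closedBall.isOpen_compl
  have hmem : ((|R| + 1 : ℝ) : ℂ) ∈ (Metric.closedBall (0 : ℂ) R)ᶜ := by
    rw [Set.mem_compl_iff, Metric.mem_closedBall, dist_zero_right, Complex.norm_real,
      Real.norm_of_nonneg (by positivity)]
    have := le_abs_self R
    linarith
  refine (hφ.1.analyticOnNhd isOpen_bandDomain).eqOn_of_preconnected_of_eventuallyEq
    (hψ.1.analyticOnNhd isOpen_bandDomain)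
    (isPreconnected_compl_ofReal_image isCompact_bandDomain_compl) (hR hmem).2 ?_
  filter_upwards [hopen.mem_nhds hmem] with z hz
  exact (hR hz).1

theorem continuousAt_sqrtDiscr_sigma (H : BandData N a b ξ σ) {i : ℕ} (hi : i ≤ N) :
    ContinuousAt (sqrtDiscr N ξ) (σ i) := by
  by_cases hb : σ i ∈ stableBands N ξ
  · have h0 := (H.hMinus_sigma_of_mem_bands hi hb).1
    have hc : Tendsto (fun z => ‖sqrtDiscr N ξ z ^ 2‖) (𝓝 (σ i : ℂ)) (𝓝 0) := by
      have h1 : ContinuousAt (fun z => ‖discrP N a b z ^ 2 - 4 * (alphaProd N a : ℂ) ^ 2‖)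
          (σ i : ℂ) := (((continuous_discrP H.one_le).pow 2).sub continuous_const).norm.continuousAt
      have h2 := h1.tendsto
      simp only [← H.sqrtDiscr_sq, h0] at h2
      simpa using h2
    have hs := hc.sqrt
    rw [ContinuousAt, h0, tendsto_zero_iff_norm_tendsto_zero]
    simpa [norm_pow, Real.sqrt_sq (norm_nonneg _)] using hs
  · exact (H.differentiableAt_sqrtDiscr fun h => hb (ofReal_mem_image_iff.1 h)).continuousAt

theorem tendsto_residue (H : BandData N a b ξ σ) {j : ℕ} (hj : j ∈ Finset.Icc 1 (N - 1)) :
    Tendsto (fun z : ℂ => (z - (σ j : ℂ)) * stieltjesFunction N a b ξ z)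
      (𝓝[bandDomain N ξ σ] (σ j : ℂ)) (𝓝 (resCoeff N a b ξ σ j)) := by
  have hjN : j ≤ N := by have := (Finset.mem_Icc.1 hj).2; omega
  have hsub : 𝓝[bandDomain N ξ σ] (σ j : ℂ) ≤ 𝓝[≠] (σ j : ℂ) :=
    nhdsWithin_mono _ fun z hz => ne_sigma_of_mem_bandDomain hz j hj
  have hnum : Tendsto (fun z => (alphaProd N a : ℂ) * hMinus N a b ξ z +
      Polynomial.aeval z (convNum a b (N - 1))) (𝓝[bandDomain N ξ σ] (σ j : ℂ))
      (𝓝 ((alphaProd N a : ℂ) * hMinus N a b ξ (σ j) +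
        ((convNum a b (N - 1)).eval (σ j) : ℝ))) := by
    rw [← Polynomial.aeval_complex_ofReal]
    have h1 : ContinuousAt (hMinus N a b ξ) (σ j) :=
      ((continuous_discrP H.one_le).continuousAt.sub (H.continuousAt_sqrtDiscr_sigma hjN)).div_const _
    exact ((h1.const_mul _).add (Polynomial.continuous_aeval _).continuousAt).tendsto.mono_left
      nhdsWithin_le_nhds
  have hden : Tendsto (fun z : ℂ => (z - σ j)⁻¹ * Polynomial.aeval z (convDen a b (N - 1)))
      (𝓝[bandDomain N ξ σ] (σ j : ℂ))
      (𝓝 ((convDen a b (N - 1)).derivative.eval (σ j) : ℝ)) := by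
    have h1 := ((convDen a b (N - 1)).hasDerivAt_aeval (σ j : ℂ)).tendsto_slope
    rw [Polynomial.aeval_complex_ofReal] at h1
    refine (h1.mono_left hsub).congr fun z => ?_
    rw [slope_def_module, Polynomial.aeval_complex_ofReal, H.den_eval_sigma hj, Complex.ofReal_zero,
      sub_zero, smul_eq_mul]
  have hquot := hnum.div hden (Complex.ofReal_ne_zero.2 (H.den_derivative_ne_zero hj))
  rw [H.resCoeff_eq hj]
  refine hquot.congr' ?_
  filter_upwards [self_mem_nhdsWithin] with z hz
  have h1 := sub_ne_zero.2 (ne_sigma_of_mem_bandDomain hz j hj)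
  have h2 := H.aeval_den_ne_zero hz
  rw [Pi.div_apply, stieltjesFunction]
  field_simp

theorem bandDensity_eq_realDensity (H : BandData N a b ξ σ) {x : ℝ} (hx : x ∈ stableBands N ξ) :
    bandDensity N a b ξ x = (realDensity N a b x : ℂ) := H.bandDensity_eq hx

theorem sqrtDiscr_div_eq (H : BandData N a b ξ σ) (z : ℂ) {x : ℝ} (hx : x ∈ stableBands N ξ) :
    (-1) ^ (N + 1) / (2 * (Real.pi : ℂ) * Complex.I) *
      (sqrtDiscr N ξ x / ((z - (x : ℂ)) * deltaNN N a b x)) =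
      (realDensity N a b x : ℂ) * (1 / (z - x)) := by
  rw [← H.bandDensity_eq_realDensity hx, bandDensity, mul_comm (z - (x : ℂ)),
    ← div_div (sqrtDiscr N ξ x), mul_one_div, mul_div_assoc]

theorem integral_band (H : BandData N a b ξ σ) {z : ℂ} (hz : z ∈ bandDomain N ξ σ) {m : ℕ}
    (hm : m < N) :
    IntervalIntegrable (fun x : ℝ => sqrtDiscr N ξ x / ((z - (x : ℂ)) * deltaNN N a b x))
        volume (ξ (2 * m + 1)) (ξ (2 * m + 2)) ∧
      (-1) ^ (N + 1) / (2 * (Real.pi : ℂ) * Complex.I) *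
        ∫ x in (ξ (2 * m + 1))..(ξ (2 * m + 2)),
          sqrtDiscr N ξ x / ((z - (x : ℂ)) * deltaNN N a b x) =
      ∫ x in Set.Ioo (ξ (2 * m + 1)) (ξ (2 * m + 2)), (realDensity N a b x : ℂ) * (1 / (z - x)) := by
  have hle := H.left_le_right m
  have hc : (-1 : ℂ) ^ (N + 1) / (2 * (Real.pi : ℂ) * Complex.I) ≠ 0 := by
    simp
  have heq : Set.EqOn (fun x : ℝ => (-1) ^ (N + 1) / (2 * (Real.pi : ℂ) * Complex.I) *
      (sqrtDiscr N ξ x / ((z - (x : ℂ)) * deltaNN N a b x)))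
      (fun x : ℝ => (realDensity N a b x : ℂ) * (1 / (z - x)))
      (Set.Ioo (ξ (2 * m + 1)) (ξ (2 * m + 2))) := fun x hx =>
    H.sqrtDiscr_div_eq z (mem_stableBands_iff.2 ⟨m, hm, Set.Ioo_subset_Icc_self hx⟩)
  constructor
  · rw [intervalIntegrable_iff_integrableOn_Ioo_of_le hle]
    have h1 := H.integrableOn_realDensity_mul (notMem_bands_of_mem_bandDomain hz) hm
    rw [← integrableOn_congr_fun heq measurableSet_Ioo] at h1
    rw [IntegrableOn]
    have h2 := h1.const_mul ((-1 : ℂ) ^ (N + 1) / (2 * (Real.pi : ℂ) * Complex.I))⁻¹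
    simpa only [← mul_assoc, inv_mul_cancel₀ hc, one_mul] using h2
  · rw [intervalIntegral.integral_of_le hle, integral_Ioc_eq_integral_Ioo, ← integral_const_mul]
    exact setIntegral_congr_fun measurableSet_Ioo heq

theorem stableBands_ae_eq :
    stableBands N ξ =ᵐ[volume] ⋃ m ∈ Finset.range N, Set.Ioo (ξ (2 * m + 1)) (ξ (2 * m + 2)) := by
  have h : stableBands N ξ = ⋃ m ∈ Finset.range N, Set.Icc (ξ (2 * m + 1)) (ξ (2 * m + 2)) := by
    ext x
    simp only [mem_stableBands_iff, Set.mem_iUnion, Finset.mem_range, exists_prop]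
  rw [h]
  exact Filter.EventuallyEq.countable_bUnion (Finset.range N).countable_toSet fun m _ =>
    Ioo_ae_eq_Icc.symm

theorem measurable_bandDensity : Measurable (fun x : ℝ => bandDensity N a b ξ x) := by
  unfold bandDensity
  refine Measurable.const_mul (Measurable.div ?_ ?_) _
  · unfold sqrtDiscr
    exact Finset.measurable_fun_prod _ fun i _ => (by fun_prop : Measurable fun x : ℝ =>
      (x : ℂ) - (ξ i : ℂ)).pow_const _
  · simp_rw [deltaNN_eq]
    exact (continuous_const.mul ((Polynomial.continuous_aeval _).comp
      Complex.continuous_ofReal)).measurable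

theorem integral_spectralMeasure (H : BandData N a b ξ σ) {z : ℂ} (hz : z ∈ bandDomain N ξ σ) :
    Integrable (fun x : ℝ => 1 / (z - (x : ℂ))) (spectralMeasure N a b ξ σ) ∧
      ∫ x : ℝ, 1 / (z - (x : ℂ)) ∂(spectralMeasure N a b ξ σ) =
        ∑ j ∈ Finset.Icc 1 (N - 1), resCoeff N a b ξ σ j / (z - σ j) +
        ∑ m ∈ Finset.range N, ∫ x in Set.Ioo (ξ (2 * m + 1)) (ξ (2 * m + 2)),
          (realDensity N a b x : ℂ) * (1 / (z - x)) := by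
  have hzb := notMem_bands_of_mem_bandDomain hz
  have hmeas : Measurable fun x : ℝ => ENNReal.ofReal (bandDensity N a b ξ x).re :=
    ENNReal.measurable_ofReal.comp (Complex.measurable_re.comp measurable_bandDensity)
  have hfin : ∀ᵐ x ∂(volume.restrict (stableBands N ξ)),
      ENNReal.ofReal (bandDensity N a b ξ x).re < ⊤ :=
    Eventually.of_forall fun _ => ENNReal.ofReal_lt_top
  have hsmul : Set.EqOn
      (fun x : ℝ => (ENNReal.ofReal (bandDensity N a b ξ x).re).toReal • (1 / (z - (x : ℂ))))
      (fun x : ℝ => (realDensity N a b x : ℂ) * (1 / (z - x))) (stableBands N ξ) := by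
    intro x hx
    simp only
    rw [ENNReal.toReal_ofReal (H.bandDensity_nonneg hx).2, H.bandDensity_eq_realDensity hx,
      Complex.ofReal_re, Complex.real_smul]
  have hms : MeasurableSet (stableBands N ξ) := (isCompact_stableBands N ξ).measurableSet
  have hIoo : ∀ m ∈ Finset.range N, IntegrableOn (fun x : ℝ => (realDensity N a b x : ℂ) *
      (1 / (z - x))) (Set.Ioo (ξ (2 * m + 1)) (ξ (2 * m + 2))) := fun m hm =>
    H.integrableOn_realDensity_mul hzb (Finset.mem_range.1 hm)
  have hdisj : ((Finset.range N : Finset ℕ) : Set ℕ).Pairwise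
      (Function.onFun Disjoint fun m => Set.Ioo (ξ (2 * m + 1)) (ξ (2 * m + 2))) := by
    intro m hm k hk hmk
    have hm' : m < N := Finset.mem_range.1 hm
    have hk' : k < N := Finset.mem_range.1 hk
    refine Set.disjoint_left.2 fun x hx hx' => ?_
    obtain ⟨h1, h2⟩ := H.mem_gap_of_mem_band hm' hx
    obtain ⟨h3, h4⟩ := H.mem_gap_of_mem_band hk' hx'
    rcases lt_or_gt_of_ne hmk with h | h
    · have := H.sigma_le (i := m + 1) (j := k) h hk'.le; linarith
    · have := H.sigma_le (i := k + 1) (j := m) h hm'.le; linarith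
  -- the absolutely continuous part
  have hac : Integrable (fun x : ℝ => 1 / (z - (x : ℂ)))
      ((volume.restrict (stableBands N ξ)).withDensity
        fun x => ENNReal.ofReal (bandDensity N a b ξ x).re) := by
    rw [integrable_withDensity_iff_integrable_smul' hmeas hfin]
    change IntegrableOn _ _ _
    rw [integrableOn_congr_fun hsmul hms, integrableOn_congr_set_ae stableBands_ae_eq,
      integrableOn_finset_iUnion]
    exact hIoo
  have haci : ∫ x : ℝ, 1 / (z - (x : ℂ)) ∂((volume.restrict (stableBands N ξ)).withDensity
        fun x => ENNReal.ofReal (bandDensity N a b ξ x).re) =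
      ∑ m ∈ Finset.range N, ∫ x in Set.Ioo (ξ (2 * m + 1)) (ξ (2 * m + 2)),
          (realDensity N a b x : ℂ) * (1 / (z - x)) := by
    rw [integral_withDensity_eq_integral_toReal_smul hmeas hfin,
      setIntegral_congr_fun hms hsmul, setIntegral_congr_set stableBands_ae_eq,
      integral_biUnion_finset _ (fun _ _ => measurableSet_Ioo) hdisj hIoo]
  -- the discrete part
  have hd : ∀ j ∈ Finset.Icc 1 (N - 1), Integrable (fun x : ℝ => 1 / (z - (x : ℂ)))
      (ENNReal.ofReal (resCoeff N a b ξ σ j).re • Measure.dirac (σ j)) := fun j _ =>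
    (integrable_dirac (by simp)).smul_measure ENNReal.ofReal_ne_top
  have hdi : Integrable (fun x : ℝ => 1 / (z - (x : ℂ))) (∑ j ∈ Finset.Icc 1 (N - 1),
      ENNReal.ofReal (resCoeff N a b ξ σ j).re • Measure.dirac (σ j)) :=
    integrable_finsetSum_measure.2 hd
  refine ⟨hdi.add_measure hac, ?_⟩
  rw [spectralMeasure, integral_add_measure hdi hac, haci, integral_finsetSum_measure hd]
  congr 1
  refine Finset.sum_congr rfl fun j hj => ?_
  obtain ⟨him, hre⟩ := H.resCoeff_nonneg hj
  have hr : resCoeff N a b ξ σ j = ((resCoeff N a b ξ σ j).re : ℂ) := by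
    apply Complex.ext <;> simp [him]
  rw [integral_smul_measure, integral_dirac, ENNReal.toReal_ofReal hre, Complex.real_smul]
  conv_rhs => rw [hr]
  ring

end BandData

theorem theorem10 (N : ℕ) (hN : 1 ≤ N) (a b : ℤ → ℝ) (ha : ∀ i, 0 < a i)
    (hpa : ∀ i, a (i + N) = a i) (hpb : ∀ i, b (i + N) = b i) :
    ∃ ξ σ : ℕ → ℝ, IsBranchPoints N a b ξ ∧ IsAuxiliarySpectrum N a b σ ∧
      -- `h(σ_j⁻)` is the value of `h` at the point of the curve over `σ_j` in the region `|h| ≤ 1`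
      (∀ j ∈ Finset.Icc 1 (N - 1),
        ((σ j : ℂ), hMinus N a b ξ (σ j)) ∈ spectralCurve N a b ∧ ‖hMinus N a b ξ (σ j)‖ ≤ 1) ∧
      -- the masses are nonnegative, and so is the density on each stable band
      (∀ j ∈ Finset.Icc 1 (N - 1),
        (resCoeff N a b ξ σ j).im = 0 ∧ 0 ≤ (resCoeff N a b ξ σ j).re) ∧
      (∀ x ∈ stableBands N ξ, (bandDensity N a b ξ x).im = 0 ∧ 0 ≤ (bandDensity N a b ξ x).re) ∧
      (∃ φ : ℂ → ℂ, IsStieltjesFunction a b (bandDomain N ξ σ) φ) ∧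
      ∀ φ : ℂ → ℂ, IsStieltjesFunction a b (bandDomain N ξ σ) φ →
        -- the coefficients are the residues of `φ`
        (∀ j ∈ Finset.Icc 1 (N - 1),
          Tendsto (fun z : ℂ => (z - (σ j : ℂ)) * φ z) (𝓝[bandDomain N ξ σ] (σ j : ℂ))
            (𝓝 (resCoeff N a b ξ σ j))) ∧
        -- the explicit formula
        (∀ z ∈ bandDomain N ξ σ,
          (∀ l ∈ Finset.Icc 1 N, IntervalIntegrable
            (fun x : ℝ => sqrtDiscr N ξ x / ((z - (x : ℂ)) * deltaNN N a b x))
            volume (ξ (2 * l - 1)) (ξ (2 * l))) ∧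
          φ z = ∑ j ∈ Finset.Icc 1 (N - 1), resCoeff N a b ξ σ j / (z - (σ j : ℂ)) +
            ∑ l ∈ Finset.Icc 1 N, (-1) ^ (N + 1) / (2 * (Real.pi : ℂ) * Complex.I) *
              ∫ x in (ξ (2 * l - 1))..(ξ (2 * l)),
                sqrtDiscr N ξ x / ((z - (x : ℂ)) * deltaNN N a b x)) ∧
        -- the Cauchy-Stieltjes transform
        (∀ z ∈ bandDomain N ξ σ,
          Integrable (fun x : ℝ => 1 / (z - (x : ℂ))) (spectralMeasure N a b ξ σ) ∧
          φ z = ∫ x : ℝ, 1 / (z - (x : ℂ)) ∂(spectralMeasure N a b ξ σ)) := by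
  obtain ⟨ξ, σ, H⟩ := exists_bandData N hN a b ha hpa
  have hS := H.isStieltjesFunction hpa hpb
  refine ⟨ξ, σ, H.isBranchPoints, H.isAuxiliarySpectrum, fun j hj => ⟨H.sigma_mem_spectralCurve ha hpa hj,
    H.norm_hMinus_sigma_le_one (by have := (Finset.mem_Icc.1 hj).2; omega)⟩,
    fun j hj => H.resCoeff_nonneg hj, fun x hx => H.bandDensity_nonneg hx, ⟨_, hS⟩, fun φ hφ => ?_⟩
  have hφeq := BandData.eqOn_of_isStieltjesFunction hφ hS
  have hformula : ∀ z ∈ bandDomain N ξ σ, φ z = _ := fun z hz =>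
    (hφeq hz).trans (H.stieltjes_formula hz)
  refine ⟨fun j hj => ?_, fun z hz => ⟨fun l hl => ?_, ?_⟩, fun z hz => ⟨?_, ?_⟩⟩
  · refine (H.tendsto_residue hj).congr' ?_
    filter_upwards [self_mem_nhdsWithin] with z hz
    rw [hφeq hz]
  · obtain ⟨h1, h2⟩ := Finset.mem_Icc.1 hl
    obtain ⟨m, rfl⟩ : ∃ m, l = m + 1 := ⟨l - 1, by omega⟩
    exact (H.integral_band hz (m := m) (by omega)).1
  · rw [hformula z hz, sum_Icc_one_eq_sum_range _ N]
    congr 1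
    exact Finset.sum_congr rfl fun m hm => (H.integral_band hz (Finset.mem_range.1 hm)).2.symm
  · exact (H.integral_spectralMeasure hz).1
  · rw [hformula z hz, (H.integral_spectralMeasure hz).2]
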